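/- **Setting** ($\hbar=1$). $N\ge 1$ particles of mass $m>0$ move in the $d$-dimensional box $\Lambda=[0,L]^d$, $d\ge1$, $L>0$, with periodic boundary conditions; $V=L^d$. The Hilbert space $\mathcal H$ consists of all square integrable wave functions of $N$ particles (distinguishable particles), or of the symmetric ones (bosons), or of the antisymmetric ones (spinless fermions). Let $$H_0=\sum_{j=1}^N\frac{|\mathbf p_j|^2}{2m}+\sum_{j<k}w(\mathbf x_j-\mathbf x_k),\qquad U=\sum_{j=1}^N u(\mathbf x_j),\qquad H(\kappa,v)=H_0+\kappa U-vP_a ,$$ where $w$ is real, continuous, even and $L$-periodic, $u$ is real, $C^1$ and $L$-periodic, and $P_a$ is the component of the total momentum $\mathbf P=\sum_j\mathbf p_j$ along a fixed coordinate axis $a$ (for instance the $d$-th). Let $E(\kappa,v)$ be the ground state energy of $H(\kappa,v)$, i.e. the infimum of $\langle\psi,H(\kappa,v)\psi\rangle$ over unit vectors in the domain. Assume that the ground state of $H_0$ is unique up to a scalar factor. The superfluid fraction is $$\frac{\rho_s}{\rho}(\kappa)=1+\frac{2}{Nm}c_2(\kappa),\qquad c_2(\kappa)=\lim_{v\to0}\frac{E(\kappa,v)-E(\kappa,0)}{v^2}.$$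 **Claim.** There is a complete orthonormal system $\{\Omega_{\mathbf k,n}\}$ of $\mathcal H$ with $H_0\Omega_{\mathbf k,n}=E_{\mathbf k,n}\Omega_{\mathbf k,n}$ and $\mathbf P\Omega_{\mathbf k,n}=\mathbf k\,\Omega_{\mathbf k,n}$, $\mathbf k\in\frac{2\pi}{L}\mathbb Z^d$, with a ground state $\Omega_{\mathbf 0,0}$ as one of its members; and there is $r>0$, depending neither on $u$ nor on $\kappa$, such that $E(\kappa,v)=E(\kappa,0)+c_2(\kappa)v^2+O(v^4)$ as $v\to0$ whenever $\sup|\kappa u|\le r$. For every such system put, with $\rho_{\mathbf k}=\sum_je^{-i\mathbf k\cdot\mathbf x_j}$ and $\tilde u(\mathbf k)=\int_\Lambda u(\mathbf x)e^{-i\mathbf k\cdot\mathbf x}d\mathbf x$, $$\tilde S(\mathbf k)=\frac1N\sum_n|\langle\Omega_{\mathbf k,n},\rho_{-\mathbf k}\Omega_{\mathbf 0,0}\rangle|^2,\qquad \Delta(K)=\inf\{E_{\mathbf k,n}-E_{\mathbf 0,0}:\mathbf k\in K,\ (\mathbf k,n)\neq(\mathbf 0,0)\},\qquad \Delta(\tilde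 u)=\Delta(\operatorname{supp}\tilde u)$$ for sets $K$ of momenta. Then $\Delta(K)>0$ whenever there is an excited state with momentum in $K$ (if there is none for $K=\operatorname{supp}\tilde u$ or $K=\{\mathbf p\}$, the sums below over $\mathbf k$ vanish, and the corresponding term is read as $0$), and the following hold. 1. *General potential.* The sum over $\mathbf k\in\frac{2\pi}L\mathbb Z^d$ converges, and as $\kappa\to0$ $$\frac{\rho_s}{\rho}(\kappa)\ \ge\ 1-\frac{2\kappa^2}{m\,\Delta(\tilde u)^3}\sum_{\mathbf k}\left(\frac{k_a|\tilde u(\mathbf k)|}{V}\right)^2\tilde S(\mathbf k)+O(\kappa^3).$$ Moreover $\rho_s/\rho\to1$ as $\kappa\to0$. 2. *Periodic potential.* For $u(\mathbf x)=u_0\cos(\mathbf p\cdot\mathbf x)$ with $u_0\in\mathbb R$, $\mathbf p\in\frac{2\pi}L\mathbb Z^d$, $$\frac{\rho_s}{\rho}(\kappa)\ \ge\ 1-\frac{(p_au_0\kappa)^2}{m\,\Delta(\{\mathbf p\})^3}\tilde S(\mathbf p)+O(\kappa^3).$$ 3. *Random potential.* Let $\tilde u(\mathbf k)$, $\mathbf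 k\in\frac{2\pi}L\mathbb Z^d$, be random variables with finite third absolute moments (for instance Gaussian), mean zero, $\tilde u(-\mathbf k)=\overline{\tilde u(\mathbf k)}$ almost surely and $\langle\tilde u(\mathbf k)\tilde u(\mathbf k')\rangle=\gamma^2V\delta_{\mathbf k+\mathbf k',\mathbf 0}$ (the Fourier coefficients of a random potential with $\langle u(\mathbf x)\rangle=0$ and $\langle u(\mathbf x)u(\mathbf y)\rangle=\gamma^2\delta(\mathbf x-\mathbf y)$). Let $F=-F$ be any finite set of momenta, consider the potential $u(\mathbf x)=\frac1V\sum_{\mathbf k\in F}\tilde u(\mathbf k)e^{i\mathbf k\cdot\mathbf x}$, and let $G_\kappa$ be the event $\frac{|\kappa|}V\sum_{\mathbf k\in F}|\tilde u(\mathbf k)|\le r$. There is a constant $C$ such that for all real $\kappa$ the event $G_\kappa$ has probability at least $1-C|\kappa|^3$, $\rho_s/\rho$ is integrable over $G_\kappa$, and $$\left\langle\frac{\rho_s}{\rho}(\kappa)\,\mathbf 1_{G_\kappa}\right\rangle\ \ge\ 1-\frac{2(\gamma\kappa)^2}{m(E_1-E_0)^3}\,\frac1V\sum_{\mathbf k\in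 F}k_a^2\tilde S(\mathbf k)-C|\kappa|^3,$$ where $E_1-E_0$ is the first excitation energy of $H_0$, the infimum of $E_{\mathbf k,n}-E_{\mathbf 0,0}$ over all $(\mathbf k,n)\ne(\mathbf 0,0)$. -/

import Mathlib

open MeasureTheory Filter Topology Asymptotics

noncomputable section

namespace Superfluid

/-! ### Configuration space and Hilbert space

`N` particles move in the box `[0,L]^d` with periodic boundary conditions (units with `ħ = 1`).
A configuration is recorded by the `N * d` coordinates `y (j, i) = x_j^i / L`, taken modulo `1`. -/

/-- Configurations of `N` particles in the periodic `d`-dimensional box, in units of `L`. -/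
abbrev Config (N d : ℕ) : Type := UnitAddTorus (Fin N × Fin d)

/-- The uniform probability measure on the configuration space. -/
abbrev configMeasure (N d : ℕ) : Measure (Config N d) :=
  Measure.pi fun _ => (AddCircle.haarAddCircle : Measure UnitAddCircle)

/-- Square integrable wave functions of `N` particles in the periodic box. -/
abbrev Wave (N d : ℕ) : Type := Lp ℂ 2 (configMeasure N d)

/-- The plane waves `y ↦ exp (2 π i ∑ n (j, i) y (j, i))`, a Hilbert basis of the wave functions. -/
def planeWave (N d : ℕ) : HilbertBasis (Fin N × Fin d → ℤ) ℂ (Wave N d) :=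
  UnitAddTorus.mFourierBasis

/-- The position `x_j ∈ [0,L)^d` of particle `j`. -/
def position {N d : ℕ} (L : ℝ) (j : Fin N) (y : Config N d) : Fin d → ℝ :=
  fun i => L * (AddCircle.equivIco (1 : ℝ) 0 (y (j, i)) : ℝ)

/-- The wave vector `k = (2π/L) n ∈ (2π/L) ℤ^d`. -/
def waveVector {d : ℕ} (L : ℝ) (n : Fin d → ℤ) : Fin d → ℝ :=
  fun i => 2 * Real.pi / L * n i

/-! ### Particle statistics -/

/-- Distinguishable particles, bosons, or (spinless) fermions. -/
inductive Statistics
  | distinguishable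
  | bose
  | fermi

/-- Relabelling the particles. -/
def relabel {N d : ℕ} (σ : Equiv.Perm (Fin N)) (y : Config N d) : Config N d :=
  fun q => y (σ q.1, q.2)

theorem measurePreserving_relabel {N d : ℕ} (σ : Equiv.Perm (Fin N)) :
    MeasurePreserving (relabel (d := d) σ) (configMeasure N d) (configMeasure N d) := by
  have h := measurePreserving_piCongrLeft
    (fun _ : Fin N × Fin d => (AddCircle.haarAddCircle : Measure UnitAddCircle))
    (Equiv.prodCongr σ.symm (Equiv.refl (Fin d)))
  convert h using 1
  funext y q
  obtain ⟨j, i⟩ := q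
  have := Equiv.piCongrLeft_apply_apply (fun _ : Fin N × Fin d => UnitAddCircle)
    (Equiv.prodCongr σ.symm (Equiv.refl (Fin d))) y (σ j, i)
  simp only [Equiv.prodCongr_apply, Prod.map_apply, Equiv.symm_apply_apply, Equiv.refl_apply]
    at this
  exact this.symm

/-- The unitary operator `(T_σ ψ)(x_1, …, x_N) = ψ(x_{σ 1}, …, x_{σ N})`. -/
def permute {N d : ℕ} (σ : Equiv.Perm (Fin N)) : Wave N d →ₗ[ℂ] Wave N d :=
  (Lp.compMeasurePreservingₗᵢ ℂ (relabel σ) (measurePreserving_relabel σ)).toLinearMap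

/-- The `N`-particle Hilbert space: all wave functions, the symmetric ones, or the
antisymmetric ones. -/
def sector (N d : ℕ) : Statistics → Submodule ℂ (Wave N d)
  | .distinguishable => ⊤
  | .bose => ⨅ σ : Equiv.Perm (Fin N), LinearMap.eqLocus (permute σ) LinearMap.id
  | .fermi => ⨅ σ : Equiv.Perm (Fin N),
      LinearMap.eqLocus (permute σ) (((Equiv.Perm.sign σ : ℤ) : ℂ) • LinearMap.id)

/-! ### Operators -/

/-- The wave functions `ψ` with `∑ |a n|² |⟨e_n, ψ⟩|² < ∞`, where `e_n` are the plane waves. -/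
def diagonalDomain {N d : ℕ} (a : (Fin N × Fin d → ℤ) → ℝ) : Submodule ℂ (Wave N d) where
  carrier := {ψ | Memℓp (fun n => (a n : ℂ) * (planeWave N d).repr ψ n) 2}
  zero_mem' := by
    have e : (fun n => (a n : ℂ) * (planeWave N d).repr (0 : Wave N d) n) = 0 := by
      funext n
      rw [map_zero, lp.coeFn_zero, Pi.zero_apply, mul_zero]
    change Memℓp (fun n => (a n : ℂ) * (planeWave N d).repr (0 : Wave N d) n) 2
    rw [e]
    exact zero_memℓp
  add_mem' := by
    intro ψ φ hψ hφ
    have e : (fun n => (a n : ℂ) * (planeWave N d).repr (ψ + φ) n) =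
        (fun n => (a n : ℂ) * (planeWave N d).repr ψ n) +
          fun n => (a n : ℂ) * (planeWave N d).repr φ n := by
      funext n
      rw [map_add, lp.coeFn_add, Pi.add_apply, mul_add, Pi.add_apply]
    change Memℓp (fun n => (a n : ℂ) * (planeWave N d).repr (ψ + φ) n) 2
    rw [e]
    exact Memℓp.add hψ hφ
  smul_mem' := by
    intro c ψ hψ
    have e : (fun n => (a n : ℂ) * (planeWave N d).repr (c • ψ) n) =
        c • fun n => (a n : ℂ) * (planeWave N d).repr ψ n := by
      funext n
      rw [map_smul, lp.coeFn_smul, Pi.smul_apply, Pi.smul_apply, smul_eq_mul, smul_eq_mul,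
        mul_left_comm]
    change Memℓp (fun n => (a n : ℂ) * (planeWave N d).repr (c • ψ) n) 2
    rw [e]
    exact Memℓp.const_smul hψ c

/-- The sequence `a n ⟨e_n, ψ⟩` as an element of `ℓ²`. -/
def diagonalSeq {N d : ℕ} (a : (Fin N × Fin d → ℤ) → ℝ) (ψ : diagonalDomain a) :
    lp (fun _ : Fin N × Fin d → ℤ => ℂ) 2 :=
  ⟨fun n => (a n : ℂ) * (planeWave N d).repr (ψ : Wave N d) n, ψ.2⟩

/-- The operator with (maximal) domain `{ψ | ∑ |a n|² |⟨e_n, ψ⟩|² < ∞}` that multiplies the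
coefficient of `ψ` along the plane wave `e_n` by `a n`. -/
def diagonalOp {N d : ℕ} (a : (Fin N × Fin d → ℤ) → ℝ) : Wave N d →ₗ.[ℂ] Wave N d where
  domain := diagonalDomain a
  toFun :=
    { toFun := fun ψ => (planeWave N d).repr.symm (diagonalSeq a ψ)
      map_add' := by
        intro ψ φ
        have e : diagonalSeq a (ψ + φ) = diagonalSeq a ψ + diagonalSeq a φ := by
          apply Subtype.ext
          funext n
          change (a n : ℂ) * (planeWave N d).repr ((ψ : Wave N d) + φ) n =
            (a n : ℂ) * (planeWave N d).repr (ψ : Wave N d) n +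
              (a n : ℂ) * (planeWave N d).repr (φ : Wave N d) n
          rw [map_add, lp.coeFn_add, Pi.add_apply, mul_add]
        rw [e, map_add]
      map_smul' := by
        intro c ψ
        have e : diagonalSeq a (c • ψ) = c • diagonalSeq a ψ := by
          apply Subtype.ext
          funext n
          change (a n : ℂ) * (planeWave N d).repr (c • (ψ : Wave N d)) n =
            c * ((a n : ℂ) * (planeWave N d).repr (ψ : Wave N d) n)
          rw [map_smul, lp.coeFn_smul, Pi.smul_apply, smul_eq_mul, mul_left_comm]
        rw [e, map_smul, RingHom.id_apply] }

/-- The wave functions `ψ` with `f ψ ∈ L²`. -/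
def mulDomain {N d : ℕ} (f : Config N d → ℂ) : Submodule ℂ (Wave N d) where
  carrier := {ψ | MemLp (fun y => f y * ψ y) 2 (configMeasure N d)}
  zero_mem' := by
    refine (MemLp.zero' (ε := ℂ)).ae_eq ?_
    filter_upwards [Lp.coeFn_zero ℂ 2 (configMeasure N d)] with y hy
    rw [hy, Pi.zero_apply, mul_zero]
  add_mem' := by
    intro ψ φ hψ hφ
    refine (MemLp.add hψ hφ).ae_eq ?_
    filter_upwards [Lp.coeFn_add ψ φ] with y hy
    rw [hy, Pi.add_apply, Pi.add_apply, mul_add]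
  smul_mem' := by
    intro c ψ hψ
    refine (MemLp.const_smul hψ c).ae_eq ?_
    filter_upwards [Lp.coeFn_smul c ψ] with y hy
    rw [hy, Pi.smul_apply, Pi.smul_apply, smul_eq_mul, smul_eq_mul, mul_left_comm]

/-- The operator of multiplication by the function `f`, on its maximal domain
`{ψ | f ψ ∈ L²}`. -/
def mulOp {N d : ℕ} (f : Config N d → ℂ) : Wave N d →ₗ.[ℂ] Wave N d where
  domain := mulDomain f
  toFun :=
    { toFun := fun ψ => MemLp.toLp (fun y => f y * (ψ : Wave N d) y) ψ.2
      map_add' := by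
        intro ψ φ
        have h1 : MemLp (fun y => f y * (ψ : Wave N d) y) 2 (configMeasure N d) := ψ.2
        have h2 : MemLp (fun y => f y * (φ : Wave N d) y) 2 (configMeasure N d) := φ.2
        refine Eq.trans ?_ (MemLp.toLp_add h1 h2)
        apply MemLp.toLp_congr
        filter_upwards [Lp.coeFn_add (ψ : Wave N d) (φ : Wave N d)] with y hy
        change f y * ((ψ : Wave N d) + (φ : Wave N d) : Wave N d) y =
          f y * (ψ : Wave N d) y + f y * (φ : Wave N d) y
        rw [hy, Pi.add_apply, mul_add]
      map_smul' := by
        intro c ψ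
        have h1 : MemLp (fun y => f y * (ψ : Wave N d) y) 2 (configMeasure N d) := ψ.2
        refine Eq.trans ?_ (MemLp.toLp_const_smul c h1)
        apply MemLp.toLp_congr
        filter_upwards [Lp.coeFn_smul c (ψ : Wave N d)] with y hy
        change f y * (c • (ψ : Wave N d) : Wave N d) y = c * (f y * (ψ : Wave N d) y)
        rw [hy, Pi.smul_apply, smul_eq_mul, mul_left_comm] }

/-- The kinetic energy `∑_{j,i} (p_j^i)² / (2m)`. -/
def kinetic (N d : ℕ) (L m : ℝ) : Wave N d →ₗ.[ℂ] Wave N d :=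
  diagonalOp fun n => ∑ j, ∑ i, waveVector L (fun i' => n (j, i')) i ^ 2 / (2 * m)

/-- The component `P_i = ∑_j p_j^i` of the total momentum. -/
def totalMomentum (N d : ℕ) (L : ℝ) (i : Fin d) : Wave N d →ₗ.[ℂ] Wave N d :=
  diagonalOp fun n => ∑ j, waveVector L (fun i' => n (j, i')) i

/-- The interaction `∑_{j<k} w(x_j - x_k)`. -/
def interaction (N d : ℕ) (L : ℝ) (w : (Fin d → ℝ) → ℝ) : Wave N d →ₗ.[ℂ] Wave N d :=
  mulOp fun y =>
    ((∑ j : Fin N, ∑ k ∈ Finset.Ioi j, w (position L j y - position L k y) : ℝ) : ℂ)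

/-- The one-body potential `U = ∑_j u(x_j)`. -/
def oneBody (N d : ℕ) (L : ℝ) (u : (Fin d → ℝ) → ℝ) : Wave N d →ₗ.[ℂ] Wave N d :=
  mulOp fun y => ((∑ j : Fin N, u (position L j y) : ℝ) : ℂ)

/-- `H₀`, the Hamiltonian without nonuniform potential. -/
def freeHamiltonian (N d : ℕ) (L m : ℝ) (w : (Fin d → ℝ) → ℝ) : Wave N d →ₗ.[ℂ] Wave N d :=
  kinetic N d L m + interaction N d L w

/-- `H(κ,v) = H₀ + κ U - v P_a`: the Hamiltonian with nonuniform potential of strength `κ`, when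
the walls slide with velocity `v` along the axis `a`. -/
def hamiltonian (N d : ℕ) (L m : ℝ) (w : (Fin d → ℝ) → ℝ) (a : Fin d) (u : (Fin d → ℝ) → ℝ)
    (κ v : ℝ) : Wave N d →ₗ.[ℂ] Wave N d :=
  freeHamiltonian N d L m w + (κ : ℂ) • oneBody N d L u - (v : ℂ) • totalMomentum N d L a

/-- `ψ` satisfies `A ψ = e ψ` (in particular it lies in the domain of `A`). -/
def EigenEq {N d : ℕ} (A : Wave N d →ₗ.[ℂ] Wave N d) (e : ℝ) (ψ : Wave N d) : Prop :=
  ∃ h : ψ ∈ A.domain, A ⟨ψ, h⟩ = (e : ℂ) • ψ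

/-- The ground state energy of `A`: the infimum of `⟨ψ, A ψ⟩` over the unit vectors of the
`N`-particle Hilbert space that lie in the domain of `A`. -/
def groundEnergy {N d : ℕ} (s : Statistics) (A : Wave N d →ₗ.[ℂ] Wave N d) : ℝ :=
  sInf {e : ℝ | ∃ ψ : A.domain, (ψ : Wave N d) ∈ sector N d s ∧ ‖(ψ : Wave N d)‖ = 1 ∧
    e = (inner ℂ (ψ : Wave N d) (A ψ)).re}

/-- `A` has a ground state, unique up to a scalar factor. -/
def HasUniqueGroundState {N d : ℕ} (s : Statistics) (A : Wave N d →ₗ.[ℂ] Wave N d) : Prop :=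
  ∃ Ω ∈ sector N d s, Ω ≠ 0 ∧ EigenEq A (groundEnergy s A) Ω ∧
    ∀ ψ ∈ sector N d s, EigenEq A (groundEnergy s A) ψ → ∃ c : ℂ, ψ = c • Ω

/-! ### The superfluid fraction -/

/-- The coefficient of `v²` in the expansion of `E(v)` at `v = 0`, for a function whose expansion
has no linear term. -/
def quadraticCoeff (E : ℝ → ℝ) : ℝ :=
  limUnder (𝓝[≠] (0 : ℝ)) fun v => (E v - E 0) / v ^ 2

/-- The ground state energy `E(κ,v)` of `H(κ,v)`. -/
def wallEnergy (s : Statistics) (N d : ℕ) (L m : ℝ) (w : (Fin d → ℝ) → ℝ) (a : Fin d)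
    (u : (Fin d → ℝ) → ℝ) (κ v : ℝ) : ℝ :=
  groundEnergy s (hamiltonian N d L m w a u κ v)

/-- The superfluid fraction `ρ_s(κ)/ρ = 1 + (2/(N m)) c₂(κ)`, where `c₂(κ)` is the coefficient of
`v²` in `E(κ,v)`. -/
def superfluidFraction (s : Statistics) (N d : ℕ) (L m : ℝ) (w : (Fin d → ℝ) → ℝ) (a : Fin d)
    (u : (Fin d → ℝ) → ℝ) (κ : ℝ) : ℝ :=
  1 + 2 / (N * m) * quadraticCoeff (wallEnergy s N d L m w a u κ)

/-! ### Potentials, density fluctuations, excitation energies -/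

/-- The function `f` on `ℝ^d` is a function on the periodic box. -/
def BoxPeriodic {d : ℕ} (L : ℝ) (f : (Fin d → ℝ) → ℝ) : Prop :=
  ∀ (x : Fin d → ℝ) (i : Fin d), f (x + Pi.single i L) = f x

/-- A sufficiently smooth one-body potential on the periodic box. -/
structure IsPotential {d : ℕ} (L : ℝ) (u : (Fin d → ℝ) → ℝ) : Prop where
  contDiff : ContDiff ℝ 1 u
  periodic : BoxPeriodic L u

/-- The plane wave `exp (i k·x)` of the wave vector `k = (2π/L) n`. -/
def cexpWave {d : ℕ} (L : ℝ) (n : Fin d → ℤ) (x : Fin d → ℝ) : ℂ :=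
  Complex.exp (Complex.I * ((∑ i, waveVector L n i * x i : ℝ) : ℂ))

/-- The Fourier transform `ũ(k) = ∫_{[0,L]^d} u(x) exp (-i k·x) dx`, `k = (2π/L) n`. -/
def fourierPotential {d : ℕ} (L : ℝ) (u : (Fin d → ℝ) → ℝ) (n : Fin d → ℤ) : ℂ :=
  ∫ x in Set.Icc (0 : Fin d → ℝ) (fun _ => L), (u x : ℂ) * cexpWave L (-n) x

/-- The function `∑_j exp (-i k·x_j)` of the configuration, `k = (2π/L) n`. -/
def densityFun {N d : ℕ} (L : ℝ) (n : Fin d → ℤ) (y : Config N d) : ℂ :=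
  ∑ j : Fin N, cexpWave L (-n) (position L j y)

theorem norm_cexpWave {d : ℕ} (L : ℝ) (n : Fin d → ℤ) (x : Fin d → ℝ) : ‖cexpWave L n x‖ = 1 := by
  rw [cexpWave, mul_comm, Complex.norm_exp_ofReal_mul_I]

theorem measurable_position {N d : ℕ} (L : ℝ) (j : Fin N) :
    Measurable (position (N := N) (d := d) L j) := by
  refine measurable_pi_lambda _ fun i => ?_
  have h : Measurable fun t : UnitAddCircle => (AddCircle.equivIco (1 : ℝ) 0 t : ℝ) :=
    measurable_subtype_coe.comp (AddCircle.measurableEquivIco (1 : ℝ) 0).measurable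
  exact (h.comp (measurable_pi_apply (j, i))).const_mul L

theorem mem_domain_density {N d : ℕ} (L : ℝ) (n : Fin d → ℤ) (ψ : Wave N d) :
    ψ ∈ (mulOp (densityFun (N := N) L n)).domain := by
  have hc : Continuous (cexpWave (d := d) L (-n)) := by
    unfold cexpWave
    fun_prop
  have hm : Measurable (densityFun (N := N) (d := d) L n) := by
    unfold densityFun
    exact Finset.measurable_sum _ fun j _ => hc.measurable.comp (measurable_position L j)
  have hb : ∀ y, ‖densityFun (N := N) (d := d) L n y‖ ≤ (N : ℝ) := by
    intro y
    refine (norm_sum_le _ _).trans ?_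
    simp [norm_cexpWave]
  change MemLp (fun y => densityFun L n y * ψ y) 2 (configMeasure N d)
  refine MemLp.of_le_mul (c := N) (Lp.memLp ψ)
    (hm.aestronglyMeasurable.mul (Lp.aestronglyMeasurable ψ)) (ae_of_all _ fun y => ?_)
  rw [norm_mul]
  exact mul_le_mul_of_nonneg_right (hb y) (norm_nonneg _)

/-- The (everywhere defined) density operator `ρ_k = ∑_j exp (-i k·x_j)`, `k = (2π/L) n`. -/
def density {N d : ℕ} (L : ℝ) (n : Fin d → ℤ) (ψ : Wave N d) : Wave N d :=
  mulOp (densityFun (N := N) L n) ⟨ψ, mem_domain_density L n ψ⟩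

/-- A complete orthonormal system `{Ω_{k,n}}` of simultaneous eigenvectors of `H₀` and of the total
momentum in the `N`-particle Hilbert space, with one vector of lowest energy marked as the ground
state. The pairs `(k,n)` are the indices `i : ι`, with `k = (2π/L) * momentum i`. -/
structure JointEigenbasis (s : Statistics) (N d : ℕ) (L m : ℝ) (w : (Fin d → ℝ) → ℝ) where
  ι : Type
  state : ι → Wave N d
  energy : ι → ℝ
  momentum : ι → Fin d → ℤ
  ground : ι
  state_mem : ∀ i, state i ∈ sector N d s
  orthonormal : Orthonormal ℂ state
  complete : sector N d s ≤ (Submodule.span ℂ (Set.range state)).topologicalClosure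
  energy_eq : ∀ i, EigenEq (freeHamiltonian N d L m w) (energy i) (state i)
  momentum_eq : ∀ i μ, EigenEq (totalMomentum N d L μ) (waveVector L (momentum i) μ) (state i)
  ground_le : ∀ i, energy ground ≤ energy i

namespace JointEigenbasis

variable {s : Statistics} {N d : ℕ} {L m : ℝ} {w : (Fin d → ℝ) → ℝ}

/-- The static structure factor `S̃(k) = (1/N) ∑_n |⟨Ω_{k,n}, ρ_{-k} Ω_{0,0}⟩|²`. -/
def structureFactor (B : JointEigenbasis s N d L m w) (k : Fin d → ℤ) : ℝ :=
  1 / N * ∑' i : {i : B.ι // B.momentum i = k},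
    ‖inner ℂ (B.state i) (density L (-k) (B.state B.ground))‖ ^ 2

/-- The excitation energies `E_{k,n} - E_{0,0}`, `(k,n) ≠ (0,0)`, at momenta in the set `K`. -/
def excitations (B : JointEigenbasis s N d L m w) (K : Set (Fin d → ℤ)) : Set ℝ :=
  {ω | ∃ i, i ≠ B.ground ∧ B.momentum i ∈ K ∧ ω = B.energy i - B.energy B.ground}

/-- The infimum `Δ` of the excitation energies at momenta in the set `K`. -/
def gap (B : JointEigenbasis s N d L m w) (K : Set (Fin d → ℤ)) : ℝ :=
  sInf (B.excitations K)

end JointEigenbasis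

/-! ### Random potentials -/

/-- `ξ k` are the Fourier coefficients of a random potential with mean zero and covariance
`⟨u(x) u(y)⟩ = γ² δ(x - y)` in a periodic box of volume `V`. Third moments are required to be
finite, as they are for a Gaussian random potential. -/
structure IsDeltaCorrelated {d : ℕ} {Γ : Type*} [MeasurableSpace Γ] (μ : Measure Γ) (V γ : ℝ)
    (ξ : (Fin d → ℤ) → Γ → ℂ) : Prop where
  memLp : ∀ k, MemLp (ξ k) 3 μ
  conj : ∀ k, ∀ᵐ ω ∂μ, ξ (-k) ω = (starRingEnd ℂ) (ξ k ω)
  mean : ∀ k, ∫ ω, ξ k ω ∂μ = 0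
  cov : ∀ k k', ∫ ω, ξ k ω * ξ k' ω ∂μ = if k + k' = 0 then ((γ ^ 2 * V : ℝ) : ℂ) else 0

/-- The potential `(1/V) ∑_{k ∈ F} c(k) exp (i k·x)` with the finitely many Fourier coefficients
`c(k)`, `k ∈ F`; the sum is real when `F = -F` and `c(-k)` is the conjugate of `c(k)`. -/
def trigPotential {d : ℕ} (L : ℝ) (F : Finset (Fin d → ℤ)) (c : (Fin d → ℤ) → ℂ)
    (x : Fin d → ℝ) : ℝ :=
  (1 / ((L ^ d : ℝ) : ℂ) * ∑ k ∈ F, c k * cexpWave L k x).re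

/-- The event `|κ| (1/V) ∑_{k ∈ F} |ξ k| ≤ r`, on which `|κ u| ≤ r` for the random potential `u`
with the Fourier coefficients `ξ k`, `k ∈ F`. -/
def smallEvent {d : ℕ} {Γ : Type*} (L r : ℝ) (F : Finset (Fin d → ℤ))
    (ξ : (Fin d → ℤ) → Γ → ℂ) (κ : ℝ) : Set Γ :=
  {ω | |κ| * (1 / L ^ d * ∑ k ∈ F, ‖ξ k ω‖) ≤ r}

end Superfluid

end

/-! Write `A = K + W` for `H₀` (kinetic energy plus bounded interaction), `e` and `Ω` for its ground
energy and state, `B = κU` and `P = P_a`. No analytic perturbation theory is used, only variational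
bounds and the solvability of linear equations on the orthogonal complement of a gapped ground
state.

`K` is diagonal in plane waves and has compact resolvent, so uniqueness of `Ω` yields a gap `g`
(`IsKinetic.exists_gap`), of which `g/2` survives when `4‖B‖ ≤ g` (`GappedGround.exists_pert`). As
`‖κU‖ ≤ N sup|κu|`, the choice `r = g/(4N)` works for all potentials at once.

Let `Ω'`, `e'` be the ground state and energy of `A + B`. Complex conjugation commutes with `A + B`
and reverses `P`, whence `⟨Ω', PΩ'⟩ = 0`, and `(A + B - e')η = PΩ'` has a solution `η ⊥ Ω'`. The
trial vector `Ω' + vη` bounds the energy from above, and splitting an arbitrary vector along it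
bounds the energy from below: `E(v) = e' - t v² + O(v⁴)` with `t = ⟨η, PΩ'⟩`
(`GappedGround.expansion`). There is no cubic term because conjugation also gives `⟨η, Pη⟩ = 0`.
Hence `ρ_s/ρ = 1 - 2t/(Nm)`.

By the same symmetry `PΩ = 0`, so `t` is of second order in `B`. `GappedGround.response_le` shows `t
≤ ⟨ζ, Pχ₁⟩ + O(‖B‖³)`, where `(A - e)χ₁ = BΩ - ⟨Ω, BΩ⟩Ω` and `(A - e)ζ = Pχ₁`. In joint eigenvectors
of `H₀` and momentum (`hasSum_response`) the main term is the sum of `k_a² |⟨Ω_{k,n}, BΩ⟩|² /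
(E_{k,n} - E_{0,0})³`. The matrix elements factor as `κ ũ(k)/V` times those of `ρ_{-k}`
(`inner_oneBodyMul`). Replacing every denominator by `Δ³` and summing over `n` leaves the structure
factor (`JointEigenbasis.exists_response_le`).

The error depends on the potential only through `sup|κu|`, with constants fixed by `H₀`. The bound
can therefore be averaged over random potentials, Markov's inequality for third moments disposing of
the event on which the potential is large. -/

noncomputable section

namespace Superfluid

/-! ### Semibounded operators with compact resolvent: ground states, gaps, reduced resolvents. -/

section Abstract

variable {H : Type*} [NormedAddCommGroup H] [InnerProductSpace ℂ H]

local notation "⟪" x ", " y "⟫" => inner ℂ x y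

/-- The (real) quadratic form `⟨ψ, A ψ⟩` of a densely defined operator. -/
def form {D : Submodule ℂ H} (A : D →ₗ[ℂ] H) (ψ : D) : ℝ := (⟪(ψ : H), A ψ⟫).re

/-- `A` is symmetric on its domain `D`. -/
def SymmOn {D : Submodule ℂ H} (A : D →ₗ[ℂ] H) : Prop :=
  ∀ ψ φ : D, ⟪A ψ, (φ : H)⟫ = ⟪(ψ : H), A φ⟫

/-- A bounded operator is symmetric. -/
def BddSymm (W : H →L[ℂ] H) : Prop := ∀ ψ φ : H, ⟪W ψ, φ⟫ = ⟪ψ, W φ⟫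

/-- A nonnegative symmetric operator with compact resolvent. -/
structure IsKinetic {D : Submodule ℂ H} (K : D →ₗ[ℂ] H) : Prop where
  symm : SymmOn K
  nonneg : ∀ ψ : D, 0 ≤ form K ψ
  resolvent : ∀ c : ℝ, 0 < c → ∃ G : H →L[ℂ] H, IsCompactOperator G ∧
    ∀ f, ∃ h : G f ∈ D, K ⟨G f, h⟩ + (c : ℂ) • G f = f

/-- A symmetric operator, bounded below, with compact resolvent. -/
structure HasCompactResolvent {D : Submodule ℂ H} (A : D →ₗ[ℂ] H) : Prop where
  symm : SymmOn A
  resolvent : ∃ c : ℝ, 0 ≤ c ∧ (∀ ψ : D, ‖(ψ : H)‖ ^ 2 ≤ form A ψ + c * ‖(ψ : H)‖ ^ 2) ∧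
    ∃ T : H →L[ℂ] H, IsCompactOperator T ∧ ∀ f, ∃ h : T f ∈ D, A ⟨T f, h⟩ + (c : ℂ) • T f = f

/-- The sum of an operator and an everywhere defined bounded operator. -/
def pert {D : Submodule ℂ H} (K : D →ₗ[ℂ] H) (W : H →L[ℂ] H) : D →ₗ[ℂ] H :=
  K + W.toLinearMap ∘ₗ D.subtype

theorem pert_apply {D : Submodule ℂ H} (K : D →ₗ[ℂ] H) (W : H →L[ℂ] H) (ψ : D) :
    pert K W ψ = K ψ + W ψ := rfl

theorem SymmOn.pert {D : Submodule ℂ H} {K : D →ₗ[ℂ] H} (hK : SymmOn K) {W : H →L[ℂ] H}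
    (hW : BddSymm W) : SymmOn (pert K W) := by
  intro ψ φ
  rw [pert_apply, pert_apply, inner_add_left, inner_add_right, hK, hW]

theorem form_pert {D : Submodule ℂ H} (K : D →ₗ[ℂ] H) (W : H →L[ℂ] H) (ψ : D) :
    form (pert K W) ψ = form K ψ + (⟪(ψ : H), W ψ⟫).re := by
  rw [form, form, pert_apply, inner_add_right, Complex.add_re]

theorem abs_re_inner_apply_le (W : H →L[ℂ] H) (x y : H) :
    |(⟪x, W y⟫).re| ≤ ‖W‖ * (‖x‖ * ‖y‖) := by
  refine (Complex.abs_re_le_norm _).trans ((norm_inner_le_norm _ _).trans ?_)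
  calc ‖x‖ * ‖W y‖ ≤ ‖x‖ * (‖W‖ * ‖y‖) := by gcongr; exact W.le_opNorm y
    _ = _ := by ring

theorem re_inner_le_norm_mul (x y : H) : (⟪x, y⟫).re ≤ ‖x‖ * ‖y‖ :=
  (Complex.re_le_norm _).trans (norm_inner_le_norm _ _)

theorem re_inner_self (x : H) : (⟪x, x⟫).re = ‖x‖ ^ 2 := by
  rw [inner_self_eq_norm_sq_to_K]; norm_cast

theorem re_inner_ofReal_smul_self (c : ℝ) (x : H) : (⟪x, (c : ℂ) • x⟫).re = c * ‖x‖ ^ 2 := by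
  rw [inner_smul_right, Complex.re_ofReal_mul, re_inner_self]

/-- A symmetric operator whose form is at least `δ ‖ψ‖²` satisfies `δ ‖ψ‖ ≤ ‖A ψ‖`. -/
theorem mul_norm_le_of_re_inner {δ : ℝ} {x y : H} (h : δ * ‖x‖ ^ 2 ≤ (⟪x, y⟫).re) :
    δ * ‖x‖ ≤ ‖y‖ := by
  rcases eq_or_ne x 0 with rfl | hx
  · simp
  have hx' : 0 < ‖x‖ := norm_pos_iff.2 hx
  have := h.trans (re_inner_le_norm_mul x y)
  nlinarith

/-- A Cauchy–Schwarz inequality for the form of `T` that avoids square roots of operators: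
positivity at `x - s T x` with `s = 1/‖T‖` gives `2s‖Tx‖² ≤ ⟨Tx, x⟩ + s²⟨T²x, Tx⟩`, and the last
term is at most `s‖Tx‖²`. -/
theorem sq_norm_apply_le_of_nonneg [CompleteSpace H] {T : H →L[ℂ] H} (hs : BddSymm T)
    (hp : ∀ x, 0 ≤ (⟪T x, x⟫).re) (x : H) : ‖T x‖ ^ 2 ≤ ‖T‖ * (⟪T x, x⟫).re := by
  rcases eq_or_ne ‖T‖ 0 with h0 | h0
  · have : T = 0 := norm_eq_zero.1 h0
    simp [this]
  have hT : 0 < ‖T‖ := lt_of_le_of_ne (norm_nonneg _) (Ne.symm h0)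
  set s : ℝ := 1 / ‖T‖ with hsdef
  have h1 := hp (x - (s : ℂ) • T x)
  have e1 : ⟪T (x - (s : ℂ) • T x), x - (s : ℂ) • T x⟫ =
      ⟪T x, x⟫ - (s : ℂ) * ⟪T x, T x⟫ - ((s : ℂ) * ⟪T x, T x⟫ - (s : ℂ) * ((s : ℂ) *
        ⟪T (T x), T x⟫)) := by
    rw [map_sub, map_smul, inner_sub_left, inner_sub_right, inner_sub_right, inner_smul_right,
      inner_smul_left, inner_smul_left, inner_smul_right, hs (T x) x, Complex.conj_ofReal]
  rw [e1] at h1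
  simp only [Complex.sub_re, Complex.re_ofReal_mul, re_inner_self] at h1
  have h2 : (⟪T (T x), T x⟫).re ≤ ‖T‖ * ‖T x‖ ^ 2 := by
    refine (re_inner_le_norm_mul _ _).trans ?_
    have := T.le_opNorm (T x)
    nlinarith [norm_nonneg (T x)]
  have h3 : s * ‖T‖ = 1 := by rw [hsdef]; field_simp
  have hs0 : 0 < s := by rw [hsdef]; positivity
  have h4 : s * (s * (⟪T (T x), T x⟫).re) ≤ s * ‖T x‖ ^ 2 := by
    have : s * (s * (⟪T (T x), T x⟫).re) ≤ s * (s * (‖T‖ * ‖T x‖ ^ 2)) := by gcongr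
    refine this.trans (le_of_eq ?_)
    rw [← mul_assoc s ‖T‖, h3, one_mul]
  have h5 : s * ‖T x‖ ^ 2 ≤ (⟪T x, x⟫).re := by linarith
  have h6 := mul_le_mul_of_nonneg_left h5 hT.le
  rwa [← mul_assoc, mul_comm ‖T‖ s, h3, one_mul] at h6

/-- Fredholm alternative: otherwise `‖T‖` lies in the resolvent set and the Rayleigh quotients stay
below `‖T‖ - ε`. But `‖T‖` is the supremum of their absolute values, which positivity makes
redundant. -/
theorem hasEigenvalue_norm_of_nonneg [CompleteSpace H] [Nontrivial H] {T : H →L[ℂ] H}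
    (hc : IsCompactOperator T) (hs : BddSymm T) (hp : ∀ x, 0 ≤ (⟪T x, x⟫).re) (h0 : T ≠ 0) :
    ∃ Ω : H, ‖Ω‖ = 1 ∧ T Ω = (‖T‖ : ℂ) • Ω := by
  have hT : 0 < ‖T‖ := norm_pos_iff.2 h0
  have hμ : (‖T‖ : ℂ) ≠ 0 := by exact_mod_cast hT.ne'
  have hev : Module.End.HasEigenvalue (T : Module.End ℂ H) (‖T‖ : ℂ) := by
    rcases hc.hasEigenvalue_or_mem_resolventSet hμ with h | h
    · exact h
    · exfalso
      obtain ⟨ε, hε, hle⟩ := T.rayleighQuotient_le_of_norm_mem_resolventSet (𝕜 := ℂ) h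
      have hn := T.norm_eq_iSup_rayleighQuotient (𝕜 := ℂ) hs
      have : ‖T‖ ≤ ‖T‖ - ε := by
        nth_rewrite 1 [hn]
        refine ciSup_le fun x => ?_
        rw [abs_of_nonneg]
        · exact hle x
        · exact div_nonneg (hp x) (by positivity)
      linarith
  obtain ⟨v, hv⟩ := hev.exists_hasEigenvector
  have hv0 : ‖v‖ ≠ 0 := norm_ne_zero_iff.2 hv.2
  refine ⟨((‖v‖⁻¹ : ℝ) : ℂ) • v, ?_, ?_⟩
  · rw [norm_smul, Complex.norm_real, norm_inv, norm_norm, inv_mul_cancel₀ hv0]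
  · have := hv.apply_eq_smul
    rw [map_smul]
    change _ • (T : Module.End ℂ H) v = _
    rw [this, smul_comm]

variable {D : Submodule ℂ H}

/-- The ground state energy of `A - v P` on the domain of `A`. -/
def infForm (A P : D →ₗ[ℂ] H) (v : ℝ) : ℝ :=
  sInf {e : ℝ | ∃ ψ : D, ‖(ψ : H)‖ = 1 ∧ e = form (A - (v : ℂ) • P) ψ}

/-- Neumann series: with `c = ‖W‖ + 1` the resolvent `G = (K + c)⁻¹` has norm at most `1/c`, so `1 +
WG` is invertible and `G(1 + WG)⁻¹`, still compact, inverts `K + W + c`. -/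
theorem IsKinetic.hasCompactResolvent_pert [CompleteSpace H] {K : D →ₗ[ℂ] H} (hK : IsKinetic K)
    {W : H →L[ℂ] H} (hW : BddSymm W) : HasCompactResolvent (pert K W) := by
  refine ⟨hK.symm.pert hW, ‖W‖ + 1, by positivity, fun ψ => ?_, ?_⟩
  · rw [form_pert]
    have h1 := hK.nonneg ψ
    have h2 := neg_le_of_abs_le (abs_re_inner_apply_le W ψ ψ)
    nlinarith
  · set c : ℝ := ‖W‖ + 1
    have hc : 0 < c := by positivity
    obtain ⟨G, hG, hGf⟩ := hK.resolvent c hc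
    have hGn : ‖G‖ ≤ 1 / c := by
      refine G.opNorm_le_bound (by positivity) fun f => ?_
      obtain ⟨h, e⟩ := hGf f
      have h1 := hK.nonneg ⟨G f, h⟩
      have h2 : c * ‖G f‖ ^ 2 ≤ (⟪G f, f⟫).re := by
        nth_rewrite 3 [← e]
        rw [inner_add_right, Complex.add_re, re_inner_ofReal_smul_self]
        exact le_add_of_nonneg_left h1
      have h3 := mul_norm_le_of_re_inner h2
      rw [one_div, inv_mul_eq_div, le_div_iff₀ hc]
      linarith
    have hlt : ‖-(W ∘L G)‖ < 1 := by
      rw [norm_neg]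
      refine (W.opNorm_comp_le G).trans_lt ?_
      calc ‖W‖ * ‖G‖ ≤ ‖W‖ * (1 / c) := by gcongr
        _ < 1 := by rw [mul_one_div, div_lt_one hc]; exact lt_add_one _
    set u := Units.oneSub (-(W ∘L G)) hlt
    refine ⟨G ∘L (↑u⁻¹ : H →L[ℂ] H), hG.comp_clm _, fun f => ?_⟩
    set g := (↑u⁻¹ : H →L[ℂ] H) f with hg
    obtain ⟨h, e⟩ := hGf g
    refine ⟨h, ?_⟩
    have hu : (u : H →L[ℂ] H) g = f := by
      rw [hg, ← mul_apply_eq_comp, Units.mul_inv]; rfl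
    have hu' : g + W (G g) = f := by
      rw [← hu]; simp [u, Units.val_oneSub]
    rw [pert_apply]
    change K ⟨G g, h⟩ + W (G g) + (c : ℂ) • G g = f
    rw [← hu', add_right_comm, e]

theorem form_add_smul (A : D →ₗ[ℂ] H) (c : ℝ) (ψ : D) :
    (⟪(ψ : H), A ψ + (c : ℂ) • (ψ : H)⟫).re = form A ψ + c * ‖(ψ : H)‖ ^ 2 := by
  rw [inner_add_right, Complex.add_re, re_inner_ofReal_smul_self, form]

/-- A right inverse of `A + c` is automatically symmetric and two-sided, because `A + c` is
symmetric and at least `1`, hence injective. -/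
theorem HasCompactResolvent.exists_inverse {A : D →ₗ[ℂ] H} (hA : HasCompactResolvent A) :
    ∃ c : ℝ, 0 ≤ c ∧ ∃ T : H →L[ℂ] H, IsCompactOperator T ∧ BddSymm T ∧
      (∀ f, ‖T f‖ ^ 2 ≤ (⟪T f, f⟫).re) ∧
      (∀ f, ∃ h : T f ∈ D, A ⟨T f, h⟩ + (c : ℂ) • T f = f) ∧
      ∀ ψ : D, T (A ψ + (c : ℂ) • (ψ : H)) = ψ := by
  obtain ⟨c, hc, hpos, T, hT, hTf⟩ := hA.resolvent
  refine ⟨c, hc, T, hT, fun f g => ?_, fun f => ?_, hTf, fun ψ => ?_⟩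
  · obtain ⟨hf, ef⟩ := hTf f
    obtain ⟨hg, eg⟩ := hTf g
    have h1 := hA.symm ⟨T f, hf⟩ ⟨T g, hg⟩
    calc ⟪T f, g⟫ = ⟪T f, A ⟨T g, hg⟩ + (c : ℂ) • T g⟫ := by rw [eg]
      _ = ⟪A ⟨T f, hf⟩ + (c : ℂ) • T f, T g⟫ := by
        rw [inner_add_left, inner_add_right, inner_smul_left, inner_smul_right,
          Complex.conj_ofReal, h1]
      _ = ⟪f, T g⟫ := by rw [ef]
  · obtain ⟨hf, ef⟩ := hTf f
    have h1 := hpos ⟨T f, hf⟩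
    rw [← form_add_smul] at h1
    simpa only [ef] using h1
  · obtain ⟨h, e⟩ := hTf (A ψ + (c : ℂ) • (ψ : H))
    set φ : D := ⟨_, h⟩ with hφ
    have h1 := hpos (φ - ψ)
    rw [← form_add_smul] at h1
    have h2 : A (φ - ψ) + (c : ℂ) • ((φ - ψ : D) : H) = 0 := by
      rw [map_sub, Submodule.coe_sub, smul_sub, sub_add_sub_comm, hφ, e, sub_self]
    rw [h2, inner_zero_right, Complex.zero_re] at h1
    have h3 : ((φ - ψ : D) : H) = 0 := by
      rw [← norm_eq_zero]
      exact pow_eq_zero_iff two_ne_zero |>.1 (le_antisymm h1 (by positivity))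
    rw [Submodule.coe_sub, sub_eq_zero] at h3
    exact h3

/-- The largest eigenvalue `‖T‖` of `T = (A + c)⁻¹` corresponds to the lowest one, `1/‖T‖ - c`, of
`A`. That it bounds the form from below is `sq_norm_apply_le_of_nonneg` at the vector `(A + c)ψ`. -/
theorem HasCompactResolvent.exists_ground [CompleteSpace H] [Nontrivial H] {A : D →ₗ[ℂ] H}
    (hA : HasCompactResolvent A) : ∃ (Ω : D) (e : ℝ), ‖(Ω : H)‖ = 1 ∧ A Ω = (e : ℂ) • (Ω : H) ∧
      ∀ ψ : D, e * ‖(ψ : H)‖ ^ 2 ≤ form A ψ := by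
  obtain ⟨c, -, T, hT, hs, hp, hTf, hTA⟩ := hA.exists_inverse
  have hp' : ∀ x, 0 ≤ (⟪T x, x⟫).re := fun x => (sq_nonneg _).trans (hp x)
  have hT0 : T ≠ 0 := by
    obtain ⟨x, hx⟩ := exists_ne (0 : H)
    rintro rfl
    obtain ⟨h, e⟩ := hTf x
    apply hx
    rw [← e]
    have : (⟨(0 : H →L[ℂ] H) x, h⟩ : D) = 0 := by ext; simp
    rw [this]
    simp
  obtain ⟨Ω, hΩ, hev⟩ := hasEigenvalue_norm_of_nonneg hT hs hp' hT0
  have ht : 0 < ‖T‖ := norm_pos_iff.2 hT0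
  have ht' : (‖T‖ : ℂ) ≠ 0 := by exact_mod_cast ht.ne'
  obtain ⟨hD, e⟩ := hTf Ω
  have hΩT : Ω = (‖T‖ : ℂ)⁻¹ • T Ω := by rw [hev, inv_smul_smul₀ ht']
  have hΩD : Ω ∈ D := by rw [hΩT]; exact D.smul_mem _ hD
  refine ⟨⟨Ω, hΩD⟩, 1 / ‖T‖ - c, hΩ, ?_, fun ψ => ?_⟩
  · have h1 : (⟨T Ω, hD⟩ : D) = (‖T‖ : ℂ) • ⟨Ω, hΩD⟩ := by ext; exact hev
    rw [h1, map_smul, hev, smul_comm, ← smul_add] at e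
    have h2 : A ⟨Ω, hΩD⟩ + (c : ℂ) • Ω = (‖T‖ : ℂ)⁻¹ • Ω := by
      nth_rewrite 3 [← e]
      rw [inv_smul_smul₀ ht']
    rw [eq_sub_of_add_eq h2]
    push_cast
    rw [sub_smul, one_div]
  · have h1 := sq_norm_apply_le_of_nonneg hs hp' (A ψ + (c : ℂ) • (ψ : H))
    rw [hTA, form_add_smul] at h1
    rw [sub_mul, sub_le_iff_le_add, one_div, inv_mul_le_iff₀ ht]
    exact h1

/-- On the range of `T = (A + c)⁻¹` one has `A T = 1 - cT`, and `A + c ≥ c + δ` gives `‖cT‖ ≤ c/(c +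
δ) < 1`, so `1 - cT` is invertible. -/
theorem HasCompactResolvent.surjective [CompleteSpace H] {A : D →ₗ[ℂ] H}
    (hA : HasCompactResolvent A) {δ : ℝ} (hδ : 0 < δ)
    (hpos : ∀ ψ : D, δ * ‖(ψ : H)‖ ^ 2 ≤ form A ψ) (f : H) : ∃ ψ : D, A ψ = f := by
  obtain ⟨c, hc, T, hT, hs, hp, hTf, hTA⟩ := hA.exists_inverse
  have hn : ‖(c : ℂ) • T‖ < 1 := by
    have h1 : ‖T‖ ≤ 1 / (c + δ) := by
      refine T.opNorm_le_bound (by positivity) fun f => ?_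
      obtain ⟨h, e⟩ := hTf f
      have h2 := hpos ⟨T f, h⟩
      have h3 : (c + δ) * ‖T f‖ ^ 2 ≤ (⟪T f, f⟫).re := by
        nth_rewrite 3 [← e]
        have := form_add_smul A c ⟨T f, h⟩
        simp only at this
        rw [this]
        simp only at h2
        linarith
      have h4 := mul_norm_le_of_re_inner h3
      rw [one_div, inv_mul_eq_div, le_div_iff₀ (by positivity)]
      linarith
    rw [norm_smul, Complex.norm_real, Real.norm_of_nonneg hc]
    calc c * ‖T‖ ≤ c * (1 / (c + δ)) := by gcongr
      _ < 1 := by rw [mul_one_div, div_lt_one (by positivity)]; linarith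
  set u := Units.oneSub _ hn
  set g := (↑u⁻¹ : H →L[ℂ] H) f with hg
  have hu : (u : H →L[ℂ] H) g = f := by
    rw [hg, ← mul_apply_eq_comp, Units.mul_inv]; rfl
  have hu' : g - (c : ℂ) • T g = f := by
    rw [← hu]; simp [u, Units.val_oneSub]
  obtain ⟨h, e⟩ := hTf g
  exact ⟨⟨T g, h⟩, by rw [← hu', ← eq_sub_of_add_eq e]⟩

/-- The orthogonal projection onto the line spanned by the unit vector `Ω`. -/
def lineProj (Ω : H) : H →L[ℂ] H := InnerProductSpace.rankOne ℂ Ω Ω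

theorem lineProj_apply (Ω x : H) : lineProj Ω x = ⟪Ω, x⟫ • Ω :=
  InnerProductSpace.rankOne_apply _ _ _

theorem lineProj_symm (Ω : H) : BddSymm (lineProj Ω) := by
  intro x y
  rw [lineProj_apply, lineProj_apply, inner_smul_left, inner_smul_right, inner_conj_symm, mul_comm]

theorem re_inner_lineProj (Ω x : H) : (⟪x, lineProj Ω x⟫).re = ‖⟪Ω, x⟫‖ ^ 2 := by
  rw [lineProj_apply, inner_smul_right, ← inner_conj_symm x Ω, Complex.mul_conj]
  rw [Complex.normSq_eq_norm_sq]; norm_cast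

theorem BddSymm.add {W B : H →L[ℂ] H} (hW : BddSymm W) (hB : BddSymm B) : BddSymm (W + B) := by
  intro x y
  simp only [add_apply, inner_add_left, inner_add_right, hW x y, hB x y]

theorem BddSymm.real_smul {W : H →L[ℂ] H} (hW : BddSymm W) (c : ℝ) : BddSymm ((c : ℂ) • W) := by
  intro x y
  simp only [smul_apply, inner_smul_left, inner_smul_right, hW x y,
    Complex.conj_ofReal]

theorem bddSymm_id : BddSymm (ContinuousLinearMap.id ℂ H) := fun _ _ => rfl

theorem pert_add (K : D →ₗ[ℂ] H) (W B : H →L[ℂ] H) (ψ : D) :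
    pert K (W + B) ψ = pert K W ψ + B ψ := by
  simp only [pert_apply, add_apply, add_assoc]

/-- `Ω` is a normalised ground state of `A` with energy `e`, and `A ≥ e + g` on the orthogonal
complement of `Ω`. -/
structure GappedGround (A : D →ₗ[ℂ] H) (Ω : D) (e g : ℝ) : Prop where
  norm_eq : ‖(Ω : H)‖ = 1
  eigen : A Ω = (e : ℂ) • (Ω : H)
  gap_pos : 0 < g
  gap : ∀ ψ : D, ⟪(Ω : H), (ψ : H)⟫ = 0 → (e + g) * ‖(ψ : H)‖ ^ 2 ≤ form A ψ

/-- Adding the projection onto `Ω` is a bounded perturbation, so the sum has a ground state `Ω'`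
with some energy `e'`. If `e' ≤ e`, then `Ω'` would be orthogonal to `Ω` and an eigenvector of
energy `e`, against uniqueness. On `Ω^⊥` the projection vanishes, and `e' - e` is a gap. -/
theorem IsKinetic.exists_gap [CompleteSpace H] {K : D →ₗ[ℂ] H} (hK : IsKinetic K)
    {W : H →L[ℂ] H} (hW : BddSymm W) {Ω : D} {e : ℝ} (hn : ‖(Ω : H)‖ = 1)
    (hev : pert K W Ω = (e : ℂ) • (Ω : H))
    (hmin : ∀ ψ : D, e * ‖(ψ : H)‖ ^ 2 ≤ form (pert K W) ψ)
    (huniq : ∀ ψ : D, pert K W ψ = (e : ℂ) • (ψ : H) → ∃ c : ℂ, (ψ : H) = c • (Ω : H)) :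
    ∃ g, GappedGround (pert K W) Ω e g := by
  have : Nontrivial H := ⟨Ω, 0, fun h => by simp [h] at hn⟩
  obtain ⟨Ω', e', hn', hev', hmin'⟩ :=
    (hK.hasCompactResolvent_pert (hW.add (lineProj_symm (Ω : H)))).exists_ground
  have hform : ∀ ψ : D, form (pert K (W + lineProj (Ω : H))) ψ =
      form (pert K W) ψ + ‖⟪(Ω : H), (ψ : H)⟫‖ ^ 2 := by
    intro ψ
    rw [form, pert_add, inner_add_right, Complex.add_re, re_inner_lineProj, form]
  have hlt : e < e' := by
    by_contra! hle
    have h1 := hform Ω'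
    rw [form, hev', re_inner_ofReal_smul_self, hn'] at h1
    have h2 := hmin Ω'
    rw [hn'] at h2
    have h3 : ‖⟪(Ω : H), (Ω' : H)⟫‖ ^ 2 ≤ 0 := by linarith
    have h4 : ⟪(Ω : H), (Ω' : H)⟫ = 0 := by
      rw [← norm_eq_zero]
      exact pow_eq_zero_iff two_ne_zero |>.1 (le_antisymm h3 (by positivity))
    have h5 : e' = e := by
      rw [h4, norm_zero] at h1
      linarith
    rw [pert_add, lineProj_apply, h4, zero_smul, add_zero, h5] at hev'
    obtain ⟨c, hc⟩ := huniq Ω' hev'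
    rw [hc, inner_smul_right, inner_self_eq_norm_sq_to_K, hn] at h4
    simp at h4
    rw [hc, h4] at hn'
    simp at hn'
  refine ⟨e' - e, hn, hev, sub_pos.2 hlt, fun ψ hψ => ?_⟩
  have h1 := hmin' ψ
  rw [hform, hψ] at h1
  simpa using h1

/-- The reduced resolvent: `(A - e) η = f` is solvable when `f` is orthogonal to the ground
state. -/
theorem GappedGround.exists_solution [CompleteSpace H] {K : D →ₗ[ℂ] H} (hK : IsKinetic K)
    {W : H →L[ℂ] H} (hW : BddSymm W) {Ω : D} {e g : ℝ} (hΩ : GappedGround (pert K W) Ω e g)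
    {f : H} (hf : ⟪(Ω : H), f⟫ = 0) :
    ∃ η : D, ⟪(Ω : H), (η : H)⟫ = 0 ∧ pert K W η - (e : ℂ) • (η : H) = f := by
  -- The corrected operator `A - e + |Ω⟩⟨Ω|` is bounded below by `min g 1`, hence surjective, and
  -- agrees with `A - e` on `Ω^⊥`.
  set W' : H →L[ℂ] H := W + (((-e : ℝ) : ℂ) • ContinuousLinearMap.id ℂ H + lineProj (Ω : H))
  have hW' : BddSymm W' := hW.add ((bddSymm_id.real_smul _).add (lineProj_symm _))
  have hA' : ∀ ψ : D, pert K W' ψ =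
      pert K W ψ - (e : ℂ) • (ψ : H) + ⟪(Ω : H), (ψ : H)⟫ • (Ω : H) := by
    intro ψ
    simp only [W', pert_add, add_apply, lineProj_apply,
      smul_apply, ContinuousLinearMap.id_apply]
    push_cast
    rw [neg_smul]
    abel
  have hsymm := hK.symm.pert hW
  have hΩ' : pert K W' Ω = (Ω : H) := by
    rw [hA', hΩ.eigen, sub_self, zero_add, inner_self_eq_norm_sq_to_K, hΩ.norm_eq]
    simp
  have hpos : ∀ ψ : D, min g 1 * ‖(ψ : H)‖ ^ 2 ≤ form (pert K W') ψ := by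
    intro ψ
    set α := ⟪(Ω : H), (ψ : H)⟫ with hα
    set χ : D := ψ - α • Ω with hχ
    have hχ0 : ⟪(Ω : H), (χ : H)⟫ = 0 := by
      rw [hχ, Submodule.coe_sub, Submodule.coe_smul, inner_sub_right, inner_smul_right,
        inner_self_eq_norm_sq_to_K, hΩ.norm_eq]
      simp [hα]
    have hψ : ψ = α • Ω + χ := by rw [hχ]; abel
    have hχ0' : ⟪(χ : H), (Ω : H)⟫ = 0 := by rw [← inner_conj_symm, hχ0, map_zero]
    have hAχ : ⟪(Ω : H), pert K W' χ⟫ = 0 := by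
      rw [← hK.symm.pert hW', hΩ', hχ0]
    have h1 : form (pert K W') ψ = ‖α‖ ^ 2 + form (pert K W') χ := by
      rw [hψ, form, form, map_add, map_smul, hΩ', Submodule.coe_add, Submodule.coe_smul,
        inner_add_left, inner_add_right, inner_add_right, inner_smul_left, inner_smul_left,
        inner_smul_right, inner_smul_right, hAχ, hχ0', inner_self_eq_norm_sq_to_K, hΩ.norm_eq]
      simp [Complex.add_re, ← Complex.normSq_eq_norm_sq, Complex.normSq_apply]
    have h2 : ‖(ψ : H)‖ ^ 2 = ‖α‖ ^ 2 + ‖(χ : H)‖ ^ 2 := by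
      rw [hψ, ← re_inner_self, ← re_inner_self (χ : H), Submodule.coe_add, Submodule.coe_smul,
        inner_add_left, inner_add_right, inner_add_right, inner_smul_left, inner_smul_left,
        inner_smul_right, inner_smul_right, hχ0, hχ0', inner_self_eq_norm_sq_to_K, hΩ.norm_eq]
      simp [Complex.add_re, ← Complex.normSq_eq_norm_sq, Complex.normSq_apply]
    have h3 : g * ‖(χ : H)‖ ^ 2 ≤ form (pert K W') χ := by
      have h4 := hΩ.gap χ hχ0
      rw [form, hA', hχ0, zero_smul, add_zero, inner_sub_right, Complex.sub_re,
        re_inner_ofReal_smul_self]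
      rw [form] at h4
      linarith
    rw [h1, h2]
    have h4 : min g 1 * ‖α‖ ^ 2 ≤ 1 * ‖α‖ ^ 2 := by gcongr; exact min_le_right _ _
    have h5 : min g 1 * ‖(χ : H)‖ ^ 2 ≤ g * ‖(χ : H)‖ ^ 2 := by gcongr; exact min_le_left _ _
    linarith
  obtain ⟨η, hη⟩ := (hK.hasCompactResolvent_pert hW').surjective
    (lt_min hΩ.gap_pos one_pos) hpos f
  -- The corrected operator is symmetric and fixes `Ω`, so orthogonality of `f` to `Ω` passes to the
  -- solution.
  have h0 : ⟪(Ω : H), (η : H)⟫ = 0 := by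
    nth_rewrite 1 [← hΩ']
    rw [hK.symm.pert hW', hη, hf]
  refine ⟨η, h0, ?_⟩
  rw [← hη, hA', h0, zero_smul, add_zero]

end Abstract

/-! ### Drift operators and the energy expansion in the drift velocity. -/

section Perturbation

variable {H : Type*} [NormedAddCommGroup H] [InnerProductSpace ℂ H] {D : Submodule ℂ H}

local notation "⟪" x ", " y "⟫" => inner ℂ x y

/-- A symmetric operator that is form bounded by `K`, such as a component of the momentum. -/
structure IsDrift (K P : D →ₗ[ℂ] H) (C : ℝ) : Prop where
  symm : SymmOn P
  const_nonneg : 0 ≤ C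
  bound : ∀ ψ : D, ‖P ψ‖ ^ 2 ≤ C * form K ψ

/-- An antiunitary operator that commutes with `K` and anticommutes with `P`. -/
structure IsReversal (K P : D →ₗ[ℂ] H) (J : H → H) : Prop where
  map_add : ∀ x y, J (x + y) = J x + J y
  map_smul : ∀ (c : ℂ) x, J (c • x) = (starRingEnd ℂ) c • J x
  inner_map : ∀ x y, ⟪J x, J y⟫ = ⟪y, x⟫
  mem : ∀ x ∈ D, J x ∈ D
  comm : ∀ ψ : D, K ⟨J ψ, mem ψ ψ.2⟩ = J (K ψ)
  anticomm : ∀ ψ : D, P ⟨J ψ, mem ψ ψ.2⟩ = -J (P ψ)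

variable {K P : D →ₗ[ℂ] H} {W B : H →L[ℂ] H} {Ω : D} {e g C : ℝ} {J : H → H}

theorem form_smul (A : D →ₗ[ℂ] H) (c : ℂ) (ψ : D) : form A (c • ψ) = ‖c‖ ^ 2 * form A ψ := by
  rw [form, map_smul, Submodule.coe_smul, inner_smul_left, inner_smul_right, ← mul_assoc,
    mul_comm _ c, Complex.mul_conj, Complex.normSq_eq_norm_sq, Complex.re_ofReal_mul, form]

theorem sq_norm_add_smul {x y : H} (h : ⟪x, y⟫ = 0) (c : ℂ) :
    ‖c • x + y‖ ^ 2 = ‖c‖ ^ 2 * ‖x‖ ^ 2 + ‖y‖ ^ 2 := by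
  have h' : ⟪c • x, y⟫ = 0 := by rw [inner_smul_left, h, mul_zero]
  have := norm_add_sq_eq_norm_sq_add_norm_sq_of_inner_eq_zero _ _ h'
  rw [norm_smul] at this
  nlinarith

theorem GappedGround.decompose {A : D →ₗ[ℂ] H} (hΩ : GappedGround A Ω e g) (ψ : H) :
    ⟪(Ω : H), ψ - ⟪(Ω : H), ψ⟫ • (Ω : H)⟫ = 0 := by
  rw [inner_sub_right, inner_smul_right, inner_self_eq_norm_sq_to_K, hΩ.norm_eq]
  simp

theorem GappedGround.norm_le {A : D →ₗ[ℂ] H} (hΩ : GappedGround A Ω e g) {ψ : D}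
    (h : ⟪(Ω : H), (ψ : H)⟫ = 0) : g * ‖(ψ : H)‖ ≤ ‖A ψ - (e : ℂ) • (ψ : H)‖ := by
  apply mul_norm_le_of_re_inner
  rw [inner_sub_right, Complex.sub_re, re_inner_ofReal_smul_self]
  have := hΩ.gap ψ h
  rw [form] at this
  linarith

theorem GappedGround.unique {A : D →ₗ[ℂ] H} (hΩ : GappedGround A Ω e g) {ψ : D}
    (h : A ψ = (e : ℂ) • (ψ : H)) : (ψ : H) = ⟪(Ω : H), (ψ : H)⟫ • (Ω : H) := by
  have h1 := hΩ.norm_le (ψ := ψ - ⟪(Ω : H), (ψ : H)⟫ • Ω) (hΩ.decompose ψ)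
  rw [map_sub, map_smul, h, hΩ.eigen, Submodule.coe_sub, Submodule.coe_smul, smul_sub,
    smul_comm (⟪(Ω : H), (ψ : H)⟫), sub_self, norm_zero] at h1
  have h2 : ‖(ψ : H) - ⟪(Ω : H), (ψ : H)⟫ • (Ω : H)‖ ≤ 0 :=
    nonpos_of_mul_nonpos_right h1 hΩ.gap_pos
  exact sub_eq_zero.1 (norm_le_zero_iff.1 h2)

theorem GappedGround.le_form {A : D →ₗ[ℂ] H} (hA : SymmOn A) (hΩ : GappedGround A Ω e g)
    (ψ : D) : e * ‖(ψ : H)‖ ^ 2 ≤ form A ψ := by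
  set α := ⟪(Ω : H), (ψ : H)⟫ with hα
  set χ : D := ψ - α • Ω with hχ
  have hχ0 : ⟪(Ω : H), (χ : H)⟫ = 0 := hΩ.decompose ψ
  have hχ0' : ⟪(χ : H), (Ω : H)⟫ = 0 := by rw [← inner_conj_symm, hχ0, map_zero]
  have hψ : ψ = α • Ω + χ := by rw [hχ]; abel
  have hAχ : ⟪(Ω : H), A χ⟫ = 0 := by
    rw [← hA, hΩ.eigen, inner_smul_left, hχ0, mul_zero]
  have h2 : ‖(ψ : H)‖ ^ 2 = ‖α‖ ^ 2 + ‖(χ : H)‖ ^ 2 := by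
    rw [hψ, Submodule.coe_add, Submodule.coe_smul, sq_norm_add_smul hχ0, hΩ.norm_eq]
    ring
  have h1 : form A ψ = ‖α‖ ^ 2 * e + form A χ := by
    have : form A ψ = form A (α • Ω) + form A χ := by
      have ha : ⟪((α • Ω : D) : H), A χ⟫ = 0 := by
        rw [Submodule.coe_smul, inner_smul_left, hAχ, mul_zero]
      have hb : ⟪(χ : H), A (α • Ω)⟫ = 0 := by
        rw [map_smul, hΩ.eigen, inner_smul_right, inner_smul_right, hχ0', mul_zero, mul_zero]
      rw [hψ, form, map_add, Submodule.coe_add, inner_add_left, inner_add_right, inner_add_right,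
        ha, hb, add_zero, zero_add, Complex.add_re, form, form]
    rw [this, form_smul, form, hΩ.eigen, re_inner_ofReal_smul_self, hΩ.norm_eq]
    ring
  have h3 := hΩ.gap χ hχ0
  have := hΩ.gap_pos
  rw [h1, h2]
  nlinarith [sq_nonneg ‖(χ : H)‖]

/-- On the orthogonal complement of the ground state the drift is bounded by the excitation
energy. -/
theorem GappedGround.drift_sq_le (hP : IsDrift K P C) (hΩ : GappedGround (pert K W) Ω e g)
    {χ : D} (h : ⟪(Ω : H), (χ : H)⟫ = 0) :
    ‖P χ‖ ^ 2 ≤ C * (1 + (|e| + ‖W‖) / g) * (form (pert K W) χ - e * ‖(χ : H)‖ ^ 2) := by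
  have hg := hΩ.gap_pos
  have h1 := hP.bound χ
  have h2 := neg_le_of_abs_le (abs_re_inner_apply_le W χ χ)
  have h3 := hΩ.gap χ h
  have h4 := form_pert K W χ
  have h5 := le_abs_self e
  set a := form (pert K W) χ - e * ‖(χ : H)‖ ^ 2 with ha
  have h6 : ‖(χ : H)‖ ^ 2 ≤ a / g := by
    rw [le_div_iff₀ hg]; linarith
  -- The kinetic form differs from that of `A - e` by at most `(|e| + ‖W‖)‖χ‖²`, and the gap absorbs
  -- `‖χ‖²`.
  have h7 : form K χ ≤ a + (|e| + ‖W‖) * ‖(χ : H)‖ ^ 2 := by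
    nlinarith [sq_nonneg ‖(χ : H)‖]
  have h8 : (|e| + ‖W‖) * ‖(χ : H)‖ ^ 2 ≤ (|e| + ‖W‖) * (a / g) := by gcongr
  calc ‖P χ‖ ^ 2 ≤ C * form K χ := h1
    _ ≤ C * (a + (|e| + ‖W‖) * (a / g)) := by
      apply mul_le_mul_of_nonneg_left _ hP.const_nonneg; linarith
    _ = _ := by ring

/-- Although `P` is unbounded, `P (A - e)⁻¹` is bounded on `Ω^⊥`. The later third order estimates
control `P` through this constant. -/
theorem GappedGround.norm_drift_le (hP : IsDrift K P C) (hΩ : GappedGround (pert K W) Ω e g)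
    {χ : D} (h : ⟪(Ω : H), (χ : H)⟫ = 0) :
    ‖P χ‖ ≤ √(C * (1 + (|e| + ‖W‖) / g) / g) * ‖pert K W χ - (e : ℂ) • (χ : H)‖ := by
  have hg := hΩ.gap_pos
  have hC := hP.const_nonneg
  have h1 := hΩ.drift_sq_le hP h
  set Q := C * (1 + (|e| + ‖W‖) / g) with hQdef
  have hQ : 0 ≤ Q := by positivity
  set y := pert K W χ - (e : ℂ) • (χ : H) with hy
  have h2 : form (pert K W) χ - e * ‖(χ : H)‖ ^ 2 = (⟪(χ : H), y⟫).re := by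
    rw [hy, inner_sub_right, Complex.sub_re, re_inner_ofReal_smul_self, form]
  have h3 := re_inner_le_norm_mul (χ : H) y
  have h4 : ‖(χ : H)‖ ≤ ‖y‖ / g := by
    rw [le_div_iff₀ hg, mul_comm]; exact hΩ.norm_le h
  rw [h2] at h1
  apply le_of_sq_le_sq _ (by positivity)
  rw [mul_pow, Real.sq_sqrt (by positivity)]
  calc ‖P χ‖ ^ 2 ≤ Q * (⟪(χ : H), y⟫).re := h1
    _ ≤ Q * (‖y‖ / g * ‖y‖) := by
      apply mul_le_mul_of_nonneg_left _ hQ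
      exact h3.trans (by gcongr)
    _ = _ := by ring

theorem sub_smul_apply' (A P : D →ₗ[ℂ] H) (c : ℂ) (ψ : D) : (A - c • P) ψ = A ψ - c • P ψ := rfl

/-- In the upper bound for the energy, `1 + v² n` is the squared norm of the trial vector; dividing
by it costs only a term of order `v⁴`. -/
theorem add_le_of_mul_le {y t n v : ℝ} (ht : 0 ≤ t) (hn : 0 ≤ n)
    (h : y * (1 + v ^ 2 * n) ≤ -t * v ^ 2) : y + t * v ^ 2 ≤ t * n * v ^ 4 := by
  have h2 : 0 < 1 + v ^ 2 * n := by positivity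
  have h3 : (y + t * v ^ 2 - t * n * v ^ 4) * (1 + v ^ 2 * n) ≤ 0 := by
    have : 0 ≤ t * n ^ 2 * v ^ 6 := by positivity
    linear_combination h + this
  by_contra! hc
  have : 0 < (y + t * v ^ 2 - t * n * v ^ 4) * (1 + v ^ 2 * n) := mul_pos (by linarith) h2
  linarith

theorem le_infForm {A P : D →ₗ[ℂ] H} {v c : ℝ} (hne : ∃ ψ : D, ‖(ψ : H)‖ = 1)
    (h : ∀ ψ : D, c * ‖(ψ : H)‖ ^ 2 ≤ form (A - (v : ℂ) • P) ψ) : c ≤ infForm A P v := by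
  obtain ⟨ψ, hψ⟩ := hne
  refine le_csInf ⟨_, ψ, hψ, rfl⟩ ?_
  rintro _ ⟨φ, hφ, rfl⟩
  have := h φ
  rw [hφ] at this
  linarith

/-- The value of `c` is immaterial: the hypothesis only keeps the set bounded below, as `sInf` of a
set unbounded below would be the default value `0`. -/
theorem infForm_mul_le {A P : D →ₗ[ℂ] H} {v c : ℝ}
    (h : ∀ ψ : D, c * ‖(ψ : H)‖ ^ 2 ≤ form (A - (v : ℂ) • P) ψ) (ψ : D) :
    infForm A P v * ‖(ψ : H)‖ ^ 2 ≤ form (A - (v : ℂ) • P) ψ := by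
  rcases eq_or_ne (ψ : H) 0 with h0 | h0
  · have : form (A - (v : ℂ) • P) ψ = 0 := by rw [form, h0, inner_zero_left, Complex.zero_re]
    rw [this, h0]; simp
  have hn : 0 < ‖(ψ : H)‖ := norm_pos_iff.2 h0
  have hle : infForm A P v ≤ form (A - (v : ℂ) • P) (((‖(ψ : H)‖⁻¹ : ℝ) : ℂ) • ψ) := by
    refine csInf_le ⟨c, ?_⟩ ⟨_, ?_, rfl⟩
    · rintro _ ⟨φ, hφ, rfl⟩
      have := h φ
      rw [hφ] at this
      linarith
    · rw [Submodule.coe_smul, norm_smul, Complex.norm_real, norm_inv, norm_norm,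
        inv_mul_cancel₀ hn.ne']
  rw [form_smul, Complex.norm_real, norm_inv, norm_norm, inv_pow, inv_mul_eq_div,
    le_div_iff₀ (by positivity)] at hle
  exact hle

theorem GappedGround.infForm_zero {A : D →ₗ[ℂ] H} (hA : SymmOn A) (hΩ : GappedGround A Ω e g)
    (P : D →ₗ[ℂ] H) : infForm A P 0 = e := by
  have h0 : A - ((0 : ℝ) : ℂ) • P = A := by simp
  have h : ∀ ψ : D, e * ‖(ψ : H)‖ ^ 2 ≤ form (A - ((0 : ℝ) : ℂ) • P) ψ := by
    rw [h0]; exact hΩ.le_form hA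
  apply le_antisymm
  · have := infForm_mul_le h Ω
    rw [h0, form, hΩ.eigen, re_inner_ofReal_smul_self, hΩ.norm_eq] at this
    linarith
  · exact le_infForm ⟨Ω, hΩ.norm_eq⟩ h

set_option maxHeartbeats 1000000 in
/-- Second order perturbation theory for the ground state energy of `A - v P`. -/
theorem GappedGround.expansion (hK : SymmOn K) (hW : BddSymm W) (hP : IsDrift K P C)
    (hΩ : GappedGround (pert K W) Ω e g) {η : D} (hη : ⟪(Ω : H), (η : H)⟫ = 0)
    (hsol : pert K W η - (e : ℂ) • (η : H) = P Ω) (hodd : ⟪(η : H), P η⟫ = 0) :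
    (fun v => infForm (pert K W) P v - infForm (pert K W) P 0 + (⟪(η : H), P Ω⟫).re * v ^ 2)
      =O[𝓝 0] fun v => v ^ 4 := by
  have hA := hK.pert hW
  rw [hΩ.infForm_zero hA]
  set A := pert K W with hAdef
  have hg := hΩ.gap_pos
  set t := (⟪(η : H), P Ω⟫).re with ht
  have ht0 : 0 ≤ t := by
    have h1 := hΩ.gap η hη
    have h2 : t = form A η - e * ‖(η : H)‖ ^ 2 := by
      rw [ht, ← hsol, inner_sub_right, Complex.sub_re, re_inner_ofReal_smul_self, form]
    rw [h2]
    nlinarith [sq_nonneg ‖(η : H)‖]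
  have htΩ : (⟪(Ω : H), P η⟫).re = t := by
    rw [← hP.symm, ← inner_conj_symm, Complex.conj_re]
  set Q := C * (1 + (|e| + ‖W‖) / g) with hQdef
  have hQ : 0 ≤ Q := by
    have := hP.const_nonneg
    positivity
  set R := √(Q / g) with hR
  have hR0 : 0 ≤ R := Real.sqrt_nonneg _
  -- On `Ω^⊥` the drift is form bounded by the excitation energy, so a small multiple of it cannot
  -- close the gap.
  have hPχ : ∀ χ : D, ⟪(Ω : H), (χ : H)⟫ = 0 →
      |(⟪(χ : H), P χ⟫).re| ≤ R * (form A χ - e * ‖(χ : H)‖ ^ 2) := by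
    intro χ hχ
    have h1 := hΩ.drift_sq_le hP hχ
    have h2 := hΩ.gap χ hχ
    set a := form A χ - e * ‖(χ : H)‖ ^ 2 with ha
    have h3 : ‖(χ : H)‖ ^ 2 ≤ a / g := by rw [le_div_iff₀ hg]; linarith
    have ha0 : 0 ≤ a := by
      have := (sq_nonneg ‖(χ : H)‖).trans h3
      rw [le_div_iff₀ hg] at this
      linarith
    refine ((Complex.abs_re_le_norm _).trans (norm_inner_le_norm _ _)).trans ?_
    apply le_of_sq_le_sq _ (by positivity)
    rw [mul_pow, mul_pow, hR, Real.sq_sqrt (by positivity)]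
    calc ‖(χ : H)‖ ^ 2 * ‖P χ‖ ^ 2 ≤ (a / g) * (Q * a) := by gcongr
      _ = _ := by ring
  set M := ‖P η‖ with hM
  -- the two bounds for the energy
  have key : ∀ v : ℝ, |v| * R ≤ 1 / 2 →
      |infForm A P v - e + t * v ^ 2| ≤ (t * ‖(η : H)‖ ^ 2 + 2 / g * M ^ 2) * |v ^ 4| := by
    intro v hv
    set S : D →ₗ[ℂ] H := A - (v : ℂ) • P with hS
    have hSs : SymmOn S := by
      intro x y
      rw [hS, sub_smul_apply', sub_smul_apply', inner_sub_left, inner_sub_right, inner_smul_left,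
        inner_smul_right, hA, hP.symm, Complex.conj_ofReal]
    -- The trial vector of first order: by the equation for `η` the terms linear in `v` cancel in
    -- `(S - e)ψ`, and only `-v² Pη` remains.
    set ψ : D := Ω + (v : ℂ) • η with hψ
    have hSψ : S ψ - (e : ℂ) • (ψ : H) = -((v ^ 2 : ℝ) : ℂ) • P η := by
      have : A η = P Ω + (e : ℂ) • (η : H) := by rw [← hsol]; abel
      rw [hS, sub_smul_apply', hψ, map_add, map_add, map_smul, map_smul, hΩ.eigen, this,
        Submodule.coe_add, Submodule.coe_smul]
      push_cast
      module
    have hψn : ‖(ψ : H)‖ ^ 2 = 1 + v ^ 2 * ‖(η : H)‖ ^ 2 := by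
      have h1 : ⟪(η : H), (Ω : H)⟫ = 0 := by rw [← inner_conj_symm, hη, map_zero]
      rw [hψ, Submodule.coe_add, Submodule.coe_smul, add_comm, sq_norm_add_smul h1, hΩ.norm_eq,
        Complex.norm_real, Real.norm_eq_abs, sq_abs]
      ring
    -- Here `hodd` removes the term of order `v³`.
    have hψS : (⟪(ψ : H), S ψ - (e : ℂ) • (ψ : H)⟫).re = -t * v ^ 2 := by
      rw [hSψ, hψ, Submodule.coe_add, Submodule.coe_smul, inner_add_left, inner_smul_right,
        inner_smul_right, inner_smul_left, hodd, mul_zero, mul_zero, add_zero, ← Complex.ofReal_neg,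
        Complex.re_ofReal_mul, htΩ]
      ring
    have hlow : ∀ φ : D, (e - t * v ^ 2 - 2 / g * M ^ 2 * v ^ 4) * ‖(φ : H)‖ ^ 2 ≤ form S φ := by
      intro φ
      set α := ⟪(Ω : H), (φ : H)⟫ with hα
      have hψα : ⟪(Ω : H), (ψ : H)⟫ = 1 := by
        rw [hψ, Submodule.coe_add, Submodule.coe_smul, inner_add_right, inner_smul_right, hη,
          inner_self_eq_norm_sq_to_K, hΩ.norm_eq]
        simp
      -- The splitting is oblique: the remainder is orthogonal to `Ω`, where the gap is available,
      -- and not to `ψ`. The resulting cross term is small because `(S - e)ψ` is of order `v²`.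
      set χ : D := φ - α • ψ with hχ
      have hχ0 : ⟪(Ω : H), (χ : H)⟫ = 0 := by
        rw [hχ, Submodule.coe_sub, Submodule.coe_smul, inner_sub_right, inner_smul_right, hψα]
        simp [hα]
      have hφ : φ = α • ψ + χ := by rw [hχ]; abel
      set S' : D →ₗ[ℂ] H := S - (e : ℂ) • D.subtype with hS'
      have hS'a : ∀ x : D, S' x = S x - (e : ℂ) • (x : H) := fun _ => rfl
      have hS's : SymmOn S' := by
        intro x y
        rw [hS'a, hS'a, inner_sub_left, inner_sub_right, inner_smul_left, inner_smul_right, hSs,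
          Complex.conj_ofReal]
      have e1 : form S' φ = form S φ - e * ‖(φ : H)‖ ^ 2 := by
        rw [form, form, hS'a, inner_sub_right, Complex.sub_re, re_inner_ofReal_smul_self]
      have e2 : form S' φ = ‖α‖ ^ 2 * (-t * v ^ 2) + 2 * (⟪(χ : H), α • S' ψ⟫).re
          + form S' χ := by
        have h1 : (⟪α • (ψ : H), S' χ⟫).re = (⟪(χ : H), α • S' ψ⟫).re := by
          rw [← Submodule.coe_smul, ← hS's, map_smul, ← inner_conj_symm, Complex.conj_re]
        have h2 : form S' φ = form S' (α • ψ) + (⟪α • (ψ : H), S' χ⟫).re +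
            (⟪(χ : H), α • S' ψ⟫).re + form S' χ := by
          rw [hφ, form, form, form, map_add, map_smul, Submodule.coe_add, Submodule.coe_smul,
            inner_add_left, inner_add_right, inner_add_right, Complex.add_re, Complex.add_re,
            Complex.add_re]
          ring
        rw [h2, h1, form_smul, form, hS'a, hψS]
        ring
      -- Half of the gap survives because `|v| R ≤ 1/2`.
      have e3 : g / 2 * ‖(χ : H)‖ ^ 2 ≤ form S' χ := by
        have h1 := hPχ χ hχ0
        have h2 := hΩ.gap χ hχ0
        have h3 : form S' χ = form A χ - e * ‖(χ : H)‖ ^ 2 - v * (⟪(χ : H), P χ⟫).re := by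
          rw [form, hS'a, hS, sub_smul_apply', inner_sub_right, inner_sub_right, Complex.sub_re,
            Complex.sub_re, re_inner_ofReal_smul_self, inner_smul_right, Complex.re_ofReal_mul, form]
          ring
        have h4 : v * (⟪(χ : H), P χ⟫).re ≤ 1 / 2 * (form A χ - e * ‖(χ : H)‖ ^ 2) := by
          refine (le_abs_self _).trans ?_
          rw [abs_mul]
          have ha : 0 ≤ form A χ - e * ‖(χ : H)‖ ^ 2 := by nlinarith [sq_nonneg ‖(χ : H)‖]
          calc |v| * |(⟪(χ : H), P χ⟫).re| ≤ |v| * (R * (form A χ - e * ‖(χ : H)‖ ^ 2)) := by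
                gcongr
            _ = |v| * R * (form A χ - e * ‖(χ : H)‖ ^ 2) := by ring
            _ ≤ _ := by gcongr
        rw [h3]
        linarith
      have e4 : -(‖χ‖ * (‖α‖ * (v ^ 2 * M))) ≤ (⟪(χ : H), α • S' ψ⟫).re := by
        have h1 : ‖α • S' ψ‖ = ‖α‖ * (v ^ 2 * M) := by
          rw [norm_smul, hS'a, hSψ, norm_smul, norm_neg, Complex.norm_real, Real.norm_eq_abs,
            abs_of_nonneg (sq_nonneg v)]
        have h2 := re_inner_le_norm_mul (χ : H) (-(α • S' ψ))
        rw [inner_neg_right, Complex.neg_re, norm_neg, h1] at h2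
        have h3 : ‖χ‖ = ‖(χ : H)‖ := rfl
        rw [h3]; linarith
      have e5 : ‖α‖ ^ 2 ≤ ‖(φ : H)‖ ^ 2 := by
        gcongr
        have := norm_inner_le_norm (𝕜 := ℂ) (Ω : H) (φ : H)
        rwa [hΩ.norm_eq, one_mul] at this
      -- Completing the square pays for the cross term of order `v²` with half of the gap and a
      -- remainder of order `v⁴`.
      have e6 : ‖χ‖ * (‖α‖ * (v ^ 2 * M)) * 2 ≤ g / 2 * ‖(χ : H)‖ ^ 2
          + ‖α‖ ^ 2 * (2 / g * M ^ 2 * v ^ 4) := by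
        have h3 : ‖χ‖ = ‖(χ : H)‖ := rfl
        rw [h3]
        have h4 : g / 2 * ‖(χ : H)‖ ^ 2 + ‖α‖ ^ 2 * (2 / g * M ^ 2 * v ^ 4)
            - ‖(χ : H)‖ * (‖α‖ * (v ^ 2 * M)) * 2
            = g / 2 * (‖(χ : H)‖ - 2 / g * (‖α‖ * (v ^ 2 * M))) ^ 2 := by
          field_simp
          ring
        have h5 : 0 ≤ g / 2 * (‖(χ : H)‖ - 2 / g * (‖α‖ * (v ^ 2 * M))) ^ 2 := by positivity
        linarith
      have e7 : ‖α‖ ^ 2 * (t * v ^ 2 + 2 / g * M ^ 2 * v ^ 4) ≤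
          ‖(φ : H)‖ ^ 2 * (t * v ^ 2 + 2 / g * M ^ 2 * v ^ 4) := by gcongr
      linear_combination e1 - e2 + e3 + 2 * e4 + e6 + e7
    have hup := infForm_mul_le hlow ψ
    have hlo := le_infForm ⟨Ω, hΩ.norm_eq⟩ hlow
    have hup' : (infForm A P v - e) * (1 + v ^ 2 * ‖(η : H)‖ ^ 2) ≤ -t * v ^ 2 := by
      rw [← hψn, ← hψS, inner_sub_right, Complex.sub_re, re_inner_ofReal_smul_self]
      rw [form] at hup
      linarith
    have hv4 : |v ^ 4| = v ^ 4 := abs_of_nonneg (by positivity)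
    rw [hv4, abs_le]
    constructor
    · have h1 : 0 ≤ t * ‖(η : H)‖ ^ 2 * v ^ 4 := by positivity
      linear_combination hlo + h1
    · have h1 := add_le_of_mul_le ht0 (sq_nonneg _) hup'
      have h4 : 0 ≤ 2 / g * M ^ 2 * v ^ 4 := by positivity
      linear_combination h1 + h4
  refine IsBigO.of_bound (t * ‖(η : H)‖ ^ 2 + 2 / g * M ^ 2) ?_
  have hev : ∀ᶠ v : ℝ in 𝓝 0, |v| * R < 1 / 2 := by
    have hc : Continuous fun v : ℝ => |v| * R := by fun_prop
    have := hc.tendsto 0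
    simp only [abs_zero, zero_mul] at this
    exact this.eventually_lt_const (by norm_num)
  filter_upwards [hev] with v hv
  exact key v hv.le

end Perturbation

/-! ### Stability of the gap, time reversal, and the response to third order in the potential. -/

section Perturbation

variable {H : Type*} [NormedAddCommGroup H] [InnerProductSpace ℂ H] {D : Submodule ℂ H}
variable {K P : D →ₗ[ℂ] H} {W B : H →L[ℂ] H} {Ω : D} {e g C : ℝ} {J : H → H}

local notation "⟪" x ", " y "⟫" => inner ℂ x y

/-- A gapped ground state persists under a small bounded perturbation. -/
theorem GappedGround.exists_pert [CompleteSpace H] (hK : IsKinetic K) (hW : BddSymm W)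
    (hΩ : GappedGround (pert K W) Ω e g) (hB : BddSymm B) (hb : 4 * ‖B‖ ≤ g) :
    ∃ (Ω' : D) (e' : ℝ), GappedGround (pert K (W + B)) Ω' e' (g / 2) ∧ |e' - e| ≤ ‖B‖ := by
  have hg := hΩ.gap_pos
  have : Nontrivial H := ⟨Ω, 0, fun h => by have := hΩ.norm_eq; simp [h] at this⟩
  set A' := pert K (W + B) with hA'
  have hs : SymmOn A' := hK.symm.pert (hW.add hB)
  have hform : ∀ ψ : D, form A' ψ = form (pert K W) ψ + (⟪(ψ : H), B ψ⟫).re := by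
    intro ψ
    rw [form, hA', pert_add, inner_add_right, Complex.add_re, form]
  have hBψ : ∀ ψ : D, |(⟪(ψ : H), B ψ⟫).re| ≤ ‖B‖ * ‖(ψ : H)‖ ^ 2 := by
    intro ψ
    rw [sq]
    exact abs_re_inner_apply_le B ψ ψ
  obtain ⟨Ω', e', hn', hev', hmin'⟩ := (hK.hasCompactResolvent_pert (hW.add hB)).exists_ground
  have hfΩ' : form A' Ω' = e' := by
    rw [form, hev', re_inner_ofReal_smul_self, hn']; ring
  have hup : e' ≤ e + ‖B‖ := by
    have h1 := hmin' Ω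
    have h2 := le_of_abs_le (hBψ Ω)
    have h3 := hform Ω
    have h4 : form (pert K W) Ω = e := by
      rw [form, hΩ.eigen, re_inner_ofReal_smul_self, hΩ.norm_eq]; ring
    rw [hΩ.norm_eq] at h1 h2
    linarith
  have hlo : e - ‖B‖ ≤ e' := by
    have h1 := hΩ.le_form (hK.symm.pert hW) Ω'
    have h2 := neg_le_of_abs_le (hBψ Ω')
    have h3 := hform Ω'
    rw [hn'] at h1 h2
    linarith
  have hperp : ∀ φ : D, ⟪(Ω : H), (φ : H)⟫ = 0 → (e + g - ‖B‖) * ‖(φ : H)‖ ^ 2 ≤ form A' φ := by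
    intro φ hφ
    have h1 := hΩ.gap φ hφ
    have h2 := neg_le_of_abs_le (hBψ φ)
    rw [hform]
    linarith
  refine ⟨Ω', e', ⟨hn', hev', by linarith, fun χ hχ => ?_⟩, abs_le.2 ⟨by linarith, by linarith⟩⟩
  set α := ⟪(Ω : H), (Ω' : H)⟫ with hα
  set β := ⟪(Ω : H), (χ : H)⟫ with hβ
  -- The min-max argument: the span of `Ω'` and `χ` contains a vector orthogonal to `Ω`, whose
  -- energy is at least `e + g - ‖B‖`. Since `Ω'` lies lower, `χ` has to lie that high.
  set φ : D := α • χ - β • Ω' with hφ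
  have hφ0 : ⟪(Ω : H), (φ : H)⟫ = 0 := by
    rw [hφ, Submodule.coe_sub, Submodule.coe_smul, Submodule.coe_smul, inner_sub_right,
      inner_smul_right, inner_smul_right, ← hα, ← hβ]
    ring
  have hχ' : ⟪(χ : H), (Ω' : H)⟫ = 0 := by rw [← inner_conj_symm, hχ, map_zero]
  have hAχ : ⟪(Ω' : H), A' χ⟫ = 0 := by
    rw [← hs, hev', inner_smul_left, hχ, mul_zero]
  have hφ' : φ = (-β) • Ω' + α • χ := by rw [hφ]; module
  have hn : ‖(φ : H)‖ ^ 2 = ‖β‖ ^ 2 + ‖α‖ ^ 2 * ‖(χ : H)‖ ^ 2 := by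
    have h0 : ⟪(Ω' : H), ((α • χ : D) : H)⟫ = 0 := by
      rw [Submodule.coe_smul, inner_smul_right, hχ, mul_zero]
    rw [hφ', Submodule.coe_add, Submodule.coe_smul, sq_norm_add_smul h0, hn', norm_neg,
      Submodule.coe_smul, norm_smul]
    ring
  have hf : form A' φ = ‖β‖ ^ 2 * e' + ‖α‖ ^ 2 * form A' χ := by
    have ha : ⟪(((-β) • Ω' : D) : H), A' (α • χ)⟫ = 0 := by
      rw [Submodule.coe_smul, map_smul, inner_smul_left, inner_smul_right, hAχ, mul_zero, mul_zero]
    have hb : ⟪((α • χ : D) : H), A' ((-β) • Ω')⟫ = 0 := by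
      rw [Submodule.coe_smul, map_smul, hev', inner_smul_left, inner_smul_right, inner_smul_right,
        hχ', mul_zero, mul_zero, mul_zero]
    have h1 : form A' φ = form A' ((-β) • Ω') + form A' (α • χ) := by
      rw [hφ', form, map_add, Submodule.coe_add, inner_add_left, inner_add_right, inner_add_right,
        ha, hb, add_zero, zero_add, Complex.add_re, form, form]
    rw [h1, form_smul, form_smul, norm_neg, hfΩ']
  have hα0 : 0 < ‖α‖ ^ 2 := by
    -- If `Ω'` were orthogonal to `Ω`, its energy would be at least `e + g - ‖B‖`, above the upper
    -- bound `e + ‖B‖`.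
    have : α ≠ 0 := by
      intro h0
      have h1 := hperp Ω' h0
      rw [hfΩ', hn'] at h1
      linarith [norm_nonneg B]
    positivity
  have h1 := hperp φ hφ0
  rw [hn, hf] at h1
  have h2 : (e + g - ‖B‖) * ‖(χ : H)‖ ^ 2 ≤ form A' χ := by
    have h3 : 0 ≤ ‖β‖ ^ 2 * (e + g - ‖B‖ - e') :=
      mul_nonneg (sq_nonneg _) (by linarith [norm_nonneg B])
    have h4 : ‖α‖ ^ 2 * ((e + g - ‖B‖) * ‖(χ : H)‖ ^ 2) ≤ ‖α‖ ^ 2 * form A' χ := by linarith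
    exact le_of_mul_le_mul_left h4 hα0
  -- The smallness `4‖B‖ ≤ g` enters as `e' + g/2 ≤ e + ‖B‖ + g/2 ≤ e + g - ‖B‖`.
  refine le_trans ?_ h2
  gcongr
  linarith

theorem IsReversal.norm_map (hJ : IsReversal K P J) (x : H) : ‖J x‖ = ‖x‖ := by
  have h : ‖J x‖ ^ 2 = ‖x‖ ^ 2 := by rw [← re_inner_self, hJ.inner_map, re_inner_self]
  exact (pow_left_inj₀ (norm_nonneg _) (norm_nonneg _) two_ne_zero).1 h

theorem IsReversal.map_neg (hJ : IsReversal K P J) (x : H) : J (-x) = -J x := by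
  have := hJ.map_smul (-1) x
  simpa using this

/-- The ground state of a reversal invariant operator is reversal invariant up to a phase. -/
theorem GappedGround.reversal (hJ : IsReversal K P J) (hJW : ∀ x, W (J x) = J (W x))
    (hΩ : GappedGround (pert K W) Ω e g) : ∃ c : ℂ, ‖c‖ = 1 ∧ J Ω = c • (Ω : H) := by
  have h1 : pert K W ⟨J Ω, hJ.mem Ω Ω.2⟩ = (e : ℂ) • J Ω := by
    rw [pert_apply, hJ.comm, hJW, ← hJ.map_add, ← pert_apply, hΩ.eigen, hJ.map_smul,
      Complex.conj_ofReal]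
  have h2 := hΩ.unique h1
  refine ⟨_, ?_, h2⟩
  have h3 := hJ.norm_map Ω
  simp only at h2
  rw [h2, norm_smul, hΩ.norm_eq, mul_one] at h3
  exact h3

/-- `J` fixes the ray of `Ω` and reverses `P`, so the expectation of `P` equals its own negative.
This is the solvability condition for the response equation. -/
theorem GappedGround.inner_drift_eq_zero (hP : SymmOn P) (hJ : IsReversal K P J)
    (hJW : ∀ x, W (J x) = J (W x)) (hΩ : GappedGround (pert K W) Ω e g) :
    ⟪(Ω : H), P Ω⟫ = 0 := by
  obtain ⟨c, hc, hJΩ⟩ := hΩ.reversal hJ hJW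
  have h1 : (⟨J Ω, hJ.mem Ω Ω.2⟩ : D) = c • Ω := by ext; exact hJΩ
  have h2 := hJ.anticomm Ω
  rw [h1, map_smul] at h2
  have h3 : ⟪c • (Ω : H), c • P Ω⟫ = -⟪(Ω : H), P Ω⟫ := by
    rw [h2, ← hJΩ, inner_neg_right, hJ.inner_map, hP]
  rw [inner_smul_left, inner_smul_right, ← mul_assoc, mul_comm _ c, Complex.mul_conj,
    Complex.normSq_eq_norm_sq, hc] at h3
  simp only [one_pow, Complex.ofReal_one, one_mul] at h3
  exact self_eq_neg.1 h3

/-- Applying `J` to the equation for `η` multiplies its right side by `-c`, where `JΩ = cΩ`. The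
solution orthogonal to `Ω` being unique, `Jη = -cη`, and then `⟨η, Pη⟩` is odd under reversal. This
is what excludes a cubic term in `v`. -/
theorem GappedGround.inner_response_eq_zero (hP : SymmOn P) (hJ : IsReversal K P J)
    (hJW : ∀ x, W (J x) = J (W x)) (hΩ : GappedGround (pert K W) Ω e g) {η : D}
    (hη : ⟪(Ω : H), (η : H)⟫ = 0) (hsol : pert K W η - (e : ℂ) • (η : H) = P Ω) :
    ⟪(η : H), P η⟫ = 0 := by
  obtain ⟨c, hc, hJΩ⟩ := hΩ.reversal hJ hJW
  have hc0 : c ≠ 0 := by rintro rfl; simp at hc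
  set η' : D := ⟨J η, hJ.mem η η.2⟩ with hη'
  have h1 : (⟨J Ω, hJ.mem Ω Ω.2⟩ : D) = c • Ω := by ext; exact hJΩ
  have h2 : J (P Ω) = -(c • P Ω) := by
    have := hJ.anticomm Ω
    rw [h1, map_smul] at this
    rw [this, neg_neg]
  have h3 : pert K W η' - (e : ℂ) • (η' : H) = -(c • P Ω) := by
    rw [← h2, ← hsol, sub_eq_add_neg, sub_eq_add_neg, hJ.map_add, hJ.map_neg, hJ.map_smul,
      Complex.conj_ofReal, pert_apply, pert_apply, hJ.map_add, hJ.comm, hJW]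
  have h4 : ⟪(Ω : H), (η' : H)⟫ = 0 := by
    have h5 : ⟪c • (Ω : H), (η' : H)⟫ = 0 := by
      rw [← hJΩ, hJ.inner_map, ← inner_conj_symm, hη, map_zero]
    rw [inner_smul_left] at h5
    exact (mul_eq_zero.1 h5).resolve_left (by simpa using hc0)
  have h5 : (η' : H) = -(c • (η : H)) := by
    have h6 := hΩ.norm_le (ψ := η' + c • η) (by
      rw [Submodule.coe_add, Submodule.coe_smul, inner_add_right, inner_smul_right, h4, hη]; simp)
    have h7 : pert K W (η' + c • η) - (e : ℂ) • ((η' + c • η : D) : H) = 0 := by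
      rw [map_add, map_smul, Submodule.coe_add, Submodule.coe_smul]
      have : pert K W η' + c • pert K W η - (e : ℂ) • ((η' : H) + c • (η : H)) =
          (pert K W η' - (e : ℂ) • (η' : H)) + c • (pert K W η - (e : ℂ) • (η : H)) := by module
      rw [this, h3, hsol, neg_add_cancel]
    rw [h7, norm_zero] at h6
    have h8 := norm_le_zero_iff.1 (nonpos_of_mul_nonpos_right h6 hΩ.gap_pos)
    rw [Submodule.coe_add, Submodule.coe_smul] at h8
    exact eq_neg_of_add_eq_zero_left h8
  have h6 : η' = (-c) • η := by ext; rw [h5, Submodule.coe_smul, neg_smul]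
  have h7 := hJ.anticomm η
  rw [← hη', h6, map_smul] at h7
  have h8 : ⟪(-c) • (η : H), (-c) • P η⟫ = -⟪(η : H), P η⟫ := by
    rw [h7, neg_smul, ← h5, inner_neg_right, hJ.inner_map, hP]
  rw [inner_smul_left, inner_smul_right, ← mul_assoc, mul_comm _ (-c), Complex.mul_conj,
    Complex.normSq_eq_norm_sq, norm_neg, hc] at h8
  simp only [one_pow, Complex.ofReal_one, one_mul] at h8
  exact self_eq_neg.1 h8

/-- The second order coefficient of the perturbed energy, to third order in the perturbation. -/
theorem GappedGround.response_le (hP : IsDrift K P C) (hs : SymmOn (pert K W))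
    (hΩ : GappedGround (pert K W) Ω e g) (hPΩ : P Ω = 0) {Ω' : D} {e' : ℝ}
    (hΩ' : GappedGround (pert K (W + B)) Ω' e' (g / 2)) (he : |e' - e| ≤ ‖B‖) {η : D}
    (hη : ⟪(Ω' : H), (η : H)⟫ = 0)
    (hsol : pert K (W + B) η - (e' : ℂ) • (η : H) = P Ω') {q : ℝ}
    (hq : q = √(C * (1 + (|e| + ‖W‖) / g) / g)) :
    (⟪(η : H), P Ω'⟫).re ≤ 8 * q ^ 2 / g * ‖B‖ ^ 2 ∧
    ∀ χ₁ ζ : D, ⟪(Ω : H), (χ₁ : H)⟫ = 0 →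
      pert K W χ₁ - (e : ℂ) • (χ₁ : H) = B Ω - ⟪(Ω : H), B Ω⟫ • (Ω : H) →
      ⟪(Ω : H), (ζ : H)⟫ = 0 → pert K W ζ - (e : ℂ) • (ζ : H) = P χ₁ →
      (⟪(η : H), P Ω'⟫).re ≤ (⟪(ζ : H), P χ₁⟫).re + 40 * q ^ 2 / g ^ 2 * ‖B‖ ^ 3 := by
  have hg := hΩ.gap_pos
  have hq0 : 0 ≤ q := hq ▸ Real.sqrt_nonneg _
  set b := ‖B‖ with hb
  have hb0 : 0 ≤ b := norm_nonneg _
  -- On `Ω^⊥`, both `P (A - e)⁻¹` and `(A - e)⁻¹` are bounded, with constants `q` and `1/g`; every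
  -- estimate below is an instance.
  have hdr : ∀ χ : D, ⟪(Ω : H), (χ : H)⟫ = 0 → ∀ y : H, ∀ r : ℝ,
      pert K W χ - (e : ℂ) • (χ : H) = y → ‖y‖ ≤ r → ‖P χ‖ ≤ q * r ∧ ‖(χ : H)‖ ≤ r / g := by
    intro χ hχ y r hy hr
    have h1 := hΩ.norm_drift_le hP hχ
    have h2 := hΩ.norm_le hχ
    rw [hy] at h1 h2
    rw [← hq] at h1
    refine ⟨h1.trans (by gcongr), ?_⟩
    rw [le_div_iff₀ hg, mul_comm]
    exact h2.trans hr
  -- the bounded operator `B - (e' - e)`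
  set d : ℂ := ((e' - e : ℝ) : ℂ) with hd
  have hBd : ∀ x : H, ‖B x - d • x‖ ≤ 2 * b * ‖x‖ := by
    intro x
    refine (norm_sub_le _ _).trans ?_
    rw [norm_smul, hd, Complex.norm_real, Real.norm_eq_abs]
    have := B.le_opNorm x
    nlinarith [norm_nonneg x]
  have hshift : ∀ x : D, pert K W x - (e : ℂ) • (x : H) =
      (pert K (W + B) x - (e' : ℂ) • (x : H)) - (B x - d • (x : H)) := by
    intro x
    rw [pert_add, hd]
    push_cast
    module
  set s := ⟪(Ω : H), (Ω' : H)⟫ with hs'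
  have hs1 : ‖s‖ ≤ 1 := by
    have := norm_inner_le_norm (𝕜 := ℂ) (Ω : H) (Ω' : H)
    rwa [hΩ.norm_eq, hΩ'.norm_eq, one_mul] at this
  -- As `PΩ = 0`, only this component of `Ω'`, which is of first order in `B`, feels the drift.
  -- Hence `η` is of first order and the response of second.
  set χ : D := Ω' - s • Ω with hχ
  have hχ0 : ⟪(Ω : H), (χ : H)⟫ = 0 := hΩ.decompose Ω'
  have hΩχ : pert K W χ - (e : ℂ) • (χ : H) = -(B Ω' - d • (Ω' : H)) := by
    have h1 : pert K W χ - (e : ℂ) • (χ : H) = pert K W Ω' - (e : ℂ) • (Ω' : H) := by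
      rw [hχ, map_sub, map_smul, hΩ.eigen, Submodule.coe_sub, Submodule.coe_smul]
      module
    rw [h1, hshift, hΩ'.eigen, sub_self, zero_sub]
  have hPχ : P Ω' = P χ := by rw [hχ, map_sub, map_smul, hPΩ, smul_zero, sub_zero]
  obtain ⟨hχ1, hχ2⟩ := hdr χ hχ0 _ (2 * b) hΩχ (by
    have := hBd Ω'
    rwa [norm_neg, ← mul_one (2 * b), ← hΩ'.norm_eq])
  have hηn : ‖(η : H)‖ ≤ 4 * q * b / g := by
    have h1 := hΩ'.norm_le hη
    rw [hsol, hPχ] at h1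
    rw [le_div_iff₀ hg]
    linarith
  have hd0 : 0 ≤ 4 * q * b / g := by positivity
  constructor
  · refine (re_inner_le_norm_mul _ _).trans ?_
    rw [hPχ]
    calc ‖(η : H)‖ * ‖P χ‖ ≤ 4 * q * b / g * (q * (2 * b)) := by gcongr
      _ = _ := by ring
  intro χ₁ ζ h₁ hsol₁ hζ hsolζ
  obtain ⟨hχ₁, -⟩ := hdr χ₁ h₁ _ (2 * b) hsol₁ (by
    refine (norm_sub_le _ _).trans ?_
    have h1 : ‖B Ω‖ ≤ b := by
      have := B.le_opNorm Ω
      rwa [hΩ.norm_eq, mul_one] at this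
    have h2 : ‖⟪(Ω : H), B Ω⟫ • (Ω : H)‖ ≤ b := by
      rw [norm_smul, hΩ.norm_eq, mul_one]
      refine (norm_inner_le_norm _ _).trans ?_
      rwa [hΩ.norm_eq, one_mul]
    linarith)
  obtain ⟨-, hζn⟩ := hdr ζ hζ _ _ hsolζ hχ₁
  -- First order theory predicts `χ ≈ -s χ₁`; the difference is of second order.
  set χ₂ : D := χ + s • χ₁ with hχ₂
  have hχ₂0 : ⟪(Ω : H), (χ₂ : H)⟫ = 0 := by
    rw [hχ₂, Submodule.coe_add, Submodule.coe_smul, inner_add_right, inner_smul_right, hχ0, h₁]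
    simp
  set y : H := B χ - d • (χ : H) with hy
  have hyn : ‖y‖ ≤ 4 * b ^ 2 / g := by
    refine (hBd χ).trans ?_
    calc 2 * b * ‖(χ : H)‖ ≤ 2 * b * (2 * b / g) := by gcongr
      _ = _ := by ring
  have hsol₂ : ∃ c : ℂ, pert K W χ₂ - (e : ℂ) • (χ₂ : H) = c • (Ω : H) - y := by
    refine ⟨s * d - s * ⟪(Ω : H), B Ω⟫, ?_⟩
    have h1 : pert K W χ₂ - (e : ℂ) • (χ₂ : H) = (pert K W χ - (e : ℂ) • (χ : H)) +
        s • (pert K W χ₁ - (e : ℂ) • (χ₁ : H)) := by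
      rw [hχ₂, map_add, map_smul, Submodule.coe_add, Submodule.coe_smul]
      module
    have h2 : (Ω' : H) = (χ : H) + s • (Ω : H) := by
      rw [hχ, Submodule.coe_sub, Submodule.coe_smul, sub_add_cancel]
    rw [h1, hΩχ, hsol₁, h2, hy, map_add, map_smul]
    module
  -- The multiple of `Ω` needs no estimate: the left side is orthogonal to `Ω`, so its norm is at
  -- most `‖y‖`.
  have hχ₂n : ‖pert K W χ₂ - (e : ℂ) • (χ₂ : H)‖ ≤ 4 * b ^ 2 / g := by
    obtain ⟨c, hc⟩ := hsol₂
    set z := pert K W χ₂ - (e : ℂ) • (χ₂ : H) with hz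
    have hzΩ : ⟪(Ω : H), z⟫ = 0 := by
      rw [hz, inner_sub_right, ← hs, hΩ.eigen, inner_smul_left, inner_smul_right, hχ₂0]
      simp
    have h1 : 1 * ‖z‖ ^ 2 ≤ (⟪z, -y⟫).re := by
      have h2 : -y = z - c • (Ω : H) := by rw [hc]; abel
      rw [h2, inner_sub_right, inner_smul_right, ← inner_conj_symm z (Ω : H), hzΩ]
      simp only [map_zero, mul_zero, sub_zero, re_inner_self, one_mul, le_refl]
    have h3 := mul_norm_le_of_re_inner h1
    rw [one_mul, norm_neg] at h3
    exact h3.trans hyn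
  obtain ⟨hPχ₂, -⟩ := hdr χ₂ hχ₂0 _ _ rfl hχ₂n
  have e1 : P Ω' = P χ₂ - s • P χ₁ := by rw [hPχ, hχ₂, map_add, map_smul]; abel
  -- Symmetry of `A - e` moves the resolvent from `ζ` onto `η`, whose own equation then applies up
  -- to the error `(B - d)η`.
  have e2 : ⟪(η : H), P χ₁⟫ = ⟪P Ω' - (B η - d • (η : H)), (ζ : H)⟫ := by
    rw [← hsolζ, ← hsol, ← hshift, inner_sub_left, inner_sub_right, hs, inner_smul_left,
      inner_smul_right, Complex.conj_ofReal]
  have e3 : (⟪(ζ : H), P χ₁⟫).re ≥ 0 := by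
    have h1 := hΩ.gap ζ hζ
    rw [← hsolζ, inner_sub_right, Complex.sub_re, re_inner_ofReal_smul_self]
    rw [form] at h1
    nlinarith [sq_nonneg ‖(ζ : H)‖]
  have e4 : (⟪(η : H), P Ω'⟫).re = (⟪(η : H), P χ₂⟫).re - (s * ⟪P χ₂, (ζ : H)⟫).re
      + (s * ((starRingEnd ℂ) s * ⟪P χ₁, (ζ : H)⟫)).re
      + (s * ⟪B η - d • (η : H), (ζ : H)⟫).re := by
    rw [e1, inner_sub_right, inner_smul_right, e2, e1, inner_sub_left, inner_sub_left,
      inner_smul_left, ← Complex.sub_re, ← Complex.add_re, ← Complex.add_re]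
    congr 1
    ring
  -- Only an upper bound is wanted, and the main term is nonnegative, so `|s|² ≤ 1` suffices and the
  -- overlap need not be expanded.
  have e5 : (s * ((starRingEnd ℂ) s * ⟪P χ₁, (ζ : H)⟫)).re ≤ (⟪(ζ : H), P χ₁⟫).re := by
    rw [← mul_assoc, Complex.mul_conj, Complex.re_ofReal_mul, Complex.normSq_eq_norm_sq,
      ← inner_conj_symm, Complex.conj_re]
    have : ‖s‖ ^ 2 ≤ 1 := pow_le_one₀ (norm_nonneg _) hs1
    nlinarith
  have hsb : ∀ x y : H, |(s * ⟪x, y⟫).re| ≤ ‖x‖ * ‖y‖ := by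
    intro x y
    refine (Complex.abs_re_le_norm _).trans ?_
    rw [norm_mul]
    have := norm_inner_le_norm (𝕜 := ℂ) x y
    calc ‖s‖ * ‖⟪x, y⟫‖ ≤ 1 * (‖x‖ * ‖y‖) := by gcongr
      _ = _ := one_mul _
  have t1 : (⟪(η : H), P χ₂⟫).re ≤ 4 * q * b / g * (q * (4 * b ^ 2 / g)) := by
    refine (re_inner_le_norm_mul _ _).trans ?_
    gcongr
  have t2 : -(s * ⟪P χ₂, (ζ : H)⟫).re ≤ q * (4 * b ^ 2 / g) * (q * (2 * b) / g) := by
    refine (neg_le_abs _).trans ((hsb _ _).trans ?_)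
    gcongr
  have t3 : (s * ⟪B η - d • (η : H), (ζ : H)⟫).re ≤ 2 * b * (4 * q * b / g) * (q * (2 * b) / g) := by
    refine (le_abs_self _).trans ((hsb _ _).trans ?_)
    have := hBd η
    gcongr
    exact this.trans (by gcongr)
  rw [e4]
  -- The three error terms contribute `16 + 8 + 16`.
  have : 40 * q ^ 2 / g ^ 2 * b ^ 3 = 4 * q * b / g * (q * (4 * b ^ 2 / g)) +
      q * (4 * b ^ 2 / g) * (q * (2 * b) / g) + 2 * b * (4 * q * b / g) * (q * (2 * b) / g) := by
    ring
  rw [this]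
  linarith

/-- The energy of the perturbed operator is quadratic in the drift velocity, with a coefficient
that is controlled to third order in the perturbation. -/
theorem GappedGround.exists_quadratic_expansion [CompleteSpace H] (hK : IsKinetic K)
    (hP : IsDrift K P C) (hJ : IsReversal K P J) (hW : BddSymm W) (hJW : ∀ x, W (J x) = J (W x))
    (hΩ : GappedGround (pert K W) Ω e g) (hPΩ : P Ω = 0) :
    ∃ M : ℝ, 0 ≤ M ∧ ∀ B : H →L[ℂ] H, BddSymm B → (∀ x, B (J x) = J (B x)) → 4 * ‖B‖ ≤ g →
      ∃ t : ℝ, 0 ≤ t ∧ t ≤ M * ‖B‖ ^ 2 ∧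
        ((fun v => infForm (pert K (W + B)) P v - infForm (pert K (W + B)) P 0 + t * v ^ 2)
          =O[𝓝 0] fun v => v ^ 4) ∧
        ∀ χ₁ ζ : D, ⟪(Ω : H), (χ₁ : H)⟫ = 0 →
          pert K W χ₁ - (e : ℂ) • (χ₁ : H) = B Ω - ⟪(Ω : H), B Ω⟫ • (Ω : H) →
          ⟪(Ω : H), (ζ : H)⟫ = 0 → pert K W ζ - (e : ℂ) • (ζ : H) = P χ₁ →
          t ≤ (⟪(ζ : H), P χ₁⟫).re + M * ‖B‖ ^ 3 := by
  have hg := hΩ.gap_pos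
  set q := √(C * (1 + (|e| + ‖W‖) / g) / g) with hq
  -- The sum of the constants of the second and third order bounds, so that one `M`, independent of
  -- `B`, serves for both.
  refine ⟨8 * q ^ 2 / g + 40 * q ^ 2 / g ^ 2, by positivity, fun B hB hJB hb => ?_⟩
  obtain ⟨Ω', e', hΩ', he⟩ := hΩ.exists_pert hK hW hB hb
  have hJWB : ∀ x, (W + B) (J x) = J ((W + B) x) := by
    intro x
    rw [add_apply, add_apply, hJ.map_add, hJW, hJB]
  obtain ⟨η, hη, hsol⟩ := hΩ'.exists_solution hK (hW.add hB)
    (hΩ'.inner_drift_eq_zero hP.symm hJ hJWB)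
  have hodd := hΩ'.inner_response_eq_zero hP.symm hJ hJWB hη hsol
  obtain ⟨h1, h2⟩ := hΩ.response_le hP (hK.symm.pert hW) hPΩ hΩ' he hη hsol hq
  refine ⟨_, ?_, ?_, hΩ'.expansion hK.symm (hW.add hB) hP hη hsol hodd, fun χ₁ ζ a1 a2 a3 a4 => ?_⟩
  · rw [← hsol, inner_sub_right, Complex.sub_re, re_inner_ofReal_smul_self]
    have h3 := hΩ'.gap η hη
    rw [form] at h3
    nlinarith [sq_nonneg ‖(η : H)‖]
  · refine h1.trans ?_
    gcongr
    exact le_add_of_nonneg_right (by positivity)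
  · refine (h2 χ₁ ζ a1 a2 a3 a4).trans ?_
    gcongr
    exact le_add_of_nonneg_left (by positivity)

/-- `v⟨ψ, Pψ⟩` is at most `|v| ‖ψ‖ √(C ⟨ψ, Kψ⟩)`, which the kinetic energy absorbs at the price `C
v² ‖ψ‖²`. So the infimum is genuine for every `v` and every `W`. -/
theorem IsDrift.lower_bound (hK : IsKinetic K) (hP : IsDrift K P C) (W : H →L[ℂ] H) (v : ℝ)
    (ψ : D) : (-(‖W‖ + C * v ^ 2)) * ‖(ψ : H)‖ ^ 2 ≤ form (pert K W - (v : ℂ) • P) ψ := by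
  have h1 : form (pert K W - (v : ℂ) • P) ψ =
      form K ψ + (⟪(ψ : H), W ψ⟫).re - v * (⟪(ψ : H), P ψ⟫).re := by
    rw [form, sub_smul_apply', inner_sub_right, Complex.sub_re, inner_smul_right,
      Complex.re_ofReal_mul, ← form_pert, form]
  have h2 := neg_le_of_abs_le (abs_re_inner_apply_le W ψ ψ)
  have hk := hK.nonneg ψ
  have hC := hP.const_nonneg
  set n := ‖(ψ : H)‖ with hn
  set k := form K ψ
  have h3 : v * (⟪(ψ : H), P ψ⟫).re ≤ k + C * v ^ 2 * n ^ 2 := by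
    have h4 : v * (⟪(ψ : H), P ψ⟫).re ≤ |v| * (n * ‖P ψ‖) := by
      refine (le_abs_self _).trans ?_
      rw [abs_mul]
      gcongr
      exact (Complex.abs_re_le_norm _).trans (norm_inner_le_norm _ _)
    refine h4.trans ?_
    apply le_of_sq_le_sq _ (by positivity)
    calc (|v| * (n * ‖P ψ‖)) ^ 2 = v ^ 2 * n ^ 2 * ‖P ψ‖ ^ 2 := by rw [mul_pow, sq_abs]; ring
      _ ≤ v ^ 2 * n ^ 2 * (C * k) := by gcongr; exact hP.bound ψ
      _ ≤ (k + C * v ^ 2 * n ^ 2) ^ 2 := by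
        have : 0 ≤ k * (C * v ^ 2 * n ^ 2) := by positivity
        nlinarith [sq_nonneg k, sq_nonneg (C * v ^ 2 * n ^ 2)]
  rw [h1]
  nlinarith

/-- The energy is 1-Lipschitz in the bounded part of the operator, with no smallness needed; this
later makes the energies of random potentials measurable. -/
theorem infForm_sub_le (hK : IsKinetic K) (hP : IsDrift K P C) (hne : ∃ ψ : D, ‖(ψ : H)‖ = 1)
    (W W' : H →L[ℂ] H) (v : ℝ) :
    infForm (pert K W) P v - infForm (pert K W') P v ≤ ‖W - W'‖ := by
  rw [sub_le_comm]
  refine le_infForm hne fun ψ => ?_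
  have h1 := infForm_mul_le (hP.lower_bound hK W v) ψ
  have h2 : form (pert K W - (v : ℂ) • P) ψ = form (pert K W' - (v : ℂ) • P) ψ +
      (⟪(ψ : H), (W - W') ψ⟫).re := by
    rw [form, form, sub_smul_apply', sub_smul_apply', pert_apply, pert_apply, sub_apply,
      ← Complex.add_re, ← inner_add_right]
    congr 2
    abel
  have h3 := le_of_abs_le (abs_re_inner_apply_le (W - W') ψ ψ)
  nlinarith

theorem abs_infForm_sub_le (hK : IsKinetic K) (hP : IsDrift K P C)
    (hne : ∃ ψ : D, ‖(ψ : H)‖ = 1) (W W' : H →L[ℂ] H) (v : ℝ) :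
    |infForm (pert K W) P v - infForm (pert K W') P v| ≤ ‖W - W'‖ := by
  refine abs_le.2 ⟨?_, infForm_sub_le hK hP hne W W' v⟩
  have := infForm_sub_le hK hP hne W' W v
  rw [norm_sub_rev] at this
  linarith

end Perturbation

/-! ### Multiplication of the coefficients in a Hilbert basis. -/

section Multiplier

variable {ι E : Type*} [NormedAddCommGroup E] [InnerProductSpace ℂ E]

local notation "⟪" x ", " y "⟫" => inner ℂ x y

theorem memℓp_two_iff {f : ι → ℂ} : Memℓp f 2 ↔ Summable fun n => ‖f n‖ ^ 2 := by
  rw [memℓp_gen_iff (by norm_num)]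
  simp

/-- The coefficient of `x` along the `n`-th vector of a Hilbert basis. -/
def coeff (b : HilbertBasis ι ℂ E) (x : E) (n : ι) : ℂ := b.repr x n

theorem coeff_eq_inner (b : HilbertBasis ι ℂ E) (x : E) (n : ι) : coeff b x n = ⟪b n, x⟫ :=
  b.repr_apply_apply x n

theorem coeff_add (b : HilbertBasis ι ℂ E) (x y : E) (n : ι) :
    coeff b (x + y) n = coeff b x n + coeff b y n := by
  simp only [coeff_eq_inner, inner_add_right]

theorem coeff_sub (b : HilbertBasis ι ℂ E) (x y : E) (n : ι) :
    coeff b (x - y) n = coeff b x n - coeff b y n := by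
  simp only [coeff_eq_inner, inner_sub_right]

theorem coeff_smul (b : HilbertBasis ι ℂ E) (c : ℂ) (x : E) (n : ι) :
    coeff b (c • x) n = c * coeff b x n := by
  simp only [coeff_eq_inner, inner_smul_right]

theorem HilbertBasis.hasSum_inner_repr (b : HilbertBasis ι ℂ E) (x y : E) :
    HasSum (fun n => (starRingEnd ℂ) (coeff b x n) * coeff b y n) ⟪x, y⟫ := by
  refine (b.hasSum_inner_mul_inner x y).congr_fun fun n => ?_
  rw [coeff_eq_inner, coeff_eq_inner, inner_conj_symm]

theorem HilbertBasis.hasSum_sq_norm (b : HilbertBasis ι ℂ E) (x : E) :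
    HasSum (fun n => ‖coeff b x n‖ ^ 2) (‖x‖ ^ 2) := by
  have h := Complex.hasSum_re (HilbertBasis.hasSum_inner_repr b x x)
  rw [re_inner_self] at h
  refine h.congr_fun fun n => ?_
  rw [mul_comm, Complex.mul_conj, Complex.ofReal_re, Complex.normSq_eq_norm_sq]

theorem HilbertBasis.ext_repr (b : HilbertBasis ι ℂ E) {x y : E}
    (h : ∀ n, coeff b x n = coeff b y n) : x = y :=
  b.repr.injective (lp.ext (funext h))

theorem HilbertBasis.memℓp_mul (b : HilbertBasis ι ℂ E) {g : ι → ℂ} {C : ℝ}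
    (hg : ∀ n, ‖g n‖ ≤ C) (x : E) : Memℓp (fun n => g n * coeff b x n) 2 := by
  rw [memℓp_two_iff]
  refine Summable.of_nonneg_of_le (fun _ => sq_nonneg _) (fun n => ?_)
    ((HilbertBasis.hasSum_sq_norm b x).summable.mul_left (C ^ 2))
  rw [norm_mul, mul_pow]
  gcongr
  exact hg n

/-- The bounded operator that multiplies the coefficients in a Hilbert basis by bounded numbers. -/
def multiplier (b : HilbertBasis ι ℂ E) (g : ι → ℂ) (C : ℝ) (hg : ∀ n, ‖g n‖ ≤ C) : E →L[ℂ] E :=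
  LinearMap.mkContinuous
    { toFun := fun x => b.repr.symm ⟨fun n => g n * coeff b x n, HilbertBasis.memℓp_mul b hg x⟩
      map_add' := fun x y => by
        rw [← map_add]
        congr 1
        ext n
        change g n * coeff b (x + y) n = g n * coeff b x n + g n * coeff b y n
        rw [coeff_add, mul_add]
      map_smul' := fun c x => by
        rw [RingHom.id_apply, ← map_smul]
        congr 1
        ext n
        change g n * coeff b (c • x) n = c * (g n * coeff b x n)
        rw [coeff_smul, mul_left_comm] } C (fun x => by
    -- Without indices nothing fixes the sign of `C`, but then the space is trivial.
    rcases isEmpty_or_nonempty ι with hι | ⟨⟨i₀⟩⟩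
    · have : x = 0 := HilbertBasis.ext_repr b fun n => (hι.false n).elim
      subst this
      rw [map_zero]
      simp
    have hC : 0 ≤ C := (norm_nonneg _).trans (hg i₀)
    refine le_of_sq_le_sq ?_ (by positivity)
    rw [mul_pow]
    refine hasSum_le (fun n => ?_) (HilbertBasis.hasSum_sq_norm b _)
      ((HilbertBasis.hasSum_sq_norm b x).mul_left (C ^ 2))
    have : coeff b (b.repr.symm ⟨fun n => g n * coeff b x n, HilbertBasis.memℓp_mul b hg x⟩) n =
        g n * coeff b x n := by
      rw [coeff, b.repr.apply_symm_apply]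
    change ‖coeff b (b.repr.symm ⟨fun n => g n * coeff b x n, _⟩) n‖ ^ 2 ≤ _
    rw [this, norm_mul, mul_pow]
    gcongr
    exact hg n)

theorem repr_multiplier (b : HilbertBasis ι ℂ E) (g : ι → ℂ) (C : ℝ) (hg : ∀ n, ‖g n‖ ≤ C) (x : E)
    (n : ι) : coeff b (multiplier b g C hg x) n = g n * coeff b x n := by
  change b.repr (b.repr.symm _) n = _
  rw [b.repr.apply_symm_apply]

/-- A norm limit of finite rank truncations: outside a finite set all `|g n|` are small, and
Parseval turns this into a bound on the norm of the tail. -/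
theorem isCompactOperator_multiplier [CompleteSpace E] (b : HilbertBasis ι ℂ E) (g : ι → ℂ) (C : ℝ)
    (hg : ∀ n, ‖g n‖ ≤ C) (h0 : Tendsto g cofinite (𝓝 0)) :
    IsCompactOperator (multiplier b g C hg) := by
  classical
  set G : Finset ι → E →L[ℂ] E := fun F =>
    ∑ n ∈ F, (ContinuousLinearMap.toSpanSingleton ℂ (g n • b n)) ∘L (innerSL ℂ (b n)) with hG
  have hGr : ∀ F x n, coeff b (G F x) n = if n ∈ F then g n * coeff b x n else 0 := by
    intro F x n
    have : G F x = ∑ k ∈ F, (coeff b x k * g k) • b k := by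
      rw [hG]
      simp [coeff_eq_inner, smul_smul]
    rw [coeff_eq_inner, this, inner_sum]
    simp only [inner_smul_right, orthonormal_iff_ite.1 b.orthonormal]
    simp [mul_comm]
  have hcomp : ∀ F, IsCompactOperator (G F) := by
    intro F
    induction F using Finset.induction_on with
    | empty => simpa [hG] using isCompactOperator_zero
    | insert i F hi ih =>
      have : G (insert i F) = (ContinuousLinearMap.toSpanSingleton ℂ (g i • b i)) ∘L
          (innerSL ℂ (b i)) + G F := by
        rw [hG]; simp [Finset.sum_insert hi]
      rw [this]
      refine IsCompactOperator.add ?_ ih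
      exact (isCompactOperator_of_locallyCompactSpace_rng
        (ContinuousLinearMap.toSpanSingleton ℂ (g i • b i))).comp_clm (innerSL ℂ (b i))
  refine isCompactOperator_of_tendsto (l := atTop) (F := G) ?_ (Eventually.of_forall hcomp)
  rw [tendsto_iff_norm_sub_tendsto_zero, Metric.tendsto_atTop]
  intro ε hε
  have hfin : {n | ¬ ‖g n‖ < ε / 2}.Finite := by
    have := h0.norm.eventually_lt_const (u := ε / 2) (by simpa using half_pos hε)
    simpa [Filter.eventually_cofinite] using this
  refine ⟨hfin.toFinset, fun F hF => ?_⟩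
  rw [dist_zero_right, norm_norm]
  refine lt_of_le_of_lt ?_ (half_lt_self hε)
  refine ContinuousLinearMap.opNorm_le_bound _ (by positivity) fun x => ?_
  refine le_of_sq_le_sq ?_ (by positivity)
  rw [mul_pow]
  refine hasSum_le (fun n => ?_) (HilbertBasis.hasSum_sq_norm b _)
    ((HilbertBasis.hasSum_sq_norm b x).mul_left _)
  rw [sub_apply, coeff_sub, hGr, repr_multiplier]
  split_ifs with hn
  · rw [sub_self, norm_zero, zero_pow two_ne_zero]; positivity
  · have : ‖g n‖ ≤ ε / 2 := by
      by_contra! hc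
      exact hn (hF (by simpa using hc.le))
    rw [zero_sub, norm_neg, norm_mul, mul_pow]
    gcongr

end Multiplier

/-! ### Operators diagonal in the plane waves. -/

section Diagonal

variable {N d : ℕ} {a : (Fin N × Fin d → ℤ) → ℝ}

local notation "⟪" x ", " y "⟫" => inner ℂ x y

theorem mem_domain_diagonalOp {ψ : Wave N d} : ψ ∈ (diagonalOp a).domain ↔
    Summable fun n => ‖(a n : ℂ) * coeff (planeWave N d) ψ n‖ ^ 2 :=
  memℓp_two_iff

theorem repr_diagonalOp (ψ : (diagonalOp (N := N) (d := d) a).domain) (n : Fin N × Fin d → ℤ) :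
    coeff (planeWave N d) (diagonalOp a ψ) n = a n * coeff (planeWave N d) ψ n := by
  change (planeWave N d).repr ((planeWave N d).repr.symm _) n = _
  rw [LinearIsometryEquiv.apply_symm_apply]
  rfl

theorem diagonalOp_symm (ψ φ : (diagonalOp (N := N) (d := d) a).domain) :
    ⟪diagonalOp a ψ, (φ : Wave N d)⟫ = ⟪(ψ : Wave N d), diagonalOp a φ⟫ := by
  have h1 := HilbertBasis.hasSum_inner_repr (planeWave N d) (diagonalOp a ψ) (φ : Wave N d)
  have h2 := HilbertBasis.hasSum_inner_repr (planeWave N d) (ψ : Wave N d) (diagonalOp a φ)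
  refine h1.unique (h2.congr_fun fun n => ?_)
  rw [repr_diagonalOp, repr_diagonalOp, map_mul, Complex.conj_ofReal, mul_assoc, mul_left_comm]

theorem hasSum_re_inner_diagonalOp (ψ : (diagonalOp (N := N) (d := d) a).domain) :
    HasSum (fun n => a n * ‖coeff (planeWave N d) ψ n‖ ^ 2)
      (⟪(ψ : Wave N d), diagonalOp a ψ⟫).re := by
  have h2 := Complex.hasSum_re
    (HilbertBasis.hasSum_inner_repr (planeWave N d) (ψ : Wave N d) (diagonalOp a ψ))
  refine h2.congr_fun fun n => ?_
  rw [repr_diagonalOp, mul_left_comm, Complex.re_ofReal_mul, mul_comm (starRingEnd ℂ _),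
    Complex.mul_conj, Complex.ofReal_re, Complex.normSq_eq_norm_sq]

theorem hasSum_sq_norm_diagonalOp (ψ : (diagonalOp (N := N) (d := d) a).domain) :
    HasSum (fun n => a n ^ 2 * ‖coeff (planeWave N d) ψ n‖ ^ 2)
      (‖diagonalOp a ψ‖ ^ 2) := by
  refine (HilbertBasis.hasSum_sq_norm (planeWave N d) (diagonalOp a ψ)).congr_fun fun n => ?_
  rw [repr_diagonalOp, norm_mul, mul_pow, Complex.norm_real, Real.norm_eq_abs, sq_abs]

/-- An eigenvector of a diagonal operator is supported on the level set of the eigenvalue. -/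
theorem EigenEq.repr_eq_zero {e : ℝ} {ψ : Wave N d} (h : EigenEq (diagonalOp a) e ψ)
    {n : Fin N × Fin d → ℤ} (hn : a n ≠ e) : coeff (planeWave N d) ψ n = 0 := by
  obtain ⟨hD, he⟩ := h
  have h1 := repr_diagonalOp ⟨ψ, hD⟩ n
  rw [he, coeff_smul] at h1
  have h2 : ((a n : ℂ) - e) * coeff (planeWave N d) ψ n = 0 := by
    rw [sub_mul, h1, sub_self]
  refine (mul_eq_zero.1 h2).resolve_left (sub_ne_zero.2 ?_)
  exact_mod_cast hn

theorem eigenEq_diagonalOp {e : ℝ} {ψ : Wave N d}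
    (h : ∀ n, a n ≠ e → coeff (planeWave N d) ψ n = 0) : EigenEq (diagonalOp a) e ψ := by
  have h1 : ∀ n, (a n : ℂ) * coeff (planeWave N d) ψ n = e * coeff (planeWave N d) ψ n := by
    intro n
    by_cases hn : a n = e
    · rw [hn]
    · rw [h n hn, mul_zero, mul_zero]
  refine ⟨?_, ?_⟩
  · rw [mem_domain_diagonalOp]
    simp_rw [h1, norm_mul, mul_pow]
    exact (HilbertBasis.hasSum_sq_norm (planeWave N d) ψ).summable.mul_left _
  · refine HilbertBasis.ext_repr (planeWave N d) fun n => ?_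
    rw [repr_diagonalOp, h1, coeff_smul]

end Diagonal

/-! ### Permutations, complex conjugation and multiplication operators on wave functions. -/

section Functions

variable {N d : ℕ}

local notation "⟪" x ", " y "⟫" => inner ℂ x y

theorem planeWave_ae (n : Fin N × Fin d → ℤ) :
    planeWave N d n =ᵐ[configMeasure N d] UnitAddTorus.mFourier n := by
  have h := UnitAddTorus.coeFn_mFourierLp (d := Fin N × Fin d) 2 n
  have e : planeWave N d n = UnitAddTorus.mFourierLp 2 n :=
    congrFun UnitAddTorus.coe_mFourierBasis n
  rw [e]
  exact h

theorem permute_ae (σ : Equiv.Perm (Fin N)) (ψ : Wave N d) :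
    permute σ ψ =ᵐ[configMeasure N d] fun y => ψ (relabel σ y) :=
  Lp.coeFn_compMeasurePreserving ψ (measurePreserving_relabel σ)

theorem inner_permute (σ : Equiv.Perm (Fin N)) (ψ φ : Wave N d) :
    ⟪permute σ ψ, permute σ φ⟫ = ⟪ψ, φ⟫ :=
  (Lp.compMeasurePreservingₗᵢ ℂ (relabel (d := d) σ) (measurePreserving_relabel σ)).inner_map_map
    ψ φ

theorem continuous_permute (σ : Equiv.Perm (Fin N)) : Continuous (permute (d := d) σ) :=
  (Lp.compMeasurePreservingₗᵢ ℂ (relabel (d := d) σ) (measurePreserving_relabel σ)).continuous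

theorem mFourier_relabel (σ : Equiv.Perm (Fin N)) (n : Fin N × Fin d → ℤ) (y : Config N d) :
    UnitAddTorus.mFourier (fun q => n (σ q.1, q.2)) (relabel σ y) = UnitAddTorus.mFourier n y := by
  simp only [UnitAddTorus.mFourier, ContinuousMap.coe_mk, relabel]
  exact Fintype.prod_equiv (Equiv.prodCongr σ (Equiv.refl (Fin d))) _ _ fun q => rfl

theorem coeff_permute (σ : Equiv.Perm (Fin N)) (ψ : Wave N d) (n : Fin N × Fin d → ℤ) :
    coeff (planeWave N d) (permute σ ψ) n =
      coeff (planeWave N d) ψ (fun q => n (σ q.1, q.2)) := by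
  have h : permute σ (planeWave N d (fun q => n (σ q.1, q.2))) = planeWave N d n := by
    refine Lp.ext ?_
    filter_upwards [permute_ae σ (planeWave N d (fun q => n (σ q.1, q.2))), planeWave_ae n,
      (measurePreserving_relabel σ).quasiMeasurePreserving.ae
        (planeWave_ae (fun q : Fin N × Fin d => n (σ q.1, q.2)))] with y h1 h2 h3
    rw [h1, h2, h3, mFourier_relabel]
  rw [coeff_eq_inner, coeff_eq_inner, ← h, inner_permute]

/-- Antiunitarity of complex conjugation, which serves as the time reversal of the abstract theory.
-/
theorem inner_star (ψ φ : Wave N d) : ⟪star ψ, star φ⟫ = ⟪φ, ψ⟫ := by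
  rw [L2.inner_def, L2.inner_def]
  refine integral_congr_ae ?_
  filter_upwards [Lp.coeFn_star ψ, Lp.coeFn_star φ] with y h1 h2
  rw [h1, h2, Pi.star_apply, Pi.star_apply]
  simp [mul_comm]

theorem star_add_wave (ψ φ : Wave N d) : star (ψ + φ) = star ψ + star φ := by
  refine Lp.ext ?_
  filter_upwards [Lp.coeFn_star ψ, Lp.coeFn_star φ, Lp.coeFn_star (ψ + φ), Lp.coeFn_add ψ φ,
    Lp.coeFn_add (star ψ) (star φ)] with y h1 h2 h3 h4 h5
  rw [h3, h5, Pi.add_apply, h1, h2, Pi.star_apply, h4, Pi.add_apply, star_add, Pi.star_apply,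
    Pi.star_apply]

theorem star_smul_wave (c : ℂ) (ψ : Wave N d) : star (c • ψ) = (starRingEnd ℂ) c • star ψ := by
  refine Lp.ext ?_
  filter_upwards [Lp.coeFn_star ψ, Lp.coeFn_star (c • ψ), Lp.coeFn_smul c ψ,
    Lp.coeFn_smul ((starRingEnd ℂ) c) (star ψ)] with y h1 h2 h3 h4
  rw [h2, h4, Pi.smul_apply, h1, Pi.star_apply, h3, Pi.smul_apply, smul_eq_mul, smul_eq_mul,
    star_mul', Pi.star_apply, starRingEnd_apply]

theorem permute_star (σ : Equiv.Perm (Fin N)) (ψ : Wave N d) :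
    permute σ (star ψ) = star (permute σ ψ) := by
  refine Lp.ext ?_
  filter_upwards [permute_ae σ ψ, permute_ae σ (star ψ), Lp.coeFn_star (permute σ ψ),
    (measurePreserving_relabel σ).quasiMeasurePreserving.ae (Lp.coeFn_star ψ)] with y h1 h2 h3 h4
  rw [h2, h3, h4, Pi.star_apply, Pi.star_apply, h1]

/-- Conjugation reverses every wave vector; it therefore preserves the kinetic energy and flips the
momentum. -/
theorem coeff_star (ψ : Wave N d) (n : Fin N × Fin d → ℤ) :
    coeff (planeWave N d) (star ψ) n = (starRingEnd ℂ) (coeff (planeWave N d) ψ (-n)) := by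
  have h : star (planeWave N d (-n)) = planeWave N d n := by
    refine Lp.ext ?_
    filter_upwards [Lp.coeFn_star (planeWave N d (-n)), planeWave_ae n, planeWave_ae (-n)]
      with y h1 h2 h3
    rw [h1, h2, Pi.star_apply, h3, UnitAddTorus.mFourier_neg, ← starRingEnd_apply,
      Complex.conj_conj]
  rw [coeff_eq_inner, coeff_eq_inner, ← h, inner_star, inner_conj_symm]

/-- A measurable function bounded by `C`. -/
structure BddMeas (f : Config N d → ℂ) (C : ℝ) : Prop where
  measurable : Measurable f
  bound : ∀ y, ‖f y‖ ≤ C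

variable {f g : Config N d → ℂ} {C C' : ℝ}

theorem BddMeas.nonneg (hf : BddMeas f C) : 0 ≤ C := (norm_nonneg _).trans (hf.bound 0)

theorem BddMeas.mem_domain (hf : BddMeas f C) (ψ : Wave N d) : ψ ∈ (mulOp f).domain := by
  change MemLp (fun y => f y * ψ y) 2 (configMeasure N d)
  refine MemLp.of_le_mul (c := C) (Lp.memLp ψ)
    (hf.measurable.aestronglyMeasurable.mul (Lp.aestronglyMeasurable ψ)) (ae_of_all _ fun y => ?_)
  rw [norm_mul]
  exact mul_le_mul_of_nonneg_right (hf.bound y) (norm_nonneg _)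

theorem mulOp_ae (ψ : (mulOp f).domain) :
    mulOp f ψ =ᵐ[configMeasure N d] fun y => f y * (ψ : Wave N d) y :=
  MemLp.coeFn_toLp ψ.2

theorem BddMeas.norm_le (hf : BddMeas f C) (ψ : Wave N d) :
    ‖mulOp f ⟨ψ, hf.mem_domain ψ⟩‖ ≤ C * ‖ψ‖ := by
  refine Lp.norm_le_mul_norm_of_ae_le_mul ?_
  filter_upwards [mulOp_ae ⟨ψ, hf.mem_domain ψ⟩] with y h1
  rw [h1, norm_mul]
  exact mul_le_mul_of_nonneg_right (hf.bound y) (norm_nonneg _)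

/-- Multiplication by a bounded measurable function, as a bounded operator. -/
def mulCLM (hf : BddMeas f C) : Wave N d →L[ℂ] Wave N d :=
  LinearMap.mkContinuous
    { toFun := fun ψ => mulOp f ⟨ψ, hf.mem_domain ψ⟩
      map_add' := fun ψ φ => (mulOp f).map_add ⟨ψ, hf.mem_domain ψ⟩ ⟨φ, hf.mem_domain φ⟩
      map_smul' := fun c ψ => (mulOp f).map_smul c ⟨ψ, hf.mem_domain ψ⟩ } C hf.norm_le

theorem mulCLM_ae (hf : BddMeas f C) (ψ : Wave N d) :
    mulCLM hf ψ =ᵐ[configMeasure N d] fun y => f y * ψ y :=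
  mulOp_ae ⟨ψ, hf.mem_domain ψ⟩

theorem norm_mulCLM_le (hf : BddMeas f C) : ‖mulCLM hf‖ ≤ C :=
  LinearMap.mkContinuous_norm_le _ hf.nonneg _

theorem mulCLM_symm (hf : BddMeas f C) (hr : ∀ y, (starRingEnd ℂ) (f y) = f y) :
    BddSymm (mulCLM hf) := by
  intro ψ φ
  rw [L2.inner_def, L2.inner_def]
  refine integral_congr_ae ?_
  filter_upwards [mulCLM_ae hf ψ, mulCLM_ae hf φ] with y h1 h2
  rw [h1, h2, ← smul_eq_mul, ← smul_eq_mul, inner_smul_left, inner_smul_right, hr]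

theorem permute_mulCLM (hf : BddMeas f C) (σ : Equiv.Perm (Fin N))
    (hσ : ∀ y, f (relabel σ y) = f y) (ψ : Wave N d) :
    permute σ (mulCLM hf ψ) = mulCLM hf (permute σ ψ) := by
  refine Lp.ext ?_
  filter_upwards [permute_ae σ ψ, permute_ae σ (mulCLM hf ψ), mulCLM_ae hf (permute σ ψ),
    (measurePreserving_relabel σ).quasiMeasurePreserving.ae (mulCLM_ae hf ψ)] with y h1 h2 h3 h4
  rw [h2, h3, h4, h1, hσ]

theorem mulCLM_star (hf : BddMeas f C) (hr : ∀ y, (starRingEnd ℂ) (f y) = f y) (ψ : Wave N d) :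
    mulCLM hf (star ψ) = star (mulCLM hf ψ) := by
  refine Lp.ext ?_
  filter_upwards [mulCLM_ae hf (star ψ), Lp.coeFn_star ψ, Lp.coeFn_star (mulCLM hf ψ),
    mulCLM_ae hf ψ] with y h1 h2 h3 h4
  rw [h1, h2, h3, Pi.star_apply, Pi.star_apply, h4, star_mul', ← starRingEnd_apply (f y), hr]

theorem bddMeas_mFourier (m : Fin N × Fin d → ℤ) :
    BddMeas (N := N) (d := d) (UnitAddTorus.mFourier m) 1 where
  measurable := (UnitAddTorus.mFourier m).continuous.measurable
  bound y := ((UnitAddTorus.mFourier m).norm_coe_le_norm y).trans UnitAddTorus.mFourier_norm.le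

/-- Multiplication by a plane wave shifts the Fourier coefficients. -/
theorem coeff_mulCLM_mFourier (m : Fin N × Fin d → ℤ)
    (hm : BddMeas (N := N) (d := d) (UnitAddTorus.mFourier m) C) (ψ : Wave N d)
    (n : Fin N × Fin d → ℤ) :
    coeff (planeWave N d) (mulCLM hm ψ) n = coeff (planeWave N d) ψ (n - m) := by
  rw [coeff_eq_inner, coeff_eq_inner, L2.inner_def, L2.inner_def]
  refine integral_congr_ae ?_
  filter_upwards [mulCLM_ae hm ψ, planeWave_ae n, planeWave_ae (n - m)] with y h1 h2 h3
  have e : UnitAddTorus.mFourier (n - m) y =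
      UnitAddTorus.mFourier n y * (starRingEnd ℂ) (UnitAddTorus.mFourier m y) := by
    rw [sub_eq_add_neg, UnitAddTorus.mFourier_add, UnitAddTorus.mFourier_neg]
  rw [h1, h2, h3, e]
  simp only [RCLike.inner_apply, map_mul, Complex.conj_conj]
  ring

theorem mulCLM_sum {ι : Type*} (F : Finset ι) (φ : ι → Config N d → ℂ) (c : ι → ℂ) {C' : ι → ℝ}
    (hφ : ∀ k, BddMeas (φ k) (C' k)) (hf : BddMeas f C) (h : ∀ y, f y = ∑ k ∈ F, c k * φ k y)
    (ψ : Wave N d) : mulCLM hf ψ = ∑ k ∈ F, c k • mulCLM (hφ k) ψ := by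
  refine Lp.ext ?_
  have h1 : ∀ᵐ y ∂configMeasure N d, ∀ k ∈ F, (c k • mulCLM (hφ k) ψ : Wave N d) y =
      c k * (φ k y * ψ y) := by
    refine (eventually_all_finset F).2 fun k _ => ?_
    filter_upwards [mulCLM_ae (hφ k) ψ, Lp.coeFn_smul (c k) (mulCLM (hφ k) ψ)] with y h1 h2
    rw [h2, Pi.smul_apply, h1, smul_eq_mul]
  filter_upwards [mulCLM_ae hf ψ, h1, Lp.coeFn_finsetSum F fun k => c k • mulCLM (hφ k) ψ]
    with y h2 h3 h4
  rw [h2, h4, Finset.sum_apply, Finset.sum_congr rfl h3, h, Finset.sum_mul]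
  exact Finset.sum_congr rfl fun k _ => mul_assoc _ _ _

end Functions

/-! ### Periodic functions on `ℝ^d` as functions on the torus. -/

section Periodic

variable {d : ℕ} {L : ℝ} {f : (Fin d → ℝ) → ℝ}

/-- The point of `[0,L)^d` with the given coordinates modulo `1`. -/
def boxPoint (L : ℝ) (y : UnitAddTorus (Fin d)) : Fin d → ℝ :=
  fun i => L * (AddCircle.equivIco (1 : ℝ) 0 (y i) : ℝ)

theorem position_eq_boxPoint {N : ℕ} (L : ℝ) (j : Fin N) (y : Config N d) :
    position L j y = boxPoint L fun i => y (j, i) := rfl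

theorem BoxPeriodic.add_int (hf : BoxPeriodic L f) (x : Fin d → ℝ) (n : Fin d → ℤ) :
    f (x + fun i => L * n i) = f x := by
  -- The periods of `f` form a group, so the generators `L e_i` suffice.
  let G : AddSubgroup (Fin d → ℝ) :=
    { carrier := {c | ∀ x, f (x + c) = f x}
      zero_mem' := fun x => by rw [add_zero]
      add_mem' := fun {a b} ha hb x => by rw [← add_assoc, hb, ha]
      neg_mem' := fun {a} ha x => by
        have := ha (x + -a)
        rw [neg_add_cancel_right] at this
        exact this.symm }
  have h1 : ∀ i, (Pi.single i L : Fin d → ℝ) ∈ G := fun i x => hf x i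
  have h2 : (fun i => L * n i) = ∑ i, n i • (Pi.single i L : Fin d → ℝ) := by
    funext k
    simp [Finset.sum_apply, Pi.single_apply, mul_comm]
  have h3 : (fun i => L * n i) ∈ G := by
    rw [h2]
    exact sum_mem fun i _ => zsmul_mem (h1 i) _
  exact h3 x

/-- A box periodic function evaluated at the representative in the box. -/
theorem BoxPeriodic.boxPoint_mk (hf : BoxPeriodic L f) (t : Fin d → ℝ) :
    f (boxPoint L fun i => (t i : UnitAddCircle)) = f fun i => L * t i := by
  have h : ∀ i, ∃ n : ℤ, (AddCircle.equivIco (1 : ℝ) 0 (t i : UnitAddCircle) : ℝ) = t i + n := by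
    intro i
    refine ⟨-⌊t i⌋, ?_⟩
    rw [AddCircle.coe_equivIco_mk_apply, div_one, mul_one, Int.cast_neg, ← sub_eq_add_neg,
      Int.self_sub_floor]
  choose n hn using h
  have : (boxPoint L fun i => (t i : UnitAddCircle)) =
      (fun i => L * t i) + fun i => L * n i := by
    funext i
    rw [boxPoint, hn, Pi.add_apply, mul_add]
  rw [this, hf.add_int]

/-- The representative in the box jumps at the boundary, so continuity is tested after pulling back
along the quotient map from `ℝ^d`, where periodicity turns the function into `f (L t)`. -/
theorem continuous_comp_boxPoint (hc : Continuous f) (hf : BoxPeriodic L f) :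
    Continuous fun y => f (boxPoint L y) := by
  have hq : IsOpenQuotientMap (Pi.map fun (_ : Fin d) (t : ℝ) => (t : UnitAddCircle)) :=
    IsOpenQuotientMap.piMap fun _ => QuotientAddGroup.isOpenQuotientMap_mk
  rw [hq.isQuotientMap.continuous_iff]
  have : (fun y => f (boxPoint L y)) ∘ (Pi.map fun (_ : Fin d) (t : ℝ) => (t : UnitAddCircle)) =
      fun t => f fun i => L * t i := by
    funext t
    exact hf.boxPoint_mk t
  rw [this]
  fun_prop

theorem BoxPeriodic.exists_bound (hL : 0 < L) (hc : Continuous f) (hf : BoxPeriodic L f) :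
    ∃ C, ∀ x, |f x| ≤ C := by
  obtain ⟨C, hC⟩ := (isCompact_range (continuous_comp_boxPoint hc hf)).isBounded.exists_norm_le
  refine ⟨C, fun x => ?_⟩
  have h1 := hf.boxPoint_mk fun i => x i / L
  have h2 : (fun i => L * (x i / L)) = x := by funext i; field_simp
  rw [h2] at h1
  rw [← h1]
  exact hC _ ⟨_, rfl⟩

end Periodic

/-! ### Particle statistics; kinetic energy and momentum in the `N`-particle space. -/

section Sector

variable {N d : ℕ} {s : Statistics}

local notation "⟪" x ", " y "⟫" => inner ℂ x y

/-- One description for all three statistics, with no condition for distinguishable particles. The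
character is real, so that antilinear conjugation preserves the sector as well. -/
theorem exists_mem_sector_iff (s : Statistics) : ∃ (p : Equiv.Perm (Fin N) → Prop)
    (χ : Equiv.Perm (Fin N) → ℝ), ∀ ψ : Wave N d, ψ ∈ sector N d s ↔
      ∀ σ, p σ → permute σ ψ = (χ σ : ℂ) • ψ := by
  cases s with
  | distinguishable => exact ⟨fun _ => False, fun _ => 1, fun ψ => by simp [sector]⟩
  | bose =>
    refine ⟨fun _ => True, fun _ => 1, fun ψ => ?_⟩
    simp [sector, Submodule.mem_iInf]
  | fermi =>
    refine ⟨fun _ => True, fun σ => (Equiv.Perm.sign σ : ℤ), fun ψ => ?_⟩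
    simp [sector, Submodule.mem_iInf]

theorem isClosed_sector (s : Statistics) : IsClosed (sector N d s : Set (Wave N d)) := by
  obtain ⟨p, χ, h⟩ := exists_mem_sector_iff (N := N) (d := d) s
  have : (sector N d s : Set (Wave N d)) =
      ⋂ σ, {ψ | p σ → permute σ ψ = (χ σ : ℂ) • ψ} := by
    ext ψ; simp [h]
  rw [this]
  refine isClosed_iInter fun σ => ?_
  by_cases hp : p σ
  · simp only [hp, true_imp_iff]
    exact isClosed_eq (continuous_permute σ) (continuous_const_smul _)
  · simp [hp]

instance : CompleteSpace (sector N d s) := (isClosed_sector s).completeSpace_coe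

/-- A homogeneous map that commutes with the permutations preserves the particle statistics. -/
theorem mem_sector_of_comm {X : Wave N d → Wave N d}
    (hX : ∀ (c : ℝ) ψ, X ((c : ℂ) • ψ) = (c : ℂ) • X ψ)
    (hc : ∀ σ ψ, permute σ (X ψ) = X (permute σ ψ)) {ψ : Wave N d} (h : ψ ∈ sector N d s) :
    X ψ ∈ sector N d s := by
  obtain ⟨p, χ, hp⟩ := exists_mem_sector_iff (N := N) (d := d) s
  rw [hp] at h ⊢
  intro σ hσ
  rw [hc, h σ hσ, hX]

/-- Multiplying the Fourier coefficients by a symmetric function preserves the statistics. -/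
theorem mem_sector_of_coeff {ψ φ : Wave N d} {g : (Fin N × Fin d → ℤ) → ℂ}
    (hg : ∀ (σ : Equiv.Perm (Fin N)) n, g (fun q => n (σ q.1, q.2)) = g n)
    (hφ : ∀ n, coeff (planeWave N d) φ n = g n * coeff (planeWave N d) ψ n)
    (h : ψ ∈ sector N d s) : φ ∈ sector N d s := by
  obtain ⟨p, χ, hp⟩ := exists_mem_sector_iff (N := N) (d := d) s
  rw [hp] at h ⊢
  intro σ hσ
  refine HilbertBasis.ext_repr (planeWave N d) fun n => ?_
  have h1 := congrArg (fun x => coeff (planeWave N d) x n) (h σ hσ)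
  simp only [coeff_permute, coeff_smul] at h1
  rw [coeff_permute, coeff_smul, hφ, hφ, hg, h1]
  ring

theorem star_mem_sector {ψ : Wave N d} (h : ψ ∈ sector N d s) : star ψ ∈ sector N d s :=
  mem_sector_of_comm (fun c ψ => by rw [star_smul_wave, Complex.conj_ofReal]) permute_star h

/-- The restriction of a bounded operator to an invariant subspace. -/
def restrictCLM (S : Submodule ℂ (Wave N d)) (W : Wave N d →L[ℂ] Wave N d)
    (h : ∀ x ∈ S, W x ∈ S) : S →L[ℂ] S :=
  (W ∘L S.subtypeL).codRestrict S fun x => h x x.2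

theorem coe_restrictCLM (S : Submodule ℂ (Wave N d)) (W : Wave N d →L[ℂ] Wave N d)
    (h : ∀ x ∈ S, W x ∈ S) (x : S) : (restrictCLM S W h x : Wave N d) = W x := rfl

theorem norm_restrictCLM_le (S : Submodule ℂ (Wave N d)) (W : Wave N d →L[ℂ] Wave N d)
    (h : ∀ x ∈ S, W x ∈ S) : ‖restrictCLM S W h‖ ≤ ‖W‖ :=
  ContinuousLinearMap.opNorm_le_bound _ (norm_nonneg _) fun x => W.le_opNorm x

/-- The restriction of a partially defined operator to a subspace. -/
def restrictPMap (S : Submodule ℂ (Wave N d)) (D : Submodule ℂ S) (A : Wave N d →ₗ.[ℂ] Wave N d)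
    (hD : ∀ x : D, ((x : S) : Wave N d) ∈ A.domain)
    (hS : ∀ x : D, A ⟨((x : S) : Wave N d), hD x⟩ ∈ S) : D →ₗ[ℂ] S :=
  LinearMap.codRestrict S
    (A.toFun ∘ₗ LinearMap.codRestrict A.domain (S.subtype ∘ₗ D.subtype) hD) hS

/-- The kinetic energy of the plane wave with the wave vectors `(2π/L) n`. -/
def kineticValue {N d : ℕ} (L m : ℝ) (n : Fin N × Fin d → ℤ) : ℝ :=
  ∑ j, ∑ i, waveVector L (fun i' => n (j, i')) i ^ 2 / (2 * m)

/-- The total momentum of the plane wave with the wave vectors `(2π/L) n`. -/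
def momentumValue {N d : ℕ} (L : ℝ) (i : Fin d) (n : Fin N × Fin d → ℤ) : ℝ :=
  ∑ j, waveVector L (fun i' => n (j, i')) i

theorem kineticValue_nonneg {L m : ℝ} (hm : 0 < m) (n : Fin N × Fin d → ℤ) :
    0 ≤ kineticValue L m n :=
  Finset.sum_nonneg fun _ _ => Finset.sum_nonneg fun _ _ => by positivity

/-- Cauchy–Schwarz over the `N` particles; the source of the drift constant `2mN`. -/
theorem sq_momentumValue_le {L m : ℝ} (hm : 0 < m) (i : Fin d) (n : Fin N × Fin d → ℤ) :
    momentumValue L i n ^ 2 ≤ 2 * m * N * kineticValue L m n := by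
  have h1 := sq_sum_le_card_mul_sum_sq (s := (Finset.univ : Finset (Fin N)))
    (f := fun j => waveVector L (fun i' => n (j, i')) i)
  rw [Finset.card_univ, Fintype.card_fin] at h1
  refine h1.trans ?_
  have h2 : ∑ j, waveVector L (fun i' => n (j, i')) i ^ 2 ≤ 2 * m * kineticValue L m n := by
    rw [kineticValue, Finset.mul_sum]
    refine Finset.sum_le_sum fun j _ => ?_
    rw [Finset.mul_sum]
    refine le_trans (le_of_eq ?_) (Finset.single_le_sum (f := fun i =>
      2 * m * (waveVector L (fun i' => n (j, i')) i ^ 2 / (2 * m)))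
      (fun i _ => by positivity) (Finset.mem_univ i))
    field_simp
  calc (N : ℝ) * ∑ j, waveVector L (fun i' => n (j, i')) i ^ 2
      ≤ N * (2 * m * kineticValue L m n) := by gcongr
    _ = _ := by ring

theorem kineticValue_perm (L m : ℝ) (σ : Equiv.Perm (Fin N)) (n : Fin N × Fin d → ℤ) :
    kineticValue L m (fun q => n (σ q.1, q.2)) = kineticValue L m n :=
  Equiv.sum_comp σ fun j => ∑ i, waveVector L (fun i' => n (j, i')) i ^ 2 / (2 * m)

theorem momentumValue_perm (L : ℝ) (i : Fin d) (σ : Equiv.Perm (Fin N))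
    (n : Fin N × Fin d → ℤ) : momentumValue L i (fun q => n (σ q.1, q.2)) = momentumValue L i n :=
  Equiv.sum_comp σ fun j => waveVector L (fun i' => n (j, i')) i

theorem kineticValue_neg (L m : ℝ) (n : Fin N × Fin d → ℤ) :
    kineticValue L m (-n) = kineticValue L m n := by
  simp [kineticValue, waveVector]

theorem momentumValue_neg (L : ℝ) (i : Fin d) (n : Fin N × Fin d → ℤ) :
    momentumValue L i (-n) = -momentumValue L i n := by
  simp [momentumValue, waveVector]

/-- Only finitely many lattice points lie below a given kinetic energy, since each coordinate is
then bounded. The compactness of the resolvent rests on this. -/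
theorem tendsto_kineticValue {L m : ℝ} (hL : 0 < L) (hm : 0 < m) :
    Tendsto (kineticValue (N := N) (d := d) L m) cofinite atTop := by
  rw [tendsto_atTop]
  intro R
  have hc : 0 < (2 * Real.pi / L) ^ 2 / (2 * m) := by positivity
  set c := (2 * Real.pi / L) ^ 2 / (2 * m) with hcdef
  obtain ⟨M, hM⟩ := exists_nat_gt (R / c)
  have hfin : (Set.Icc (fun _ => -(M : ℤ)) (fun _ => (M : ℤ)) : Set (Fin N × Fin d → ℤ)).Finite :=
    Set.finite_Icc _ _
  refine (hfin.subset fun n hn => ?_)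
  simp only [Set.mem_ofPred_eq, not_le, Set.mem_compl_iff] at hn
  have hq : ∀ q, |n q| ≤ M := by
    intro q
    by_contra! hq
    have h1 : c * (n q : ℝ) ^ 2 ≤ kineticValue L m n := by
      have h2 : c * (n q : ℝ) ^ 2 = waveVector L (fun i' => n (q.1, i')) q.2 ^ 2 / (2 * m) := by
        rw [hcdef, waveVector]; ring
      rw [h2, kineticValue]
      refine le_trans ?_ (Finset.single_le_sum (f := fun j => ∑ i,
        waveVector L (fun i' => n (j, i')) i ^ 2 / (2 * m))
        (fun j _ => Finset.sum_nonneg fun i _ => by positivity) (Finset.mem_univ q.1))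
      exact Finset.single_le_sum (f := fun i =>
        waveVector L (fun i' => n (q.1, i')) i ^ 2 / (2 * m))
        (fun i _ => by positivity) (Finset.mem_univ q.2)
    have h3 : (M : ℝ) ≤ (n q : ℝ) ^ 2 := by
      have h4 : (M : ℤ) + 1 ≤ |n q| := hq
      have h5 : (M : ℤ) ≤ n q ^ 2 := by
        rw [← sq_abs]
        nlinarith [abs_nonneg (n q)]
      exact_mod_cast h5
    have h6 : R < c * M := by rwa [div_lt_iff₀' hc] at hM
    nlinarith
  exact ⟨fun q => (abs_le.1 (hq q)).1, fun q => (abs_le.1 (hq q)).2⟩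

variable {L m : ℝ}

/-- The domain of the kinetic energy in the `N`-particle Hilbert space. -/
def kineticDomain (s : Statistics) (N d : ℕ) (L m : ℝ) : Submodule ℂ (sector N d s) :=
  (kinetic N d L m).domain.comap (sector N d s).subtype

/-- The kinetic energy as an operator in the `N`-particle Hilbert space. -/
def sectorKinetic (s : Statistics) (N d : ℕ) (L m : ℝ) :
    kineticDomain s N d L m →ₗ[ℂ] sector N d s :=
  restrictPMap _ _ (kinetic N d L m) (fun x => x.2) fun x =>
    mem_sector_of_coeff (g := fun n => (kineticValue L m n : ℂ))
      (fun σ n => by rw [kineticValue_perm]) (fun n => repr_diagonalOp _ n) x.1.2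

/-- The square of the momentum is controlled by the kinetic value `k`, and `k ≤ k² + 1`. -/
theorem mem_totalMomentum_domain (hm : 0 < m) (i : Fin d) {ψ : Wave N d}
    (h : ψ ∈ (kinetic N d L m).domain) : ψ ∈ (totalMomentum N d L i).domain := by
  have h1 := mem_domain_diagonalOp.1 h
  refine mem_domain_diagonalOp.2 (Summable.of_nonneg_of_le (fun _ => sq_nonneg _) (fun n => ?_)
    ((h1.add (HilbertBasis.hasSum_sq_norm (planeWave N d) ψ).summable).mul_left (2 * m * N)))
  have h2 := sq_momentumValue_le (L := L) hm i n
  have h3 := kineticValue_nonneg (L := L) hm n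
  change ‖(momentumValue L i n : ℂ) * _‖ ^ 2 ≤ 2 * m * N * (‖(kineticValue L m n : ℂ) * _‖ ^ 2 + _)
  rw [norm_mul, norm_mul, mul_pow, mul_pow, Complex.norm_real, Complex.norm_real,
    Real.norm_eq_abs, Real.norm_eq_abs, sq_abs, sq_abs]
  have h4 : momentumValue L i n ^ 2 ≤ 2 * m * N * (kineticValue L m n ^ 2 + 1) := by
    refine h2.trans ?_
    gcongr
    nlinarith [sq_nonneg (kineticValue L m n - 1)]
  calc momentumValue L i n ^ 2 * ‖coeff (planeWave N d) ψ n‖ ^ 2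
      ≤ 2 * m * N * (kineticValue L m n ^ 2 + 1) * ‖coeff (planeWave N d) ψ n‖ ^ 2 := by gcongr
    _ = _ := by ring

/-- A component of the total momentum as an operator in the `N`-particle Hilbert space. -/
def sectorMomentum (s : Statistics) (N d : ℕ) (L m : ℝ) (hm : 0 < m) (i : Fin d) :
    kineticDomain s N d L m →ₗ[ℂ] sector N d s :=
  restrictPMap _ _ (totalMomentum N d L i) (fun x => mem_totalMomentum_domain hm i x.2) fun x =>
    mem_sector_of_coeff (g := fun n => (momentumValue L i n : ℂ))
      (fun σ n => by rw [momentumValue_perm]) (fun n => repr_diagonalOp _ n) x.1.2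

/-- In plane waves the resolvent is multiplication by `1/(k + c)` with `k` the kinetic value, which
tends to zero. It is symmetric in the particles and so restricts to the closed sector. -/
theorem isKinetic_sectorKinetic (hL : 0 < L) (hm : 0 < m) :
    IsKinetic (sectorKinetic s N d L m) where
  symm ψ φ := diagonalOp_symm ⟨((ψ : sector N d s) : Wave N d), ψ.2⟩
    ⟨((φ : sector N d s) : Wave N d), φ.2⟩
  nonneg ψ := by
    have h := hasSum_re_inner_diagonalOp ⟨((ψ : sector N d s) : Wave N d), ψ.2⟩
    exact h.nonneg fun n => mul_nonneg (kineticValue_nonneg hm n) (sq_nonneg _)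
  resolvent c hc := by
    set g : (Fin N × Fin d → ℤ) → ℂ := fun n => ((1 / (kineticValue L m n + c) : ℝ) : ℂ) with hg
    have hpos : ∀ n : Fin N × Fin d → ℤ, 0 < kineticValue L m n + c := fun n =>
      add_pos_of_nonneg_of_pos (kineticValue_nonneg hm n) hc
    have hgb : ∀ n, ‖g n‖ ≤ 1 / c := by
      intro n
      rw [hg, Complex.norm_real, Real.norm_of_nonneg (by have := hpos n; positivity)]
      exact one_div_le_one_div_of_le hc (le_add_of_nonneg_left (kineticValue_nonneg hm n))
    have hg0 : Tendsto g cofinite (𝓝 0) := by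
      have h1 : Tendsto (fun n : Fin N × Fin d → ℤ => 1 / (kineticValue L m n + c)) cofinite
          (𝓝 0) := by
        simp_rw [one_div]
        exact (tendsto_atTop_add_const_right _ c (tendsto_kineticValue hL hm)).inv_tendsto_atTop
      have := (Complex.continuous_ofReal.tendsto 0).comp h1
      rwa [Complex.ofReal_zero] at this
    set G := multiplier (planeWave N d) g (1 / c) hgb with hG
    have hGS : ∀ x ∈ sector N d s, G x ∈ sector N d s := fun x hx =>
      mem_sector_of_coeff (g := g) (fun σ n => by rw [hg]; simp only [kineticValue_perm])
        (repr_multiplier (planeWave N d) g (1 / c) hgb x) hx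
    have hGc : IsCompactOperator (restrictCLM (sector N d s) G hGS) := by
      have h1 : IsCompactOperator (G ∘L (sector N d s).subtypeL) :=
        (isCompactOperator_multiplier (planeWave N d) g (1 / c) hgb hg0).comp_clm _
      exact h1.codRestrict (fun x => hGS x x.2) (isClosed_sector s)
    refine ⟨restrictCLM _ G hGS, hGc, fun f => ?_⟩
    have hcoef : ∀ n, (kineticValue L m n : ℂ) * coeff (planeWave N d) (G f) n =
        coeff (planeWave N d) f n - c * coeff (planeWave N d) (G f) n := by
      intro n
      rw [hG, repr_multiplier, hg]
      have : (kineticValue L m n : ℂ) + c ≠ 0 := by exact_mod_cast (hpos n).ne'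
      push_cast
      field_simp
      ring
    have hD : G f ∈ (kinetic N d L m).domain := by
      refine mem_domain_diagonalOp.2 ?_
      have h1 := (HilbertBasis.hasSum_sq_norm (planeWave N d)
        ((f : Wave N d) - (c : ℂ) • G f)).summable
      refine h1.congr fun n => ?_
      rw [coeff_sub, coeff_smul, ← hcoef]
      rfl
    refine ⟨hD, Subtype.ext (HilbertBasis.ext_repr (planeWave N d) fun n => ?_)⟩
    rw [Submodule.coe_add, Submodule.coe_smul, coeff_add, coeff_smul]
    have h1 : coeff (planeWave N d) (sectorKinetic s N d L m
        ⟨restrictCLM (sector N d s) G hGS f, hD⟩ : Wave N d) n =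
        (kineticValue L m n : ℂ) * coeff (planeWave N d) (G f) n :=
      repr_diagonalOp ⟨G f, hD⟩ n
    rw [h1, hcoef, coe_restrictCLM, sub_add_cancel]

theorem isDrift_sectorMomentum (hm : 0 < m) (i : Fin d) :
    IsDrift (sectorKinetic s N d L m) (sectorMomentum s N d L m hm i) (2 * m * N) where
  symm ψ φ := diagonalOp_symm
    ⟨((ψ : sector N d s) : Wave N d), mem_totalMomentum_domain hm i ψ.2⟩
    ⟨((φ : sector N d s) : Wave N d), mem_totalMomentum_domain hm i φ.2⟩
  const_nonneg := by positivity
  bound ψ := by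
    have h1 := hasSum_re_inner_diagonalOp ⟨((ψ : sector N d s) : Wave N d), ψ.2⟩
    have h2 := hasSum_sq_norm_diagonalOp
      ⟨((ψ : sector N d s) : Wave N d), mem_totalMomentum_domain hm i ψ.2⟩
    refine hasSum_le (fun n => ?_) h2 (h1.mul_left (2 * m * N))
    rw [← mul_assoc]
    exact mul_le_mul_of_nonneg_right (sq_momentumValue_le hm i n) (sq_nonneg _)

/-- Complex conjugation of the wave functions. -/
def sectorConj (s : Statistics) (N d : ℕ) (ψ : sector N d s) : sector N d s := ⟨star (ψ : Wave N d), star_mem_sector ψ.2⟩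

theorem isReversal_sectorConj (hm : 0 < m) (i : Fin d) :
    IsReversal (sectorKinetic s N d L m) (sectorMomentum s N d L m hm i) (sectorConj s N d) where
  map_add x y := Subtype.ext (star_add_wave _ _)
  map_smul c x := Subtype.ext (star_smul_wave c _)
  inner_map x y := inner_star _ _
  mem x hx := by
    have h1 := mem_domain_diagonalOp.1 hx
    refine mem_domain_diagonalOp.2 ?_
    refine ((Equiv.neg _).summable_iff.2 h1).congr fun n => ?_
    change ‖(kineticValue L m (-n) : ℂ) * coeff (planeWave N d) (x : Wave N d) (-n)‖ ^ 2 =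
      ‖(kineticValue L m n : ℂ) * coeff (planeWave N d) (star (x : Wave N d)) n‖ ^ 2
    rw [coeff_star, kineticValue_neg, norm_mul, norm_mul, RCLike.norm_conj]
  comm ψ := by
    refine Subtype.ext (HilbertBasis.ext_repr (planeWave N d) fun n => ?_)
    have h1 : ∀ (φ : kineticDomain s N d L m) n, coeff (planeWave N d)
        (sectorKinetic s N d L m φ : Wave N d) n =
        (kineticValue L m n : ℂ) * coeff (planeWave N d) (φ : sector N d s) n :=
      fun φ n => repr_diagonalOp ⟨((φ : sector N d s) : Wave N d), φ.2⟩ n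
    rw [h1]
    change _ * coeff (planeWave N d) (star ((ψ : sector N d s) : Wave N d)) n =
      coeff (planeWave N d) (star (sectorKinetic s N d L m ψ : Wave N d)) n
    rw [coeff_star, coeff_star, h1, map_mul, Complex.conj_ofReal, kineticValue_neg]
  anticomm ψ := by
    refine Subtype.ext (HilbertBasis.ext_repr (planeWave N d) fun n => ?_)
    have h1 : ∀ (φ : kineticDomain s N d L m) n, coeff (planeWave N d)
        (sectorMomentum s N d L m hm i φ : Wave N d) n =
        (momentumValue L i n : ℂ) * coeff (planeWave N d) (φ : sector N d s) n :=
      fun φ n => repr_diagonalOp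
        ⟨((φ : sector N d s) : Wave N d), mem_totalMomentum_domain hm i φ.2⟩ n
    rw [h1, Submodule.coe_neg, ← neg_one_smul ℂ, coeff_smul]
    change _ * coeff (planeWave N d) (star ((ψ : sector N d s) : Wave N d)) n =
      -1 * coeff (planeWave N d) (star (sectorMomentum s N d L m hm i ψ : Wave N d)) n
    rw [coeff_star, coeff_star, h1, map_mul, Complex.conj_ofReal, momentumValue_neg]
    push_cast
    ring

end Sector

/-! ### The Hamiltonians as bounded perturbations of the kinetic energy. -/

section Potentials

variable {N d : ℕ} {s : Statistics} {L m : ℝ} {w u : (Fin d → ℝ) → ℝ} {b C : ℝ}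

local notation "⟪" x ", " y "⟫" => inner ℂ x y

/-- The interaction energy of a configuration. -/
def interactionFun (N : ℕ) {d : ℕ} (L : ℝ) (w : (Fin d → ℝ) → ℝ) (y : Config N d) : ℂ :=
  ((∑ j : Fin N, ∑ k ∈ Finset.Ioi j, w (position L j y - position L k y) : ℝ) : ℂ)

/-- The potential energy of a configuration. -/
def oneBodyFun (N : ℕ) {d : ℕ} (L : ℝ) (u : (Fin d → ℝ) → ℝ) (y : Config N d) : ℂ :=
  ((∑ j : Fin N, u (position L j y) : ℝ) : ℂ)

/-- A measurable potential bounded by `b`. -/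
structure BddPotential (u : (Fin d → ℝ) → ℝ) (b : ℝ) : Prop where
  measurable : Measurable u
  bound : ∀ x, |u x| ≤ b

theorem BddPotential.bddMeas (hu : BddPotential u b) (N : ℕ) (L : ℝ) :
    BddMeas (oneBodyFun N L u) (N * b) where
  measurable := Complex.measurable_ofReal.comp
    (Finset.measurable_sum _ fun j _ => hu.measurable.comp (measurable_position L j))
  bound y := by
    rw [oneBodyFun, Complex.norm_real]
    refine (norm_sum_le _ _).trans ((Finset.sum_le_sum fun j _ => hu.bound _).trans ?_)
    simp

theorem bddMeas_interactionFun (hw : Measurable w) (hb : ∀ x, |w x| ≤ b) (L : ℝ) :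
    BddMeas (interactionFun N L w) (∑ j : Fin N, ∑ _k ∈ Finset.Ioi j, b) where
  measurable := Complex.measurable_ofReal.comp
    (Finset.measurable_sum _ fun j _ => Finset.measurable_sum _ fun k _ =>
      hw.comp ((measurable_position L j).sub (measurable_position L k)))
  bound y := by
    rw [interactionFun, Complex.norm_real]
    refine (norm_sum_le _ _).trans (Finset.sum_le_sum fun j _ => ?_)
    exact (norm_sum_le _ _).trans (Finset.sum_le_sum fun k _ => hb _)

/-- Relabelling does not preserve the order `j < k`, so the pair sum is expressed through the full
double sum and the diagonal, both visibly invariant. -/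
theorem two_mul_sum_Ioi (g : Fin N → Fin N → ℝ) (hg : ∀ j k, g j k = g k j) :
    2 * ∑ j, ∑ k ∈ Finset.Ioi j, g j k = ∑ j, ∑ k, g j k - ∑ j, g j j := by
  have h1 : ∀ j : Fin N, ∑ k, g j k =
      ∑ k ∈ Finset.Ioi j, g j k + ∑ k ∈ Finset.Iio j, g j k + g j j := by
    intro j
    have hd : Disjoint (Finset.Ioi j) (Finset.Iio j) := by
      rw [Finset.disjoint_left]
      intro x hx hx'
      exact absurd (Finset.mem_Ioi.1 hx) (not_lt.2 (Finset.mem_Iio.1 hx').le)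
    have hu : (Finset.univ : Finset (Fin N)) = insert j (Finset.Ioi j ∪ Finset.Iio j) := by
      ext x
      simp only [Finset.mem_univ, Finset.mem_insert, Finset.mem_union, Finset.mem_Ioi,
        Finset.mem_Iio, true_iff]
      rcases lt_trichotomy x j with h | h | h <;> simp [h]
    rw [hu, Finset.sum_insert (by simp), Finset.sum_union hd, add_comm]
  have h2 : ∑ j, ∑ k ∈ Finset.Iio j, g j k = ∑ j, ∑ k ∈ Finset.Ioi j, g j k := by
    rw [Finset.sum_comm' (t' := Finset.univ) (s' := fun k => Finset.Ioi k) (by simp)]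
    exact Finset.sum_congr rfl fun j _ => Finset.sum_congr rfl fun k _ => hg k j
  simp only [h1, Finset.sum_add_distrib, h2]
  ring

theorem interactionFun_relabel (hw : ∀ x, w (-x) = w x) (σ : Equiv.Perm (Fin N))
    (y : Config N d) : interactionFun N L w (relabel σ y) = interactionFun N L w y := by
  have hp : ∀ j, position L j (relabel σ y) = position L (σ j) y := fun j => rfl
  have hg : ∀ x y, w (x - y) = w (y - x) := fun x y => by rw [← hw (y - x), neg_sub]
  rw [interactionFun, interactionFun]
  congr 1
  have h1 := two_mul_sum_Ioi (fun j k : Fin N => w (position L j y - position L k y))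
    fun j k => hg _ _
  have h2 := two_mul_sum_Ioi (fun j k : Fin N =>
    w (position L j (relabel σ y) - position L k (relabel σ y))) fun j k => hg _ _
  simp only [hp] at h2 ⊢
  have h3 : ∑ j, ∑ k, w (position L (σ j) y - position L (σ k) y) =
      ∑ j, ∑ k, w (position L j y - position L k y) := by
    rw [Equiv.sum_comp σ fun j => ∑ k, w (position L j y - position L (σ k) y)]
    exact Finset.sum_congr rfl fun j _ =>
      Equiv.sum_comp σ fun k => w (position L j y - position L k y)
  have h4 : ∑ j, w (position L (σ j) y - position L (σ j) y) =
      ∑ j, w (position L j y - position L j y) :=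
    Equiv.sum_comp σ fun j => w (position L j y - position L j y)
  rw [h3, h4] at h2
  linarith

theorem oneBodyFun_relabel (σ : Equiv.Perm (Fin N)) (y : Config N d) :
    oneBodyFun N L u (relabel σ y) = oneBodyFun N L u y := by
  rw [oneBodyFun, oneBodyFun]
  congr 1
  exact Equiv.sum_comp σ fun j => u (position L j y)

/-- Multiplication by a symmetric function in the `N`-particle Hilbert space. -/
def sectorMul (s : Statistics) {f : Config N d → ℂ} (hf : BddMeas f C)
    (hσ : ∀ (σ : Equiv.Perm (Fin N)) y, f (relabel σ y) = f y) :
    sector N d s →L[ℂ] sector N d s :=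
  restrictCLM _ (mulCLM hf) fun _ hx => mem_sector_of_comm (fun _ _ => map_smul _ _ _)
    (fun σ ψ => permute_mulCLM hf σ (hσ σ) ψ) hx

theorem norm_sectorMul_le {f : Config N d → ℂ} (hf : BddMeas f C)
    (hσ : ∀ (σ : Equiv.Perm (Fin N)) y, f (relabel σ y) = f y) : ‖sectorMul s hf hσ‖ ≤ C :=
  (norm_restrictCLM_le _ _ _).trans (norm_mulCLM_le hf)

theorem sectorMul_symm {f : Config N d → ℂ} (hf : BddMeas f C)
    (hσ : ∀ (σ : Equiv.Perm (Fin N)) y, f (relabel σ y) = f y)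
    (hr : ∀ y, (starRingEnd ℂ) (f y) = f y) : BddSymm (sectorMul s hf hσ) :=
  fun ψ φ => mulCLM_symm hf hr ψ φ

theorem sectorMul_conj {f : Config N d → ℂ} (hf : BddMeas f C)
    (hσ : ∀ (σ : Equiv.Perm (Fin N)) y, f (relabel σ y) = f y)
    (hr : ∀ y, (starRingEnd ℂ) (f y) = f y) (ψ : sector N d s) :
    sectorMul s hf hσ (sectorConj s N d ψ) = sectorConj s N d (sectorMul s hf hσ ψ) :=
  Subtype.ext (mulCLM_star hf hr ψ)

/-- The one-body potential in the `N`-particle Hilbert space. -/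
def sectorPotential (s : Statistics) (N : ℕ) (L : ℝ) (hu : BddPotential u b) :
    sector N d s →L[ℂ] sector N d s :=
  sectorMul s (hu.bddMeas N L) oneBodyFun_relabel

theorem norm_sectorPotential_le (hu : BddPotential u b) : ‖sectorPotential s N L hu‖ ≤ N * b :=
  norm_sectorMul_le _ _

theorem sectorPotential_symm (hu : BddPotential u b) : BddSymm (sectorPotential s N L hu) :=
  sectorMul_symm _ _ fun _ => Complex.conj_ofReal _

theorem sectorPotential_conj (hu : BddPotential u b) (ψ : sector N d s) :
    sectorPotential s N L hu (sectorConj s N d ψ) = sectorConj s N d (sectorPotential s N L hu ψ) :=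
  sectorMul_conj _ _ (fun _ => Complex.conj_ofReal _) ψ

/-- Stated through a bound on `κ u` rather than on `u`, so that the range of validity depends
neither on `u` nor on `κ`. -/
theorem norm_smul_sectorPotential_le (hu : BddPotential u b) {κ r : ℝ} (hr : 0 ≤ r)
    (h : ∀ x, |κ * u x| ≤ r) : ‖(κ : ℂ) • sectorPotential s N L hu‖ ≤ N * r := by
  refine (ContinuousLinearMap.opNorm_smul_le _ _).trans ?_
  rw [Complex.norm_real, Real.norm_eq_abs]
  rcases eq_or_ne κ 0 with rfl | hκ
  · rw [abs_zero, zero_mul]; positivity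
  have hκ' : 0 < |κ| := abs_pos.2 hκ
  have hu' : BddPotential u (r / |κ|) := ⟨hu.measurable, fun x => by
    rw [le_div_iff₀ hκ', mul_comm, ← abs_mul]; exact h x⟩
  have h1 : ‖sectorPotential s N L hu‖ ≤ N * (r / |κ|) :=
    norm_sectorPotential_le (s := s) (L := L) hu'
  calc |κ| * ‖sectorPotential s N L hu‖ ≤ |κ| * (N * (r / |κ|)) := by gcongr
    _ = N * r := by field_simp

/-- A pair interaction that is continuous, periodic and even. -/
structure IsInteraction (L : ℝ) (w : (Fin d → ℝ) → ℝ) : Prop where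
  continuous : Continuous w
  periodic : BoxPeriodic L w
  even : ∀ x, w (-x) = w x
  bounded : ∃ b, ∀ x, |w x| ≤ b

theorem IsInteraction.bddMeas (hw : IsInteraction L w) (N : ℕ) :
    BddMeas (interactionFun N L w) (∑ j : Fin N, ∑ _k ∈ Finset.Ioi j, hw.bounded.choose) :=
  bddMeas_interactionFun hw.continuous.measurable hw.bounded.choose_spec L

/-- The interaction in the `N`-particle Hilbert space. -/
def sectorInteraction (s : Statistics) (N : ℕ) (hw : IsInteraction L w) :
    sector N d s →L[ℂ] sector N d s :=
  sectorMul s (hw.bddMeas N) (interactionFun_relabel hw.even)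

theorem sectorInteraction_symm (hw : IsInteraction L w) : BddSymm (sectorInteraction s N hw) :=
  sectorMul_symm _ _ fun _ => Complex.conj_ofReal _

theorem sectorInteraction_conj (hw : IsInteraction L w) (ψ : sector N d s) :
    sectorInteraction s N hw (sectorConj s N d ψ) = sectorConj s N d (sectorInteraction s N hw ψ) :=
  sectorMul_conj _ _ (fun _ => Complex.conj_ofReal _) ψ

theorem mem_domain_freeHamiltonian (hw : IsInteraction L w) {ψ : Wave N d} :
    ψ ∈ (freeHamiltonian N d L m w).domain ↔ ψ ∈ (kinetic N d L m).domain :=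
  ⟨fun h => h.1, fun h => ⟨h, (hw.bddMeas N).mem_domain ψ⟩⟩

theorem mem_domain_hamiltonian (hm : 0 < m) (hw : IsInteraction L w) (hu : BddPotential u b)
    {a : Fin d} {κ v : ℝ} {ψ : Wave N d} :
    ψ ∈ (hamiltonian N d L m w a u κ v).domain ↔ ψ ∈ (kinetic N d L m).domain :=
  ⟨fun h => h.1.1.1, fun h => ⟨⟨(mem_domain_freeHamiltonian hw).2 h,
    (hu.bddMeas N L).mem_domain ψ⟩, mem_totalMomentum_domain hm a h⟩⟩

theorem coe_pert_potential (hm : 0 < m) (hw : IsInteraction L w) (hu : BddPotential u b)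
    {a : Fin d} {κ v : ℝ} (ψ : kineticDomain s N d L m)
    (h : ((ψ : sector N d s) : Wave N d) ∈ (hamiltonian N d L m w a u κ v).domain) :
    (((pert (sectorKinetic s N d L m) (sectorInteraction s N hw +
      (κ : ℂ) • sectorPotential s N L hu) - (v : ℂ) • sectorMomentum s N d L m hm a) ψ :
      sector N d s) : Wave N d) =
      hamiltonian N d L m w a u κ v ⟨((ψ : sector N d s) : Wave N d), h⟩ := by
  rw [sub_smul_apply', pert_add, Submodule.coe_sub, Submodule.coe_add]
  rfl

/-- The potentials are bounded and the momentum is defined wherever the kinetic energy is. Thus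
every `H(κ,v)` has the kinetic domain, and both infima run over the same vectors. -/
theorem wallEnergy_eq_infForm (hm : 0 < m) (hw : IsInteraction L w) (hu : BddPotential u b)
    (a : Fin d) (κ v : ℝ) : wallEnergy s N d L m w a u κ v =
      infForm (pert (sectorKinetic s N d L m) (sectorInteraction s N hw +
        (κ : ℂ) • sectorPotential s N L hu)) (sectorMomentum s N d L m hm a) v := by
  rw [wallEnergy, groundEnergy, infForm]
  congr 1
  ext e
  constructor
  · rintro ⟨⟨ψ, hψ⟩, hS, hn, rfl⟩
    have hD := (mem_domain_hamiltonian hm hw hu).1 hψ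
    let ψ' : kineticDomain s N d L m := ⟨⟨ψ, hS⟩, hD⟩
    refine ⟨ψ', hn, ?_⟩
    have h := coe_pert_potential (s := s) hm hw hu (a := a) (κ := κ) (v := v) ψ' hψ
    rw [← h]
    rfl
  · rintro ⟨ψ, hn, rfl⟩
    have hD : ((ψ : sector N d s) : Wave N d) ∈ (hamiltonian N d L m w a u κ v).domain :=
      (mem_domain_hamiltonian hm hw hu).2 ψ.2
    refine ⟨⟨((ψ : sector N d s) : Wave N d), hD⟩, (ψ : sector N d s).2, hn, ?_⟩
    exact congrArg (fun x : Wave N d => (inner ℂ ((ψ : sector N d s) : Wave N d) x).re)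
      (coe_pert_potential hm hw hu ψ hD)

/-- At `v = 0` the drift does not enter, hence the arbitrary `P`. -/
theorem groundEnergy_eq_infForm (hw : IsInteraction L w)
    (P : kineticDomain s N d L m →ₗ[ℂ] sector N d s) :
    groundEnergy s (freeHamiltonian N d L m w) =
      infForm (pert (sectorKinetic s N d L m) (sectorInteraction s N hw)) P 0 := by
  rw [groundEnergy, infForm]
  congr 1
  ext e
  rw [Complex.ofReal_zero, zero_smul, sub_zero]
  constructor
  · rintro ⟨ψ, hS, hn, rfl⟩
    exact ⟨⟨⟨ψ, hS⟩, (mem_domain_freeHamiltonian hw).1 ψ.2⟩, hn, rfl⟩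
  · rintro ⟨ψ, hn, rfl⟩
    exact ⟨⟨_, (mem_domain_freeHamiltonian hw).2 ψ.2⟩, (ψ : sector N d s).2, hn, rfl⟩

theorem EigenEq.pert_eq (hw : IsInteraction L w) {ψ : Wave N d} (hS : ψ ∈ sector N d s) {e : ℝ}
    (h : EigenEq (freeHamiltonian N d L m w) e ψ) :
    ∃ hD : (⟨ψ, hS⟩ : sector N d s) ∈ kineticDomain s N d L m,
      pert (sectorKinetic s N d L m) (sectorInteraction s N hw) ⟨⟨ψ, hS⟩, hD⟩ =
        (e : ℂ) • (⟨ψ, hS⟩ : sector N d s) := by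
  obtain ⟨h1, h2⟩ := h
  exact ⟨(mem_domain_freeHamiltonian hw).1 h1, Subtype.ext h2⟩

theorem eigenEq_of_pert_eq (hw : IsInteraction L w) {ψ : kineticDomain s N d L m} {e : ℝ}
    (h : pert (sectorKinetic s N d L m) (sectorInteraction s N hw) ψ =
      (e : ℂ) • (ψ : sector N d s)) :
    EigenEq (freeHamiltonian N d L m w) e ((ψ : sector N d s) : Wave N d) :=
  ⟨(mem_domain_freeHamiltonian hw).2 ψ.2, congrArg Subtype.val h⟩

theorem exists_gappedGround (hL : 0 < L) (hm : 0 < m) (hw : IsInteraction L w)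
    (hground : HasUniqueGroundState s (freeHamiltonian N d L m w)) :
    ∃ (Ω : kineticDomain s N d L m) (g : ℝ),
      GappedGround (pert (sectorKinetic s N d L m) (sectorInteraction s N hw)) Ω
        (groundEnergy s (freeHamiltonian N d L m w)) g := by
  obtain ⟨Ω, hS, hne, hev, huniq⟩ := hground
  have hΩ : 0 < ‖Ω‖ := norm_pos_iff.2 hne
  obtain ⟨hD, hev'⟩ := hev.pert_eq hw hS
  set e := groundEnergy s (freeHamiltonian N d L m w) with he
  set Ω' : kineticDomain s N d L m := ((‖Ω‖⁻¹ : ℝ) : ℂ) • ⟨⟨Ω, hS⟩, hD⟩ with hΩ'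
  refine ⟨Ω', (isKinetic_sectorKinetic hL hm).exists_gap (sectorInteraction_symm hw) ?_ ?_ ?_ ?_⟩
  · rw [hΩ', Submodule.coe_smul, norm_smul, Complex.norm_real, norm_inv, norm_norm]
    exact inv_mul_cancel₀ hΩ.ne'
  · rw [hΩ', map_smul, hev', Submodule.coe_smul, smul_comm]
  · intro ψ
    have hK := isKinetic_sectorKinetic (s := s) (N := N) (d := d) hL hm
    -- The zero drift supplies the semiboundedness that makes the ground energy a true lower bound.
    have hP : IsDrift (sectorKinetic s N d L m) 0 0 :=
      ⟨fun _ _ => by simp, le_rfl, fun _ => by simp⟩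
    have h1 := infForm_mul_le (hP.lower_bound hK (sectorInteraction s N hw) 0) ψ
    rw [← groundEnergy_eq_infForm hw] at h1
    simpa using h1
  · intro ψ hψ
    obtain ⟨c, hc⟩ := huniq _ (ψ : sector N d s).2 (eigenEq_of_pert_eq hw hψ)
    refine ⟨c * ‖Ω‖, Subtype.ext ?_⟩
    rw [hc, hΩ', Submodule.coe_smul, Submodule.coe_smul, Submodule.coe_smul, smul_smul]
    push_cast
    rw [mul_assoc, mul_inv_cancel₀ (by exact_mod_cast hΩ.ne'), mul_one]

end Potentials

/-! ### Total momentum and translation invariance of the interaction. -/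

section Momentum

variable {N d : ℕ} {s : Statistics} {L m : ℝ} {w : (Fin d → ℝ) → ℝ}

local notation "⟪" x ", " y "⟫" => inner ℂ x y

/-- The total momentum, in units of `2π/L`, of the plane wave with the wave vectors `(2π/L) n`. -/
def totalIndex (n : Fin N × Fin d → ℤ) : Fin d → ℤ := fun i => ∑ j, n (j, i)

theorem totalIndex_sub (n n' : Fin N × Fin d → ℤ) :
    totalIndex (n - n') = totalIndex n - totalIndex n' := by
  funext i
  simp [totalIndex, Finset.sum_sub_distrib]

theorem totalIndex_perm (σ : Equiv.Perm (Fin N)) (n : Fin N × Fin d → ℤ) :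
    totalIndex (fun q => n (σ q.1, q.2)) = totalIndex n := by
  funext i
  exact Equiv.sum_comp σ fun j => n (j, i)

theorem momentumValue_eq (L : ℝ) (i : Fin d) (n : Fin N × Fin d → ℤ) :
    momentumValue L i n = waveVector L (totalIndex n) i := by
  simp [momentumValue, waveVector, totalIndex, Finset.mul_sum]

theorem waveVector_injective (hL : 0 < L) {k l : Fin d → ℤ}
    (h : ∀ i, waveVector L k i = waveVector L l i) : k = l := by
  funext i
  have hc : 2 * Real.pi / L ≠ 0 := by positivity
  have := mul_left_cancel₀ hc (h i)
  exact_mod_cast this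

/-- The projection onto the wave functions with total momentum `(2π/L) k`. -/
def momentumProj (N : ℕ) {d : ℕ} (k : Fin d → ℤ) : Wave N d →L[ℂ] Wave N d :=
  multiplier (planeWave N d) (fun n => if totalIndex n = k then 1 else 0) 1
    fun n => by split_ifs <;> simp

theorem coeff_momentumProj (k : Fin d → ℤ) (ψ : Wave N d) (n : Fin N × Fin d → ℤ) :
    coeff (planeWave N d) (momentumProj N k ψ) n =
      if totalIndex n = k then coeff (planeWave N d) ψ n else 0 := by
  rw [momentumProj, repr_multiplier]
  split_ifs <;> simp


theorem momentumProj_symm (k : Fin d → ℤ) : BddSymm (momentumProj N k) := by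
  intro ψ φ
  have h1 := HilbertBasis.hasSum_inner_repr (planeWave N d) (momentumProj N k ψ) φ
  have h2 := HilbertBasis.hasSum_inner_repr (planeWave N d) ψ (momentumProj N k φ)
  simp only [coeff_momentumProj] at h1 h2
  refine h1.unique ?_
  convert h2 using 2 with n
  split_ifs <;> simp

theorem momentumProj_momentumProj (k l : Fin d → ℤ) (ψ : Wave N d) :
    momentumProj N k (momentumProj N l ψ) = if k = l then momentumProj N k ψ else 0 := by
  refine HilbertBasis.ext_repr (planeWave N d) fun n => ?_
  rw [coeff_momentumProj, coeff_momentumProj]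
  by_cases hkl : k = l
  · subst hkl
    rw [if_pos rfl, coeff_momentumProj]
    split_ifs <;> rfl
  · rw [if_neg hkl, ← zero_smul ℂ ψ, coeff_smul, zero_mul]
    split_ifs with h1 h2
    · exact absurd (h1.symm.trans h2) hkl
    · rfl
    · rfl

theorem eq_zero_of_momentumProj {ψ : Wave N d} (h : ∀ k, momentumProj N k ψ = 0) : ψ = 0 := by
  refine HilbertBasis.ext_repr (planeWave N d) fun n => ?_
  have h1 := coeff_momentumProj (totalIndex n) ψ n
  rw [if_pos rfl, h] at h1
  exact h1.symm

theorem momentumProj_mem_sector (k : Fin d → ℤ) {ψ : Wave N d} (h : ψ ∈ sector N d s) :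
    momentumProj N k ψ ∈ sector N d s :=
  mem_sector_of_coeff (fun σ n => by simp only [totalIndex_perm]) (repr_multiplier _ _ _ _ ψ) h

/-- A wave function of total momentum `(2π/L) k`. -/
def HasMomentum (k : Fin d → ℤ) (ψ : Wave N d) : Prop :=
  ∀ n, totalIndex n ≠ k → coeff (planeWave N d) ψ n = 0

theorem hasMomentum_of_momentumProj {k : Fin d → ℤ} {ψ : Wave N d} (h : momentumProj N k ψ = ψ) :
    HasMomentum k ψ := by
  intro n hn
  rw [← h, coeff_momentumProj, if_neg hn]

theorem HasMomentum.eigenEq {k : Fin d → ℤ} {ψ : Wave N d} (h : HasMomentum k ψ) (i : Fin d) :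
    EigenEq (totalMomentum N d L i) (waveVector L k i) ψ := by
  refine eigenEq_diagonalOp fun n hn => h n fun hk => hn ?_
  change momentumValue L i n = _
  rw [momentumValue_eq, hk]

theorem hasMomentum_of_eigenEq (hL : 0 < L) {k : Fin d → ℤ} {ψ : Wave N d}
    (h : ∀ i, EigenEq (totalMomentum N d L i) (waveVector L k i) ψ) : HasMomentum k ψ := by
  intro n hn
  by_contra hc
  refine hn (waveVector_injective hL fun i => ?_)
  rw [← momentumValue_eq]
  by_contra hi
  exact hc ((h i).repr_eq_zero hi)

/-- Wave functions of different total momentum are orthogonal. -/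
theorem HasMomentum.inner_eq_zero {k l : Fin d → ℤ} {ψ φ : Wave N d} (hψ : HasMomentum k ψ)
    (hφ : HasMomentum l φ) (hkl : k ≠ l) : ⟪ψ, φ⟫ = 0 := by
  have h1 := HilbertBasis.hasSum_inner_repr (planeWave N d) ψ φ
  refine h1.unique ?_
  convert hasSum_zero with n
  by_cases hn : totalIndex n = k
  · rw [hφ n (fun h => hkl (hn.symm.trans h)), mul_zero]
  · rw [hψ n hn, map_zero, zero_mul]

/-- Multiplication by a plane wave shifts the total momentum. -/
theorem HasMomentum.mulCLM_mFourier {k : Fin d → ℤ} {ψ : Wave N d} (h : HasMomentum k ψ) {C : ℝ}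
    (q : Fin N × Fin d → ℤ) (hq : BddMeas (N := N) (d := d) (UnitAddTorus.mFourier q) C) :
    HasMomentum (k + totalIndex q) (mulCLM hq ψ) := by
  intro n hn
  rw [coeff_mulCLM_mFourier]
  refine h _ fun h1 => hn ?_
  rw [← h1, totalIndex_sub, sub_add_cancel]

theorem momentumProj_mulCLM_mFourier (k : Fin d → ℤ) {C : ℝ} {q : Fin N × Fin d → ℤ}
    (hq : BddMeas (N := N) (d := d) (UnitAddTorus.mFourier q) C) (h0 : totalIndex q = 0)
    (ψ : Wave N d) :
    momentumProj N k (mulCLM hq ψ) = mulCLM hq (momentumProj N k ψ) := by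
  refine HilbertBasis.ext_repr (planeWave N d) fun n => ?_
  rw [coeff_momentumProj, coeff_mulCLM_mFourier, coeff_mulCLM_mFourier, coeff_momentumProj,
    totalIndex_sub, h0, sub_zero]

/-- The wave vectors of a plane wave of momentum `q` of particle `j`. -/
def particleIndex (j : Fin N) (q : Fin d → ℤ) : Fin N × Fin d → ℤ :=
  fun p => if p.1 = j then q p.2 else 0

theorem totalIndex_particleIndex (j : Fin N) (q : Fin d → ℤ) :
    totalIndex (particleIndex j q) = q := by
  funext i
  simp [totalIndex, particleIndex]

theorem mFourier_particleIndex (j : Fin N) (q : Fin d → ℤ) (y : Config N d) :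
    UnitAddTorus.mFourier (particleIndex j q) y = UnitAddTorus.mFourier q fun i => y (j, i) := by
  change ∏ p, fourier (particleIndex j q p) (y p) = ∏ i, fourier (q i) (y (j, i))
  rw [Fintype.prod_prod_type, Finset.prod_eq_single j]
  · simp [particleIndex]
  · intro j' _ hj
    simp [particleIndex, hj]
  · simp

theorem mFourier_apply_sub (q : Fin d → ℤ) (x x' : UnitAddTorus (Fin d)) :
    UnitAddTorus.mFourier q (x - x') = UnitAddTorus.mFourier q x * UnitAddTorus.mFourier (-q) x' := by
  change ∏ i, fourier (q i) (x i - x' i) = (∏ i, fourier (q i) (x i)) * ∏ i, fourier (-q i) (x' i)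
  rw [← Finset.prod_mul_distrib]
  refine Finset.prod_congr rfl fun i _ => ?_
  rw [fourier_apply, fourier_apply, fourier_apply, smul_sub, sub_eq_add_neg, ← neg_smul,
    AddCircle.toCircle_add, Circle.coe_mul]

/-- A continuous function on the torus, composed with a measurable map. -/
theorem bddMeas_comp (f : C(UnitAddTorus (Fin d), ℂ)) {g : Config N d → UnitAddTorus (Fin d)}
    (hg : Measurable g) : BddMeas (fun y => f (g y)) ‖f‖ where
  measurable := f.continuous.measurable.comp hg
  bound _ := f.norm_coe_le_norm _

theorem mulCLM_congr {f f' : Config N d → ℂ} {C C' : ℝ} (hf : BddMeas f C) (hf' : BddMeas f' C')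
    (h : ∀ y, f y = f' y) : mulCLM hf = mulCLM hf' := by
  obtain rfl : f = f' := funext h
  rfl

/-- The multiplication operators by the functions `y ↦ f (g y)`, linear and continuous in `f`. -/
def compMul {g : Config N d → UnitAddTorus (Fin d)} (hg : Measurable g) :
    C(UnitAddTorus (Fin d), ℂ) →L[ℂ] (Wave N d →L[ℂ] Wave N d) :=
  LinearMap.mkContinuous
    { toFun := fun f => mulCLM (bddMeas_comp f hg)
      map_add' := fun f f' => by
        ext1 ψ
        rw [add_apply]
        apply Lp.ext
        filter_upwards [mulCLM_ae (bddMeas_comp f hg) ψ, mulCLM_ae (bddMeas_comp f' hg) ψ,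
          mulCLM_ae (bddMeas_comp (f + f') hg) ψ,
          Lp.coeFn_add (mulCLM (bddMeas_comp f hg) ψ) (mulCLM (bddMeas_comp f' hg) ψ)]
          with y h1 h2 h3 h4
        rw [h3, h4, Pi.add_apply, h1, h2, ContinuousMap.add_apply, add_mul]
      map_smul' := fun c f => by
        ext1 ψ
        rw [RingHom.id_apply, smul_apply]
        apply Lp.ext
        filter_upwards [mulCLM_ae (bddMeas_comp f hg) ψ, mulCLM_ae (bddMeas_comp (c • f) hg) ψ,
          Lp.coeFn_smul c (mulCLM (bddMeas_comp f hg) ψ)] with y h1 h2 h3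
        rw [h2, h3, Pi.smul_apply, h1, ContinuousMap.smul_apply, smul_eq_mul, smul_eq_mul,
          mul_assoc] } 1
    fun f => by
      rw [one_mul]
      exact norm_mulCLM_le (bddMeas_comp f hg)

theorem compMul_apply {g : Config N d → UnitAddTorus (Fin d)} (hg : Measurable g)
    (f : C(UnitAddTorus (Fin d), ℂ)) : compMul hg f = mulCLM (bddMeas_comp f hg) := rfl

/-- The relative coordinate of two particles. -/
def relCoord (j k : Fin N) (y : Config N d) : UnitAddTorus (Fin d) := fun i => y (j, i) - y (k, i)

theorem measurable_relCoord (j k : Fin N) : Measurable (relCoord (d := d) j k) := by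
  refine Continuous.measurable ?_
  unfold relCoord
  fun_prop

/-- Both sides are linear and continuous in `f`, so trigonometric monomials suffice, their span
being dense. For these the factor `exp (iq·(x_j - x_k))` adds `q` to one particle and removes it
from the other. -/
theorem momentumProj_compMul_relCoord (l : Fin d → ℤ) (j k : Fin N)
    (f : C(UnitAddTorus (Fin d), ℂ)) (ψ : Wave N d) :
    momentumProj N l (compMul (measurable_relCoord j k) f ψ) =
      compMul (measurable_relCoord j k) f (momentumProj N l ψ) := by
  set A := compMul (N := N) (d := d) (measurable_relCoord j k)
  let E1 : C(UnitAddTorus (Fin d), ℂ) →L[ℂ] Wave N d :=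
    (momentumProj N l) ∘L ((ContinuousLinearMap.apply ℂ (Wave N d) ψ) ∘L A)
  let E2 : C(UnitAddTorus (Fin d), ℂ) →L[ℂ] Wave N d :=
    (ContinuousLinearMap.apply ℂ (Wave N d) (momentumProj N l ψ)) ∘L A
  have hE : E1 = E2 := by
    refine ContinuousLinearMap.ext_on (s := Set.range (UnitAddTorus.mFourier (d := Fin d))) ?_ ?_
    · have h := UnitAddTorus.span_mFourier_closure_eq_top (d := Fin d)
      exact Submodule.dense_iff_topologicalClosure_eq_top.2 h
    · rintro _ ⟨q, rfl⟩
      have hy : ∀ y : Config N d, UnitAddTorus.mFourier q (relCoord j k y) =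
          UnitAddTorus.mFourier (particleIndex j q + particleIndex k (-q)) y := by
        intro y
        rw [UnitAddTorus.mFourier_add, mFourier_particleIndex, mFourier_particleIndex,
          ← mFourier_apply_sub]
        rfl
      change momentumProj N l (mulCLM (bddMeas_comp (UnitAddTorus.mFourier q)
        (measurable_relCoord j k)) ψ) = mulCLM (bddMeas_comp (UnitAddTorus.mFourier q)
        (measurable_relCoord j k)) (momentumProj N l ψ)
      rw [mulCLM_congr _ (bddMeas_mFourier _) hy, momentumProj_mulCLM_mFourier]
      funext i
      simp [totalIndex, particleIndex, Finset.sum_add_distrib]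
  exact DFunLike.congr_fun hE f

/-- A continuous periodic function as a function on the torus. -/
def torusFun {f : (Fin d → ℝ) → ℝ} (hc : Continuous f) (hf : BoxPeriodic L f) :
    C(UnitAddTorus (Fin d), ℂ) :=
  ⟨fun y => (f (boxPoint L y) : ℂ),
    Complex.continuous_ofReal.comp (continuous_comp_boxPoint hc hf)⟩

/-- The difference of two box representatives may leave the box; periodicity of `w` makes this
harmless. -/
theorem torusFun_relCoord (hw : IsInteraction L w) (j k : Fin N) (y : Config N d) :
    torusFun hw.continuous hw.periodic (relCoord j k y) =
      (w (position L j y - position L k y) : ℂ) := by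
  have h := hw.periodic.boxPoint_mk fun i =>
    (AddCircle.equivIco (1 : ℝ) 0 (y (j, i)) : ℝ) - (AddCircle.equivIco (1 : ℝ) 0 (y (k, i)) : ℝ)
  simp only [AddCircle.coe_sub, AddCircle.coe_equivIco] at h
  change (w (boxPoint L _) : ℂ) = _
  rw [Complex.ofReal_inj]
  refine Eq.trans h ?_
  congr 1
  funext i
  simp only [position, Pi.sub_apply]
  ring

theorem momentumProj_interaction (hw : IsInteraction L w) (l : Fin d → ℤ) (ψ : Wave N d) :
    momentumProj N l (mulCLM (hw.bddMeas N) ψ) =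
      mulCLM (hw.bddMeas N) (momentumProj N l ψ) := by
  have h : ∀ y, interactionFun N L w y = ∑ p ∈ (Finset.univ : Finset (Fin N)).sigma
      fun j => Finset.Ioi j, (1 : ℂ) * torusFun hw.continuous hw.periodic (relCoord p.1 p.2 y) := by
    intro y
    rw [interactionFun, Finset.sum_sigma]
    push_cast
    refine Finset.sum_congr rfl fun j _ => Finset.sum_congr rfl fun k _ => ?_
    rw [one_mul, torusFun_relCoord hw]
  have h1 := mulCLM_sum _ _ _ (fun p : Σ _ : Fin N, Fin N =>
    bddMeas_comp (torusFun hw.continuous hw.periodic) (measurable_relCoord p.1 p.2))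
    (hw.bddMeas N) h
  rw [h1, h1, map_sum]
  refine Finset.sum_congr rfl fun p _ => ?_
  rw [map_smul, ← compMul_apply, momentumProj_compMul_relCoord]

end Momentum

/-! ### Joint eigenbases for an operator with compact resolvent and commuting projections. -/

section JointSpectrum

variable {E : Type*} [NormedAddCommGroup E] [InnerProductSpace ℂ E]

local notation "⟪" x ", " y "⟫" => inner ℂ x y

theorem bddSymm_eigenvalue_conj {T : E →L[ℂ] E} (hT : BddSymm T) {x : E} (hx : x ≠ 0) {μ : ℂ}
    (h : T x = μ • x) : (starRingEnd ℂ) μ = μ := by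
  have h1 := hT x x
  rw [h, inner_smul_left, inner_smul_right] at h1
  exact mul_right_cancel₀ (inner_self_ne_zero.2 hx) h1

theorem bddSymm_inner_eq_zero {T : E →L[ℂ] E} (hT : BddSymm T) {x y : E} {μ ν : ℂ}
    (hx : T x = μ • x) (hy : T y = ν • y) (h : μ ≠ ν) : ⟪x, y⟫ = 0 := by
  rcases eq_or_ne x 0 with rfl | hx0
  · exact inner_zero_left _
  have h1 := hT x y
  rw [hx, hy, inner_smul_left, inner_smul_right, bddSymm_eigenvalue_conj hT hx0 hx] at h1
  by_contra hc
  exact h (mul_right_cancel₀ hc h1)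

/-- A compact symmetric operator and a complete family of commuting orthogonal projections have
a complete orthonormal system of joint eigenvectors. -/
theorem exists_joint_eigenbasis {E : Type} [NormedAddCommGroup E] [InnerProductSpace ℂ E]
    [CompleteSpace E] {κ : Type} {T : E →L[ℂ] E} (hc : IsCompactOperator T) (hT : BddSymm T)
    {Q : κ → E →L[ℂ] E} (hQ : ∀ k, BddSymm (Q k)) (hcomm : ∀ k x, Q k (T x) = T (Q k x))
    (hidem : ∀ k x, Q k (Q k x) = Q k x) (horth : ∀ k l x, k ≠ l → Q k (Q l x) = 0)
    (htot : ∀ x, (∀ k, Q k x = 0) → x = 0) :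
    ∃ (ι : Type) (b : ι → E) (μ : ι → ℂ) (k : ι → κ), Orthonormal ℂ b ∧
      (∀ i, T (b i) = μ i • b i) ∧ (∀ i, Q (k i) (b i) = b i) ∧
      (Submodule.span ℂ (Set.range b)).topologicalClosure = ⊤ := by
  -- The joint eigenspaces are closed and mutually orthogonal; the system is the union of Hilbert
  -- bases of them.
  let V : ℂ × κ → Submodule ℂ E := fun a =>
    LinearMap.ker ((T - a.1 • ContinuousLinearMap.id ℂ E : E →L[ℂ] E) : E →ₗ[ℂ] E) ⊓
      LinearMap.ker ((Q a.2 - ContinuousLinearMap.id ℂ E : E →L[ℂ] E) : E →ₗ[ℂ] E)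
  have hV : ∀ a x, x ∈ V a ↔ T x = a.1 • x ∧ Q a.2 x = x := by
    intro a x
    simp only [V, Submodule.mem_inf, LinearMap.mem_ker]
    exact and_congr sub_eq_zero sub_eq_zero
  have hVc : ∀ a, IsClosed (V a : Set E) := fun a =>
    (ContinuousLinearMap.isClosed_ker _).inter (ContinuousLinearMap.isClosed_ker _)
  have : ∀ a, CompleteSpace (V a) := fun a => (hVc a).completeSpace_coe
  have hfam : OrthogonalFamily ℂ (fun a => V a) fun a => (V a).subtypeₗᵢ := by
    intro a a' hne x y
    obtain ⟨hx1, hx2⟩ := (hV a x).1 x.2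
    obtain ⟨hy1, hy2⟩ := (hV a' y).1 y.2
    change ⟪(x : E), (y : E)⟫ = 0
    by_cases h1 : a.1 = a'.1
    · have h2 : a.2 ≠ a'.2 := fun h2 => hne (Prod.ext h1 h2)
      rw [← hx2, hQ, ← hy2, horth _ _ _ h2, inner_zero_right]
    · exact bddSymm_inner_eq_zero hT hx1 hy1 h1
  choose S b hb using fun a => exists_hilbertBasis ℂ (V a)
  refine ⟨Σ a, S a, fun i => (b i.1 i.2 : E), fun i => i.1.1, fun i => i.1.2, ?_, ?_, ?_, ?_⟩
  · exact hfam.orthonormal_sigma_orthonormal fun a => (b a).orthonormal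
  · exact fun i => ((hV _ _).1 (b i.1 i.2).2).1
  · exact fun i => ((hV _ _).1 (b i.1 i.2).2).2
  · rw [Submodule.topologicalClosure_eq_top_iff, Submodule.eq_bot_iff]
    intro x hx
    rw [Submodule.mem_orthogonal'] at hx
    have hxV : ∀ a, ∀ v ∈ V a, ⟪x, v⟫ = 0 := by
      intro a v hv
      have : (innerSL ℂ x) ∘L (V a).subtypeL = 0 := by
        refine ContinuousLinearMap.ext_on (s := Set.range (b a)) ?_ ?_
        · exact Submodule.dense_iff_topologicalClosure_eq_top.2 (b a).dense_span
        · rintro _ ⟨i, rfl⟩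
          exact hx _ (Submodule.subset_span ⟨⟨a, i⟩, rfl⟩)
      exact DFunLike.congr_fun this ⟨v, hv⟩
    -- For completeness, let `x` be orthogonal to all joint eigenspaces. By the spectral theorem for
    -- `T` it suffices that `Q k x` is orthogonal to every eigenvector `v`, and moving `Q k` onto
    -- `v` lands in a joint eigenspace.
    refine htot x fun k => ?_
    have hbot := ContinuousLinearMap.orthogonalComplement_iSup_eigenspaces_eq_bot hc hT
    rw [Submodule.eq_bot_iff] at hbot
    refine hbot _ ?_
    rw [← Submodule.iInf_orthogonal, Submodule.mem_iInf]
    intro μ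
    rw [Submodule.mem_orthogonal']
    intro v hv
    rw [hQ]
    refine hxV (μ, k) _ ((hV _ _).2 ⟨?_, hidem k v⟩)
    have hv' : T v = μ • v := Module.End.mem_eigenspace_iff.1 hv
    change T (Q k v) = μ • Q k v
    rw [← hcomm, hv', map_smul]

/-- Diagonalise `T = (A + c)⁻¹`, which commutes with the projections because `A` does. An eigenvalue
`μ` of `T` is real and nonzero and gives the energy `1/μ - c`. -/
theorem HasCompactResolvent.exists_joint_eigenbasis {E : Type} [NormedAddCommGroup E]
    [InnerProductSpace ℂ E] [CompleteSpace E] {κ : Type} {D : Submodule ℂ E} {A : D →ₗ[ℂ] E}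
    (hA : HasCompactResolvent A) {Q : κ → E →L[ℂ] E} (hQ : ∀ k, BddSymm (Q k))
    (hQA : ∀ k (ψ : D), ∃ h : Q k ψ ∈ D, A ⟨Q k ψ, h⟩ = Q k (A ψ))
    (hidem : ∀ k x, Q k (Q k x) = Q k x) (horth : ∀ k l x, k ≠ l → Q k (Q l x) = 0)
    (htot : ∀ x, (∀ k, Q k x = 0) → x = 0) :
    ∃ (ι : Type) (b : ι → E) (e : ι → ℝ) (k : ι → κ), Orthonormal ℂ b ∧
      (∀ i, ∃ h : b i ∈ D, A ⟨b i, h⟩ = (e i : ℂ) • b i) ∧ (∀ i, Q (k i) (b i) = b i) ∧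
      (Submodule.span ℂ (Set.range b)).topologicalClosure = ⊤ := by
  obtain ⟨c, hc0, T, hTc, hTs, hTp, hTf, hTA⟩ := hA.exists_inverse
  have hcomm : ∀ k x, Q k (T x) = T (Q k x) := by
    intro k f
    obtain ⟨h, hf⟩ := hTf f
    obtain ⟨h', hp⟩ := hQA k ⟨T f, h⟩
    have h2 := hTA ⟨Q k (T f), h'⟩
    rw [hp] at h2
    change T (_ + (c : ℂ) • Q k (T f)) = Q k (T f) at h2
    rw [← map_smul, ← map_add, hf] at h2
    exact h2.symm
  obtain ⟨ι, b, μ, k, hon, hTb, hkb, hdense⟩ :=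
    Superfluid.exists_joint_eigenbasis hTc hTs hQ hcomm hidem horth htot
  have hb0 : ∀ i, b i ≠ 0 := hon.ne_zero
  have hμ0 : ∀ i, μ i ≠ 0 := by
    intro i h0
    obtain ⟨h, hf⟩ := hTf (b i)
    have hz : T (b i) = 0 := by rw [hTb, h0, zero_smul]
    have hz' : (⟨T (b i), h⟩ : D) = 0 := Subtype.ext hz
    rw [hz', hz, map_zero, smul_zero, add_zero] at hf
    exact hb0 i hf.symm
  have hμr : ∀ i, (((μ i)⁻¹ - c).re : ℂ) = (μ i)⁻¹ - c := by
    intro i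
    rw [← Complex.conj_eq_iff_re]
    rw [map_sub, map_inv₀, bddSymm_eigenvalue_conj hTs (hb0 i) (hTb i), Complex.conj_ofReal]
  refine ⟨ι, b, fun i => ((μ i)⁻¹ - c).re, k, hon, fun i => ?_, hkb, hdense⟩
  obtain ⟨h, hf⟩ := hTf (b i)
  have hD : b i ∈ D := by
    rw [hTb] at h
    have := Submodule.smul_mem _ (μ i)⁻¹ h
    rwa [smul_smul, inv_mul_cancel₀ (hμ0 i), one_smul] at this
  refine ⟨hD, ?_⟩
  have h3 : (⟨T (b i), h⟩ : D) = μ i • ⟨b i, hD⟩ := Subtype.ext (hTb i)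
  rw [h3, hTb, map_smul] at hf
  rw [hμr, sub_smul]
  have h4 := congrArg (fun x => (μ i)⁻¹ • x) hf
  simp only [smul_add, smul_smul] at h4
  rw [inv_mul_cancel₀ (hμ0 i), one_smul, mul_left_comm, inv_mul_cancel₀ (hμ0 i), mul_one] at h4
  exact eq_sub_of_add_eq h4

theorem SymmOn.eigenvalue_eq {D : Submodule ℂ E} {A : D →ₗ[ℂ] E} (hA : SymmOn A) {ψ φ : D}
    {e f : ℝ} (hψ : A ψ = (e : ℂ) • (ψ : E)) (hφ : A φ = (f : ℂ) • (φ : E))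
    (h : ⟪(ψ : E), (φ : E)⟫ ≠ 0) : e = f := by
  have h2 := hA ψ φ
  rw [hψ, hφ, inner_smul_left, inner_smul_right, Complex.conj_ofReal] at h2
  exact_mod_cast mul_right_cancel₀ h h2

theorem exists_inner_ne_zero {ι : Type*} {b : ι → E}
    (hdense : (Submodule.span ℂ (Set.range b)).topologicalClosure = ⊤) {x : E} (hx : x ≠ 0) :
    ∃ i, ⟪b i, x⟫ ≠ 0 := by
  by_contra! hcon
  have h1 : innerSL ℂ x = 0 := by
    refine ContinuousLinearMap.ext_on (s := Set.range b)
      (Submodule.dense_iff_topologicalClosure_eq_top.2 hdense) ?_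
    rintro _ ⟨i, rfl⟩
    rw [innerSL_apply_apply, ← inner_conj_symm, hcon, map_zero]
    rfl
  have h2 := DFunLike.congr_fun h1 x
  rw [innerSL_apply_apply, zero_apply, inner_self_eq_zero] at h2
  exact hx h2

theorem GappedGround.energy_le {D : Submodule ℂ E} {A : D →ₗ[ℂ] E} (hA : SymmOn A) {Ω : D}
    {e g f : ℝ} (hΩ : GappedGround A Ω e g) {ψ : D} (hn : ‖(ψ : E)‖ = 1)
    (hψ : A ψ = (f : ℂ) • (ψ : E)) : e ≤ f := by
  have h2 := hΩ.le_form hA ψ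
  rwa [form, hψ, re_inner_ofReal_smul_self, hn, one_pow, mul_one, mul_one] at h2

theorem GappedGround.gap_le {D : Submodule ℂ E} {A : D →ₗ[ℂ] E} {Ω : D}
    {e g f : ℝ} (hΩ : GappedGround A Ω e g) {ψ : D} (hn : ‖(ψ : E)‖ = 1)
    (hψ : A ψ = (f : ℂ) • (ψ : E)) (h0 : ⟪(Ω : E), (ψ : E)⟫ = 0) : e + g ≤ f := by
  have h2 := hΩ.gap ψ h0
  rwa [form, hψ, re_inner_ofReal_smul_self, hn, one_pow, mul_one, mul_one] at h2

theorem GappedGround.ne_zero {D : Submodule ℂ E} {A : D →ₗ[ℂ] E} {Ω : D} {e g : ℝ}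
    (hΩ : GappedGround A Ω e g) : (Ω : E) ≠ 0 := by
  intro h
  have := hΩ.norm_eq
  rw [h, norm_zero] at this
  exact zero_ne_one this

end JointSpectrum

/-! ### Existence of a system of joint eigenvectors for `H₀` and the momentum. -/

section Existence

variable {N d : ℕ} {s : Statistics} {L m : ℝ} {w : (Fin d → ℝ) → ℝ}

local notation "⟪" x ", " y "⟫" => inner ℂ x y

/-- The projection onto total momentum `(2π/L) k` in the `N`-particle Hilbert space. -/
def sectorProj (s : Statistics) (N : ℕ) {d : ℕ} (k : Fin d → ℤ) :
    sector N d s →L[ℂ] sector N d s :=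
  restrictCLM _ (momentumProj N k) fun _ hx => momentumProj_mem_sector k hx

theorem sectorProj_pert (hw : IsInteraction L w) (k : Fin d → ℤ) (ψ : kineticDomain s N d L m) :
    ∃ h : sectorProj s N k ψ ∈ kineticDomain s N d L m,
      pert (sectorKinetic s N d L m) (sectorInteraction s N hw) ⟨sectorProj s N k ψ, h⟩ =
        sectorProj s N k (pert (sectorKinetic s N d L m) (sectorInteraction s N hw) ψ) := by
  have h1 := mem_domain_diagonalOp.1 ψ.2
  have hD : sectorProj s N k ψ ∈ kineticDomain s N d L m := by
    refine mem_domain_diagonalOp.2 (Summable.of_nonneg_of_le (fun _ => sq_nonneg _)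
      (fun n => ?_) h1)
    change ‖_ * coeff (planeWave N d) (momentumProj N k _) n‖ ^ 2 ≤ _
    rw [coeff_momentumProj, norm_mul, norm_mul]
    gcongr
    split_ifs
    · exact le_rfl
    · rw [norm_zero]; exact norm_nonneg _
  refine ⟨hD, ?_⟩
  rw [pert_apply, pert_apply, map_add]
  congr 1
  · refine Subtype.ext (HilbertBasis.ext_repr (planeWave N d) fun n => ?_)
    have h2 : ∀ (φ : kineticDomain s N d L m) n, coeff (planeWave N d)
        (sectorKinetic s N d L m φ : Wave N d) n =
        (kineticValue L m n : ℂ) * coeff (planeWave N d) (φ : sector N d s) n :=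
      fun φ n => repr_diagonalOp ⟨((φ : sector N d s) : Wave N d), φ.2⟩ n
    rw [h2]
    change _ * coeff (planeWave N d) (momentumProj N k ((ψ : sector N d s) : Wave N d)) n =
      coeff (planeWave N d) (momentumProj N k (sectorKinetic s N d L m ψ : Wave N d)) n
    rw [coeff_momentumProj, coeff_momentumProj, h2]
    split_ifs
    · rfl
    · rw [mul_zero]
  · exact Subtype.ext (momentumProj_interaction hw k ((ψ : sector N d s) : Wave N d)).symm

theorem coe_sectorProj (k : Fin d → ℤ) (x : sector N d s) :
    (sectorProj s N k x : Wave N d) = momentumProj N k x := rfl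

theorem sectorProj_symm (k : Fin d → ℤ) : BddSymm (sectorProj s N k) :=
  fun x y => momentumProj_symm k (x : Wave N d) (y : Wave N d)

theorem sectorProj_sectorProj_self (k : Fin d → ℤ) (x : sector N d s) :
    sectorProj s N k (sectorProj s N k x) = sectorProj s N k x := by
  refine Subtype.ext ?_
  rw [coe_sectorProj, coe_sectorProj, momentumProj_momentumProj, if_pos rfl]

theorem sectorProj_sectorProj_of_ne (k l : Fin d → ℤ) (x : sector N d s) (h : k ≠ l) :
    sectorProj s N k (sectorProj s N l x) = 0 := by
  refine Subtype.ext ?_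
  rw [coe_sectorProj, coe_sectorProj, momentumProj_momentumProj, if_neg h, Submodule.coe_zero]

theorem eq_zero_of_sectorProj (x : sector N d s) (h : ∀ k, sectorProj s N k x = 0) : x = 0 := by
  refine Subtype.ext (eq_zero_of_momentumProj fun k => ?_)
  rw [← coe_sectorProj, h, Submodule.coe_zero]

theorem sector_le_closure_span {ι : Type*} {b : ι → sector N d s}
    (h : (Submodule.span ℂ (Set.range b)).topologicalClosure = ⊤) :
    sector N d s ≤
      (Submodule.span ℂ (Set.range fun i => (b i : Wave N d))).topologicalClosure := by
  intro x hx
  have h1 : (⟨x, hx⟩ : sector N d s) ∈ closure (Submodule.span ℂ (Set.range b) :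
      Set (sector N d s)) := by
    rw [← Submodule.topologicalClosure_coe, h]
    trivial
  refine map_mem_closure (f := Subtype.val) continuous_subtype_val h1 ?_
  intro y hy
  have h2 := Submodule.mem_map_of_mem (f := (sector N d s).subtype) hy
  rw [Submodule.map_span] at h2
  convert h2 using 2
  rw [← Set.range_comp]
  rfl

theorem eigenEq_of_exists_pert_eq (hw : IsInteraction L w) {x : sector N d s} {e : ℝ}
    (h : ∃ h : x ∈ kineticDomain s N d L m,
      pert (sectorKinetic s N d L m) (sectorInteraction s N hw) ⟨x, h⟩ = (e : ℂ) • x) :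
    EigenEq (freeHamiltonian N d L m w) e (x : Wave N d) := by
  obtain ⟨h, h1⟩ := h
  exact eigenEq_of_pert_eq (ψ := ⟨x, h⟩) hw h1

theorem exists_jointEigenbasis (hL : 0 < L) (hm : 0 < m) (hw : IsInteraction L w)
    (hground : HasUniqueGroundState s (freeHamiltonian N d L m w)) :
    Nonempty (JointEigenbasis s N d L m w) := by
  obtain ⟨Ω, g, hΩ⟩ := exists_gappedGround hL hm hw hground
  have hK := isKinetic_sectorKinetic (s := s) (N := N) (d := d) hL hm
  have hW := sectorInteraction_symm (s := s) (N := N) hw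
  have hA := hK.symm.pert hW
  obtain ⟨ι, b, e, k, hon, hbA, hkb, hdense⟩ :=
    (hK.hasCompactResolvent_pert hW).exists_joint_eigenbasis (Q := fun k => sectorProj s N k)
    sectorProj_symm (sectorProj_pert hw) sectorProj_sectorProj_self sectorProj_sectorProj_of_ne
    eq_zero_of_sectorProj
  -- By completeness some member overlaps with the ground state; eigenvectors of different energies
  -- being orthogonal, that member has the ground energy.
  obtain ⟨i₀, hi₀⟩ := exists_inner_ne_zero hdense hΩ.ne_zero
  have he : e i₀ = groundEnergy s (freeHamiltonian N d L m w) := by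
    obtain ⟨h, h1⟩ := hbA i₀
    exact hA.eigenvalue_eq h1 hΩ.eigen hi₀
  have hle : ∀ i, e i₀ ≤ e i := fun i => by
    obtain ⟨h, h1⟩ := hbA i
    exact he.trans_le (hΩ.energy_le hA (ψ := ⟨b i, h⟩) (hon.1 i) h1)
  have hen : ∀ i, EigenEq (freeHamiltonian N d L m w) (e i) (b i : Wave N d) := fun i => 
    eigenEq_of_exists_pert_eq hw (hbA i)
  have hmom : ∀ i, HasMomentum (k i) (b i : Wave N d) := fun i =>
    hasMomentum_of_momentumProj (by rw [← coe_sectorProj, hkb])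
  have hon' : Orthonormal ℂ fun i => (b i : Wave N d) :=
    hon.comp_linearIsometry (sector N d s).subtypeₗᵢ
  exact ⟨⟨ι, fun i => (b i : Wave N d), e, k, i₀, fun i => (b i).2, hon',
    sector_le_closure_span hdense, hen, fun i => (hmom i).eigenEq, hle⟩⟩

end Existence

/-! ### The second order response in an eigenbasis. -/

section Response

variable {H : Type*} [NormedAddCommGroup H] [InnerProductSpace ℂ H] {D : Submodule ℂ H}
  {ι : Type*}

local notation "⟪" x ", " y "⟫" => inner ℂ x y

theorem SymmOn.inner_eigen {A : D →ₗ[ℂ] H} (hA : SymmOn A) {φ : D} {e : ℝ}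
    (h : A φ = (e : ℂ) • (φ : H)) (ψ : D) : ⟪(φ : H), A ψ⟫ = e * ⟪(φ : H), (ψ : H)⟫ := by
  rw [← hA, h, inner_smul_left, Complex.conj_ofReal]

/-- The second order response in an orthonormal system of joint eigenvectors. -/
theorem hasSum_response {A P : D →ₗ[ℂ] H} (hA : SymmOn A) (hP : SymmOn P)
    (b : HilbertBasis ι ℂ H) {e k : ι → ℝ} {i₀ : ι}
    (hbA : ∀ i, ∃ h : b i ∈ D, A ⟨b i, h⟩ = (e i : ℂ) • b i)
    (hbP : ∀ i, ∃ h : b i ∈ D, P ⟨b i, h⟩ = (k i : ℂ) • b i)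
    (hgap : ∀ i, i ≠ i₀ → e i₀ < e i) (hk : k i₀ = 0) {f : H} {χ ζ : D}
    (hχ : A χ - (e i₀ : ℂ) • (χ : H) = f - ⟪b i₀, f⟫ • b i₀)
    (hζ : A ζ - (e i₀ : ℂ) • (ζ : H) = P χ) :
    HasSum (fun i => k i ^ 2 * ‖⟪b i, f⟫‖ ^ 2 / (e i - e i₀) ^ 3) (⟪(ζ : H), P χ⟫).re := by
  refine (Complex.hasSum_re (HilbertBasis.hasSum_inner_repr b (ζ : H) (P χ))).congr_fun fun i => ?_
  obtain ⟨hD, hAi⟩ := hbA i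
  obtain ⟨_, hPi⟩ := hbP i
  have e1 : coeff b (P χ) i = k i * ⟪b i, (χ : H)⟫ := by
    rw [coeff_eq_inner]
    exact hP.inner_eigen (φ := ⟨b i, hD⟩) hPi χ
  rw [e1, coeff_eq_inner]
  -- The ground state term vanishes because its momentum does; the zero denominator is harmless.
  rcases eq_or_ne i i₀ with rfl | hi
  · rw [hk]; simp
  have hpos : 0 < e i - e i₀ := sub_pos.2 (hgap i hi)
  have hne : ((e i - e i₀ : ℝ) : ℂ) ≠ 0 := by exact_mod_cast hpos.ne'
  have h2 := congrArg (fun x => ⟪b i, x⟫) hχ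
  have h3 := congrArg (fun x => ⟪b i, x⟫) hζ
  have h4 := hA.inner_eigen (φ := ⟨b i, hD⟩) hAi χ
  have h5 := hA.inner_eigen (φ := ⟨b i, hD⟩) hAi ζ
  simp only [inner_sub_right, inner_smul_right] at h2 h3
  rw [h4, b.orthonormal.2 hi, mul_zero, sub_zero, ← sub_mul] at h2
  rw [h5, ← coeff_eq_inner b (P χ), e1, ← sub_mul] at h3
  -- One division by the excitation energy for `χ` and two for `ζ` make the cube.
  have h6 : ⟪b i, (χ : H)⟫ = ⟪b i, f⟫ / ((e i - e i₀ : ℝ) : ℂ) := by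
    rw [eq_div_iff hne, mul_comm, ← h2]; push_cast; rfl
  have h7 : ⟪b i, (ζ : H)⟫ = k i * (⟪b i, f⟫ / ((e i - e i₀ : ℝ) : ℂ)) /
      ((e i - e i₀ : ℝ) : ℂ) := by
    rw [eq_div_iff hne, mul_comm, ← h6, ← h3]; push_cast; rfl
  rw [h6, h7]
  set x := ⟪b i, f⟫
  have h8 : (starRingEnd ℂ) x * x = ((‖x‖ ^ 2 : ℝ) : ℂ) := by
    rw [mul_comm, Complex.mul_conj, Complex.normSq_eq_norm_sq]
  have h9 : (starRingEnd ℂ) (k i * (x / ((e i - e i₀ : ℝ) : ℂ)) / ((e i - e i₀ : ℝ) : ℂ)) *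
      (k i * (x / ((e i - e i₀ : ℝ) : ℂ))) =
      ((k i ^ 2 * ‖x‖ ^ 2 / (e i - e i₀) ^ 3 : ℝ) : ℂ) := by
    simp only [map_div₀, map_mul, Complex.conj_ofReal]
    calc _ = (k i : ℂ) ^ 2 * ((starRingEnd ℂ) x * x) / ((e i - e i₀ : ℝ) : ℂ) ^ 3 := by
          field_simp
      _ = _ := by rw [h8]; push_cast; rfl
  rw [h9, Complex.ofReal_re]

end Response

/-! ### The marked ground state of a system: gap, zero momentum, time reversal. -/

section GroundState

variable {H : Type*} [NormedAddCommGroup H] [InnerProductSpace ℂ H] {D : Submodule ℂ H}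

local notation "⟪" x ", " y "⟫" => inner ℂ x y

/-- A unit eigenvector that is not above the ground energy is a phase times `Ω`, hence inherits the
gap. -/
theorem GappedGround.of_le {A : D →ₗ[ℂ] H} (hA : SymmOn A) {Ω Ω₀ : D} {e e₀ g : ℝ}
    (hΩ : GappedGround A Ω e g) (hn : ‖(Ω₀ : H)‖ = 1) (h : A Ω₀ = (e₀ : ℂ) • (Ω₀ : H))
    (hle : e₀ ≤ e) : GappedGround A Ω₀ e₀ g := by
  obtain rfl : e₀ = e := le_antisymm hle (hΩ.energy_le hA hn h)
  refine ⟨hn, h, hΩ.gap_pos, fun ψ hψ => hΩ.gap ψ ?_⟩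
  have h1 := hΩ.unique h
  rw [h1, inner_smul_left] at hψ
  refine (mul_eq_zero.1 hψ).resolve_left fun h0 => ?_
  rw [map_eq_zero] at h0
  rw [h0, zero_smul] at h1
  rw [h1, norm_zero] at hn
  exact zero_ne_one hn

end GroundState

namespace JointEigenbasis

variable {N d : ℕ} {s : Statistics} {L m : ℝ} {w : (Fin d → ℝ) → ℝ}

local notation "⟪" x ", " y "⟫" => inner ℂ x y

/-- The members of the system as vectors of the `N`-particle Hilbert space. -/
def vec (B : JointEigenbasis s N d L m w) (i : B.ι) : sector N d s := ⟨B.state i, B.state_mem i⟩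

theorem orthonormal_vec (B : JointEigenbasis s N d L m w) : Orthonormal ℂ B.vec :=
  ⟨B.orthonormal.1, fun _ _ hij => B.orthonormal.2 hij⟩

theorem dense_vec (B : JointEigenbasis s N d L m w) :
    (Submodule.span ℂ (Set.range B.vec)).topologicalClosure = ⊤ := by
  rw [eq_top_iff]
  intro x _
  have h1 : (x : Wave N d) ∈ closure (Submodule.span ℂ (Set.range B.state) : Set (Wave N d)) := by
    rw [← Submodule.topologicalClosure_coe]
    exact B.complete x.2
  change x ∈ closure (Submodule.span ℂ (Set.range B.vec) : Set (sector N d s))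
  rw [Topology.IsInducing.subtypeVal.closure_eq_preimage_closure_image, Set.mem_preimage]
  have h2 : (Subtype.val '' (Submodule.span ℂ (Set.range B.vec) : Set (sector N d s)) :
      Set (Wave N d)) = (Submodule.span ℂ (Set.range B.state) : Set (Wave N d)) := by
    have h3 := Submodule.map_span (sector N d s).subtype (Set.range B.vec)
    rw [← Set.range_comp] at h3
    exact congrArg SetLike.coe h3
  exact h2.symm ▸ h1

/-- The system as a Hilbert basis of the `N`-particle Hilbert space. -/
def hilbertBasis (B : JointEigenbasis s N d L m w) : HilbertBasis B.ι ℂ (sector N d s) :=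
  HilbertBasis.mk B.orthonormal_vec B.dense_vec.ge

theorem hilbertBasis_apply (B : JointEigenbasis s N d L m w) (i : B.ι) :
    B.hilbertBasis i = B.vec i := by
  rw [hilbertBasis, HilbertBasis.coe_mk]

theorem mem_kineticDomain (hw : IsInteraction L w) (B : JointEigenbasis s N d L m w) (i : B.ι) :
    B.vec i ∈ kineticDomain s N d L m :=
  ((B.energy_eq i).pert_eq hw (B.state_mem i)).1

theorem pert_vec (hw : IsInteraction L w) (B : JointEigenbasis s N d L m w) (i : B.ι) :
    pert (sectorKinetic s N d L m) (sectorInteraction s N hw)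
      ⟨B.vec i, B.mem_kineticDomain hw i⟩ = (B.energy i : ℂ) • B.vec i :=
  ((B.energy_eq i).pert_eq hw (B.state_mem i)).2

theorem momentum_vec (hm : 0 < m) (hw : IsInteraction L w) (B : JointEigenbasis s N d L m w)
    (i : B.ι) (a : Fin d) : sectorMomentum s N d L m hm a ⟨B.vec i, B.mem_kineticDomain hw i⟩ =
      (waveVector L (B.momentum i) a : ℂ) • B.vec i :=
  Subtype.ext (B.momentum_eq i a).2

theorem hasMomentum (hL : 0 < L) (B : JointEigenbasis s N d L m w) (i : B.ι) :
    HasMomentum (B.momentum i) (B.state i) :=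
  hasMomentum_of_eigenEq hL (B.momentum_eq i)

/-- The ground state of the system, in the domain of the kinetic energy. -/
def groundVec (hw : IsInteraction L w) (B : JointEigenbasis s N d L m w) :
    kineticDomain s N d L m := ⟨B.vec B.ground, B.mem_kineticDomain hw B.ground⟩

/-- The gap `g` is the same for every system, which allows `r` to be chosen before the system. -/
theorem gappedGround (hL : 0 < L) (hm : 0 < m) (hw : IsInteraction L w)
    (B : JointEigenbasis s N d L m w) {Ω : kineticDomain s N d L m} {e g : ℝ}
    (hΩ : GappedGround (pert (sectorKinetic s N d L m) (sectorInteraction s N hw)) Ω e g) :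
    GappedGround (pert (sectorKinetic s N d L m) (sectorInteraction s N hw)) (B.groundVec hw)
      (B.energy B.ground) g := by
  have hA := (isKinetic_sectorKinetic (s := s) (N := N) (d := d) hL hm).symm.pert
    (sectorInteraction_symm hw)
  obtain ⟨i, hi⟩ := exists_inner_ne_zero B.dense_vec hΩ.ne_zero
  have he : B.energy i = e :=
    hA.eigenvalue_eq (ψ := ⟨B.vec i, B.mem_kineticDomain hw i⟩) (B.pert_vec hw i) hΩ.eigen hi
  exact hΩ.of_le hA (B.orthonormal.1 B.ground) (B.pert_vec hw B.ground)
    ((B.ground_le i).trans he.le)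

variable {g : ℝ} {hw : IsInteraction L w}

/-- The expectation of each momentum component vanishes by time reversal, and in an eigenvector it
is the eigenvalue. -/
theorem momentum_ground (hL : 0 < L) (hm : 0 < m) (B : JointEigenbasis s N d L m w)
    (hB : GappedGround (pert (sectorKinetic s N d L m) (sectorInteraction s N hw)) (B.groundVec hw)
      (B.energy B.ground) g) : B.momentum B.ground = 0 := by
  refine waveVector_injective hL fun i => ?_
  have h1 := hB.inner_drift_eq_zero (isDrift_sectorMomentum hm i).symm
    (isReversal_sectorConj hm i) (fun x => sectorInteraction_conj hw x)
  have h2 := (isDrift_sectorMomentum (s := s) (N := N) (L := L) hm i).symm.inner_eigen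
    (B.momentum_vec hm hw B.ground i) (B.groundVec hw)
  have h3 := h2.symm.trans h1
  have h4 : ⟪(B.groundVec hw : sector N d s), (B.groundVec hw : sector N d s)⟫ ≠ 0 :=
    inner_self_ne_zero.2 hB.ne_zero
  have h5 := (mul_eq_zero.1 h3).resolve_right h4
  rw [Complex.ofReal_eq_zero] at h5
  rw [h5]
  simp [waveVector]

theorem momentum_groundVec (hL : 0 < L) (hm : 0 < m) (B : JointEigenbasis s N d L m w)
    (hB : GappedGround (pert (sectorKinetic s N d L m) (sectorInteraction s N hw)) (B.groundVec hw)
      (B.energy B.ground) g) (a : Fin d) :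
    sectorMomentum s N d L m hm a (B.groundVec hw) = 0 := by
  refine (B.momentum_vec hm hw B.ground a).trans ?_
  rw [B.momentum_ground hL hm hB]
  simp [waveVector]

theorem add_gap_le_energy (B : JointEigenbasis s N d L m w)
    (hB : GappedGround (pert (sectorKinetic s N d L m) (sectorInteraction s N hw)) (B.groundVec hw)
      (B.energy B.ground) g) {i : B.ι} (hi : i ≠ B.ground) : B.energy B.ground + g ≤ B.energy i :=
  hB.gap_le (ψ := ⟨B.vec i, B.mem_kineticDomain hw i⟩) (B.orthonormal.1 i) (B.pert_vec hw i)
    (B.orthonormal_vec.2 hi.symm)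

theorem gap_pos (B : JointEigenbasis s N d L m w)
    (hB : GappedGround (pert (sectorKinetic s N d L m) (sectorInteraction s N hw)) (B.groundVec hw)
      (B.energy B.ground) g) {K : Set (Fin d → ℤ)} (hK : (B.excitations K).Nonempty) :
    0 < B.gap K := by
  refine hB.gap_pos.trans_le (le_csInf hK ?_)
  rintro _ ⟨i, hi, -, rfl⟩
  linarith [B.add_gap_le_energy hB hi]

theorem gap_le (B : JointEigenbasis s N d L m w) {K : Set (Fin d → ℤ)} {i : B.ι}
    (hi : i ≠ B.ground) (hK : B.momentum i ∈ K) : B.gap K ≤ B.energy i - B.energy B.ground := by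
  refine csInf_le ⟨0, ?_⟩ ⟨i, hi, hK, rfl⟩
  rintro _ ⟨i, -, -, rfl⟩
  linarith [B.ground_le i]

/-- An eigenvector of energy and momentum has the energy and momentum of a member of the system. -/
theorem exists_index (hL : 0 < L) (hm : 0 < m) (hw : IsInteraction L w)
    (B : JointEigenbasis s N d L m w) {ψ : kineticDomain s N d L m} {e : ℝ} {k : Fin d → ℤ}
    (h0 : (ψ : sector N d s) ≠ 0)
    (he : pert (sectorKinetic s N d L m) (sectorInteraction s N hw) ψ =
      (e : ℂ) • (ψ : sector N d s))
    (hk : HasMomentum k ((ψ : sector N d s) : Wave N d)) :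
    ∃ i, B.energy i = e ∧ B.momentum i = k := by
  have hA := (isKinetic_sectorKinetic (s := s) (N := N) (d := d) hL hm).symm.pert
    (sectorInteraction_symm hw)
  obtain ⟨i, hi⟩ := exists_inner_ne_zero B.dense_vec h0
  refine ⟨i, hA.eigenvalue_eq (ψ := ⟨B.vec i, B.mem_kineticDomain hw i⟩) (B.pert_vec hw i) he hi, ?_⟩
  by_contra hne
  exact hi ((B.hasMomentum hL i).inner_eq_zero hk hne)

/-- Time reversal of a member of the system. -/
theorem exists_index_neg (hL : 0 < L) (hm : 0 < m) (hw : IsInteraction L w) (a : Fin d)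
    (B : JointEigenbasis s N d L m w) (i : B.ι) :
    ∃ j, B.energy j = B.energy i ∧ B.momentum j = -B.momentum i := by
  have hJ := isReversal_sectorConj (s := s) (N := N) (L := L) hm a
  refine B.exists_index hL hm hw
    (ψ := ⟨sectorConj s N d (B.vec i), hJ.mem _ (B.mem_kineticDomain hw i)⟩) ?_ ?_ ?_
  · intro h
    have h1 := hJ.norm_map (B.vec i)
    have h2 : ‖B.vec i‖ = 1 := B.orthonormal_vec.1 i
    have h3 : sectorConj s N d (B.vec i) = 0 := h
    rw [h3, norm_zero, h2] at h1
    exact zero_ne_one h1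
  · have h1 := B.pert_vec hw i
    rw [pert_apply] at h1 ⊢
    have h2 := hJ.comm ⟨B.vec i, B.mem_kineticDomain hw i⟩
    have h3 : sectorInteraction s N hw (sectorConj s N d (B.vec i)) =
      sectorConj s N d (sectorInteraction s N hw (B.vec i)) := sectorInteraction_conj hw _
    change _ + sectorInteraction s N hw (sectorConj s N d (B.vec i)) =
      (B.energy i : ℂ) • sectorConj s N d (B.vec i)
    rw [h3]
    refine (congrArg (· + _) h2).trans ?_
    rw [← hJ.map_add]
    refine (congrArg (sectorConj s N d) h1).trans ?_
    rw [hJ.map_smul, Complex.conj_ofReal]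
  · intro n hn
    change coeff (planeWave N d) (star (B.state i)) n = 0
    rw [coeff_star, B.hasMomentum hL i, map_zero]
    intro h
    apply hn
    rw [← h]
    funext j
    simp [totalIndex]

end JointEigenbasis

/-! ### Density operators and one-body multiplication operators. -/

section Density

variable {N d : ℕ} {s : Statistics} {L m : ℝ} {w u : (Fin d → ℝ) → ℝ}

local notation "⟪" x ", " y "⟫" => inner ℂ x y

theorem HasMomentum.add {k : Fin d → ℤ} {ψ φ : Wave N d} (hψ : HasMomentum k ψ)
    (hφ : HasMomentum k φ) : HasMomentum k (ψ + φ) := by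
  intro n hn
  rw [coeff_add, hψ n hn, hφ n hn, add_zero]

theorem hasMomentum_zero (k : Fin d → ℤ) : HasMomentum k (0 : Wave N d) := by
  intro n _
  rw [← zero_smul ℂ (0 : Wave N d), coeff_smul, zero_mul]

theorem hasMomentum_sum {ι : Type*} (F : Finset ι) {k : Fin d → ℤ} {ψ : ι → Wave N d}
    (h : ∀ i, HasMomentum k (ψ i)) : HasMomentum k (∑ i ∈ F, ψ i) := by
  classical
  induction F using Finset.induction_on with
  | empty => exact hasMomentum_zero k
  | insert a F ha ih =>
    rw [Finset.sum_insert ha]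
    exact (h a).add ih

theorem cexpWave_mul (hL : 0 < L) (q : Fin d → ℤ) (t : Fin d → ℝ) :
    cexpWave L q (fun i => L * t i) = UnitAddTorus.mFourier q fun i => (t i : UnitAddCircle) := by
  change _ = ∏ i, fourier (q i) (t i : UnitAddCircle)
  simp only [fourier_coe_apply]
  rw [← Complex.exp_sum, cexpWave]
  congr 1
  push_cast
  rw [Finset.mul_sum]
  refine Finset.sum_congr rfl fun i _ => ?_
  have : (L : ℂ) ≠ 0 := by exact_mod_cast hL.ne'
  simp only [waveVector]
  push_cast
  field_simp

theorem cexpWave_boxPoint (hL : 0 < L) (q : Fin d → ℤ) (y : UnitAddTorus (Fin d)) :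
    cexpWave L q (boxPoint L y) = UnitAddTorus.mFourier q y := by
  refine (cexpWave_mul hL q _).trans ?_
  congr 1
  funext i
  exact AddCircle.coe_equivIco

/-- The coordinates of a particle. -/
def particleCoord (j : Fin N) (y : Config N d) : UnitAddTorus (Fin d) := fun i => y (j, i)

theorem measurable_particleCoord (j : Fin N) : Measurable (particleCoord (d := d) j) := by
  refine Continuous.measurable ?_
  unfold particleCoord
  fun_prop

theorem densityFun_neg (hL : 0 < L) (k : Fin d → ℤ) (y : Config N d) :
    densityFun L (-k) y = ∑ j, UnitAddTorus.mFourier k (particleCoord j y) := by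
  rw [densityFun]
  refine Finset.sum_congr rfl fun j _ => ?_
  rw [neg_neg, position_eq_boxPoint, cexpWave_boxPoint hL]
  rfl

theorem bddMeas_densityFun (L : ℝ) (k : Fin d → ℤ) :
    BddMeas (densityFun (N := N) L k) N where
  measurable := by
    have hc : Continuous (cexpWave (d := d) L (-k)) := by
      unfold cexpWave
      fun_prop
    unfold densityFun
    exact Finset.measurable_sum _ fun j _ => hc.measurable.comp (measurable_position L j)
  bound y := by
    refine (norm_sum_le _ _).trans ?_
    simp [norm_cexpWave]

theorem density_eq (L : ℝ) (k : Fin d → ℤ) (ψ : Wave N d) :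
    density L k ψ = mulCLM (bddMeas_densityFun L k) ψ := rfl

theorem norm_density_le (L : ℝ) (k : Fin d → ℤ) (ψ : Wave N d) : ‖density L k ψ‖ ≤ N * ‖ψ‖ :=
  (bddMeas_densityFun L k).norm_le ψ

theorem density_mem_sector (L : ℝ) (k : Fin d → ℤ) {ψ : Wave N d} (h : ψ ∈ sector N d s) :
    density L k ψ ∈ sector N d s :=
  mem_sector_of_comm (X := density L k) (fun _ _ => map_smul (mulCLM (bddMeas_densityFun L k)) _ _)
    (fun σ ψ => permute_mulCLM (bddMeas_densityFun L k) σ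
      (fun y => Equiv.sum_comp σ fun j => cexpWave L (-k) (position L j y)) ψ) h

/-- The multiplication operator by `∑_j f (y_j)`. -/
def oneBodyMul (N : ℕ) {d : ℕ} : C(UnitAddTorus (Fin d), ℂ) →L[ℂ] (Wave N d →L[ℂ] Wave N d) :=
  ∑ j : Fin N, compMul (measurable_particleCoord j)

theorem oneBodyMul_apply {f : C(UnitAddTorus (Fin d), ℂ)} {h : Config N d → ℂ} {C : ℝ}
    (hh : BddMeas h C) (hf : ∀ y, h y = ∑ j, f (particleCoord j y)) (ψ : Wave N d) :
    oneBodyMul N f ψ = mulCLM hh ψ := by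
  have h1 := mulCLM_sum Finset.univ (fun (j : Fin N) y => f (particleCoord j y)) (fun _ => (1 : ℂ))
    (fun j => bddMeas_comp f (measurable_particleCoord j)) hh
    (fun y => by rw [hf y]; simp) ψ
  rw [h1, oneBodyMul, sum_apply, sum_apply]
  refine Finset.sum_congr rfl fun j _ => ?_
  rw [one_smul, compMul_apply]

theorem oneBodyMul_mFourier (hL : 0 < L) (q : Fin d → ℤ) (ψ : Wave N d) :
    oneBodyMul N (UnitAddTorus.mFourier q) ψ = density L (-q) ψ := by
  rw [density_eq]
  exact oneBodyMul_apply _ (densityFun_neg hL q) ψ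

/-- Each summand of `ρ_{-k}` multiplies by a plane wave in one particle, adding `k` to the total
momentum. -/
theorem HasMomentum.density (hL : 0 < L) (k : Fin d → ℤ) {ψ : Wave N d} (h : HasMomentum 0 ψ) :
    HasMomentum k (density L (-k) ψ) := by
  rw [← oneBodyMul_mFourier hL, oneBodyMul, sum_apply, sum_apply]
  refine hasMomentum_sum _ fun j => ?_
  rw [compMul_apply, mulCLM_congr (bddMeas_comp _ (measurable_particleCoord j))
    (bddMeas_mFourier (particleIndex j k)) fun y => (mFourier_particleIndex j k y).symm]
  have := h.mulCLM_mFourier (particleIndex j k) (bddMeas_mFourier (particleIndex j k))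
  rwa [totalIndex_particleIndex, zero_add] at this

theorem norm_mulCLM_eq {f f' : Config N d → ℂ} {C C' : ℝ} (hf : BddMeas f C)
    (hf' : BddMeas f' C') (h : ∀ y, ‖f y‖ = ‖f' y‖) (ψ : Wave N d) :
    ‖mulCLM hf ψ‖ = ‖mulCLM hf' ψ‖ := by
  have h1 : ∀ᵐ y ∂configMeasure N d, ‖mulCLM hf ψ y‖ = ‖mulCLM hf' ψ y‖ := by
    filter_upwards [mulCLM_ae hf ψ, mulCLM_ae hf' ψ] with y h1 h2
    rw [h1, h2, norm_mul, norm_mul, h y]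
  exact le_antisymm (Lp.norm_le_norm_of_ae_le (h1.mono fun _ h => h.le))
    (Lp.norm_le_norm_of_ae_le (h1.mono fun _ h => h.ge))

theorem cexpWave_neg (L : ℝ) (k : Fin d → ℤ) (x : Fin d → ℝ) :
    cexpWave L (-k) x = (starRingEnd ℂ) (cexpWave L k x) := by
  rw [cexpWave, cexpWave, ← Complex.exp_conj, map_mul, Complex.conj_I, Complex.conj_ofReal]
  simp [waveVector]

/-- The two density functions are complex conjugates, so they have equal moduli; hence the structure
factor is even. -/
theorem norm_density_neg (L : ℝ) (k : Fin d → ℤ) (ψ : Wave N d) :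
    ‖density L (-k) ψ‖ = ‖density L k ψ‖ := by
  refine norm_mulCLM_eq (bddMeas_densityFun L (-k)) (bddMeas_densityFun L k) (fun y => ?_) ψ
  have : densityFun L (-k) y = (starRingEnd ℂ) (densityFun L k y) := by
    simp only [densityFun, map_sum, cexpWave_neg]
  rw [this, RCLike.norm_conj]

end Density

/-! ### Fourier coefficients on the torus and matrix elements of one-body potentials. -/

section TorusFourier

variable {N d : ℕ} {s : Statistics} {L m : ℝ} {w u : (Fin d → ℝ) → ℝ}

local notation "⟪" x ", " y "⟫" => inner ℂ x y

/-- The uniform probability measure on the torus. -/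
abbrev torusMeasure (d : ℕ) : Measure (UnitAddTorus (Fin d)) :=
  Measure.pi fun _ => (AddCircle.haarAddCircle : Measure UnitAddCircle)

/-- The plane waves on the torus. -/
def torusBasis (d : ℕ) : HilbertBasis (Fin d → ℤ) ℂ (Lp ℂ 2 (torusMeasure d)) :=
  UnitAddTorus.mFourierBasis

/-- A continuous function as an element of `L²`. -/
def torusLp (d : ℕ) : C(UnitAddTorus (Fin d), ℂ) →L[ℂ] Lp ℂ 2 (torusMeasure d) :=
  ContinuousMap.toLp 2 (torusMeasure d) ℂ

/-- The Fourier coefficient of a continuous function on the torus. -/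
def torusCoeff (k : Fin d → ℤ) : C(UnitAddTorus (Fin d), ℂ) →L[ℂ] ℂ :=
  (innerSL ℂ (torusBasis d k)) ∘L torusLp d

theorem torusBasis_apply (k : Fin d → ℤ) :
    torusBasis d k = torusLp d (UnitAddTorus.mFourier k) :=
  congrFun UnitAddTorus.coe_mFourierBasis k

theorem torusCoeff_mFourier (k q : Fin d → ℤ) :
    torusCoeff k (UnitAddTorus.mFourier q) = if k = q then 1 else 0 := by
  change ⟪torusBasis d k, torusLp d (UnitAddTorus.mFourier q)⟫ = _
  rw [← torusBasis_apply]
  exact orthonormal_iff_ite.1 (torusBasis d).orthonormal k q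

theorem torusCoeff_eq_coeff (k : Fin d → ℤ) (f : C(UnitAddTorus (Fin d), ℂ)) :
    torusCoeff k f = coeff (torusBasis d) (torusLp d f) k := by
  rw [coeff_eq_inner]
  rfl

theorem torusCoeff_eq_mFourierCoeff (k : Fin d → ℤ) (f : C(UnitAddTorus (Fin d), ℂ)) :
    torusCoeff k f = UnitAddTorus.mFourierCoeff f k := by
  rw [torusCoeff_eq_coeff]
  exact (UnitAddTorus.mFourierBasis_repr (torusLp d f) k).trans
    (UnitAddTorus.mFourierCoeff_toLp f k)

/-- The matrix elements of a one-body potential between states of fixed momentum. -/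
theorem inner_oneBodyMul (hL : 0 < L) {k : Fin d → ℤ} {φ ψ : Wave N d} (hφ : HasMomentum k φ)
    (hψ : HasMomentum 0 ψ) (f : C(UnitAddTorus (Fin d), ℂ)) :
    ⟪φ, oneBodyMul N f ψ⟫ = torusCoeff k f * ⟪φ, density L (-k) ψ⟫ := by
  let E1 : C(UnitAddTorus (Fin d), ℂ) →L[ℂ] ℂ :=
    (innerSL ℂ φ) ∘L ((ContinuousLinearMap.apply ℂ (Wave N d) ψ) ∘L oneBodyMul N)
  let E2 : C(UnitAddTorus (Fin d), ℂ) →L[ℂ] ℂ := ⟪φ, density L (-k) ψ⟫ • torusCoeff k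
  -- Both functionals are linear and continuous in `f`. On a monomial of wave vector `q ≠ k` they
  -- vanish by momentum conservation.
  have hE : E1 = E2 := by
    refine ContinuousLinearMap.ext_on (s := Set.range (UnitAddTorus.mFourier (d := Fin d))) ?_ ?_
    · exact Submodule.dense_iff_topologicalClosure_eq_top.2
        (UnitAddTorus.span_mFourier_closure_eq_top (d := Fin d))
    · rintro _ ⟨q, rfl⟩
      change ⟪φ, oneBodyMul N (UnitAddTorus.mFourier q) ψ⟫ =
        ⟪φ, density L (-k) ψ⟫ * torusCoeff k (UnitAddTorus.mFourier q)
      rw [oneBodyMul_mFourier hL, torusCoeff_mFourier]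
      split_ifs with h
      · rw [h, mul_one]
      · rw [mul_zero]
        exact hφ.inner_eq_zero (hψ.density hL q) h
  rw [mul_comm]
  exact DFunLike.congr_fun hE f

end TorusFourier

/-! ### The structure factor and the bound on the second order response. -/

namespace JointEigenbasis

variable {N d : ℕ} {s : Statistics} {L m : ℝ} {w : (Fin d → ℝ) → ℝ} {g : ℝ}
  {hw : IsInteraction L w}

local notation "⟪" x ", " y "⟫" => inner ℂ x y

/-- The ground state has total momentum zero. -/
theorem hasMomentum_ground (hL : 0 < L) (hm : 0 < m) (B : JointEigenbasis s N d L m w)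
    (hB : GappedGround (pert (sectorKinetic s N d L m) (sectorInteraction s N hw)) (B.groundVec hw)
      (B.energy B.ground) g) : HasMomentum 0 (B.state B.ground) := by
  have := B.hasMomentum hL B.ground
  rwa [B.momentum_ground hL hm hB] at this

/-- Parseval: `ρ_{-k}` sends the ground state into momentum `k`, so the members of that momentum
exhaust its norm. -/
theorem hasSum_sq_inner_density (hL : 0 < L) (B : JointEigenbasis s N d L m w)
    (h0 : HasMomentum 0 (B.state B.ground)) (k : Fin d → ℤ) :
    HasSum (fun i : {i : B.ι // B.momentum i = k} =>
      ‖⟪B.state i, density L (-k) (B.state B.ground)⟫‖ ^ 2)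
      (‖density L (-k) (B.state B.ground)‖ ^ 2) := by
  have h1 := HilbertBasis.hasSum_sq_norm B.hilbertBasis
    ⟨density L (-k) (B.state B.ground), density_mem_sector L (-k) (B.state_mem B.ground)⟩
  have h2 : ∀ i, coeff B.hilbertBasis
      ⟨density L (-k) (B.state B.ground), density_mem_sector L (-k) (B.state_mem B.ground)⟩ i =
      ⟪B.state i, density L (-k) (B.state B.ground)⟫ := by
    intro i
    rw [coeff_eq_inner, hilbertBasis_apply]
    rfl
  simp only [h2] at h1
  refine (hasSum_subtype_iff_of_support_subset (s := {i : B.ι | B.momentum i = k}) ?_).2 h1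
  intro i hi
  by_contra hne
  refine hi ?_
  change ‖_‖ ^ 2 = (0 : ℝ)
  rw [(B.hasMomentum hL i).inner_eq_zero (h0.density hL k) hne, norm_zero]
  norm_num

theorem structureFactor_eq (hL : 0 < L) (B : JointEigenbasis s N d L m w)
    (h0 : HasMomentum 0 (B.state B.ground)) (k : Fin d → ℤ) :
    B.structureFactor k = 1 / N * ‖density L (-k) (B.state B.ground)‖ ^ 2 := by
  rw [structureFactor, (B.hasSum_sq_inner_density hL h0 k).tsum_eq]

theorem structureFactor_nonneg (B : JointEigenbasis s N d L m w) (k : Fin d → ℤ) :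
    0 ≤ B.structureFactor k :=
  mul_nonneg (by positivity) (tsum_nonneg fun _ => sq_nonneg _)

/-- A crude bound, uniform in `k`, that reduces the convergence of the sums to that of `k_a²
|ũ(k)|²`. -/
theorem structureFactor_le (hL : 0 < L) (hN : 0 < N) (B : JointEigenbasis s N d L m w)
    (h0 : HasMomentum 0 (B.state B.ground)) (k : Fin d → ℤ) : B.structureFactor k ≤ N := by
  rw [B.structureFactor_eq hL h0]
  have h1 := norm_density_le L (-k) (B.state B.ground)
  rw [B.orthonormal.1, mul_one] at h1
  have hN' : (0 : ℝ) < N := by exact_mod_cast hN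
  rw [one_div, inv_mul_le_iff₀ hN']
  nlinarith [norm_nonneg (density L (-k) (B.state B.ground))]

theorem structureFactor_neg (hL : 0 < L) (B : JointEigenbasis s N d L m w)
    (h0 : HasMomentum 0 (B.state B.ground)) (k : Fin d → ℤ) :
    B.structureFactor (-k) = B.structureFactor k := by
  rw [B.structureFactor_eq hL h0, B.structureFactor_eq hL h0, norm_density_neg]

/-- `X` has the matrix elements of the one-body potential with the Fourier coefficients `c k`. -/
def IsOneBody (B : JointEigenbasis s N d L m w) (X : sector N d s →L[ℂ] sector N d s)
    (c : (Fin d → ℤ) → ℂ) : Prop :=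
  ∀ i, ⟪B.vec i, X (B.vec B.ground)⟫ =
    c (B.momentum i) * ⟪B.state i, density L (-(B.momentum i)) (B.state B.ground)⟫

/-- The sum over the members of the system, arranged by momentum. -/
theorem hasSum_structureFactor (hL : 0 < L) (hN : 0 < N) (B : JointEigenbasis s N d L m w)
    (h0 : HasMomentum 0 (B.state B.ground)) {f : (Fin d → ℤ) → ℝ} (hf : ∀ k, 0 ≤ f k)
    (hs : Summable fun k => f k * B.structureFactor k) :
    HasSum (fun i => f (B.momentum i) *
      ‖⟪B.state i, density L (-(B.momentum i)) (B.state B.ground)⟫‖ ^ 2)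
      (N * ∑' k, f k * B.structureFactor k) := by
  have hN' : (N : ℝ) ≠ 0 := by exact_mod_cast hN.ne'
  set F : B.ι → ℝ := fun i => f (B.momentum i) *
      ‖⟪B.state i, density L (-(B.momentum i)) (B.state B.ground)⟫‖ ^ 2 with hF
  have hfib : ∀ k, HasSum (fun i : {i : B.ι // B.momentum i = k} => F i)
      (N * (f k * B.structureFactor k)) := by
    intro k
    have h1 := (B.hasSum_sq_inner_density hL h0 k).mul_left (f k)
    have h2 : N * (f k * B.structureFactor k) =
        f k * ‖density L (-k) (B.state B.ground)‖ ^ 2 := by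
      rw [B.structureFactor_eq hL h0]
      field_simp
    rw [h2]
    refine h1.congr_fun fun i => ?_
    rw [hF]
    simp only [i.2]
  -- All terms are nonnegative, so the sum over members may be grouped by momentum.
  have hs' : Summable fun p : Σ k, {i : B.ι // B.momentum i = k} => F p.2 := by
    rw [summable_sigma_of_nonneg fun p => mul_nonneg (hf _) (sq_nonneg _)]
    refine ⟨fun k => (hfib k).summable, ?_⟩
    refine (hs.mul_left (N : ℝ)).congr fun k => ?_
    exact (hfib k).tsum_eq.symm
  rw [← (Equiv.sigmaFiberEquiv B.momentum).hasSum_iff]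
  have h3 : ∑' p : Σ k, {i : B.ι // B.momentum i = k}, F p.2 =
      N * ∑' k, f k * B.structureFactor k := by
    rw [hs'.tsum_sigma' fun k => (hfib k).summable, ← tsum_mul_left]
    exact tsum_congr fun k => (hfib k).tsum_eq
  rw [← h3]
  exact hs'.hasSum

/-- Every excitation energy is replaced by its lower bound `Δ`. This is demanded only of excited
members at momenta with nonzero coefficient, since no other member contributes. -/
theorem exists_response_le (hL : 0 < L) (hm : 0 < m) (hN : 0 < N) (a : Fin d)
    (B : JointEigenbasis s N d L m w)
    (hB : GappedGround (pert (sectorKinetic s N d L m) (sectorInteraction s N hw)) (B.groundVec hw)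
      (B.energy B.ground) g) {X : sector N d s →L[ℂ] sector N d s} {c : (Fin d → ℤ) → ℂ}
    (hX : B.IsOneBody X c) {Δ : ℝ}
    (hΔ : ∀ i, i ≠ B.ground → c (B.momentum i) ≠ 0 → 0 < Δ ∧ Δ ≤ B.energy i - B.energy B.ground)
    (hs : Summable fun k => (waveVector L k a * ‖c k‖) ^ 2 * B.structureFactor k) :
    ∃ χ ζ : kineticDomain s N d L m,
      ⟪(B.groundVec hw : sector N d s), (χ : sector N d s)⟫ = 0 ∧
      pert (sectorKinetic s N d L m) (sectorInteraction s N hw) χ -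
        (B.energy B.ground : ℂ) • (χ : sector N d s) =
        X (B.groundVec hw) - ⟪(B.groundVec hw : sector N d s), X (B.groundVec hw)⟫ •
          (B.groundVec hw : sector N d s) ∧
      ⟪(B.groundVec hw : sector N d s), (ζ : sector N d s)⟫ = 0 ∧
      pert (sectorKinetic s N d L m) (sectorInteraction s N hw) ζ -
        (B.energy B.ground : ℂ) • (ζ : sector N d s) = sectorMomentum s N d L m hm a χ ∧
      (⟪(ζ : sector N d s), sectorMomentum s N d L m hm a χ⟫).re ≤
        1 / Δ ^ 3 * (N * ∑' k, (waveVector L k a * ‖c k‖) ^ 2 * B.structureFactor k) := by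
  have hK := isKinetic_sectorKinetic (s := s) (N := N) (d := d) hL hm
  have hW := sectorInteraction_symm (s := s) (N := N) hw
  have hP := (isDrift_sectorMomentum (s := s) (N := N) (L := L) hm a).symm
  have hPΩ := B.momentum_groundVec hL hm hB a
  have h0 := B.hasMomentum_ground hL hm hB
  obtain ⟨χ, hχ0, hχ⟩ := hB.exists_solution hK hW
    (hB.decompose (X (B.groundVec hw)))
  have hz : ⟪(B.groundVec hw : sector N d s), sectorMomentum s N d L m hm a χ⟫ = 0 := by
    rw [← hP, hPΩ, inner_zero_left]
  obtain ⟨ζ, hζ0, hζ⟩ := hB.exists_solution hK hW hz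
  refine ⟨χ, ζ, hχ0, hχ, hζ0, hζ, ?_⟩
  have h1 := hasSum_response (hK.symm.pert hW) hP B.hilbertBasis (e := B.energy)
    (k := fun i => waveVector L (B.momentum i) a) (i₀ := B.ground) (f := X (B.groundVec hw))
    (χ := χ) (ζ := ζ)
    (fun i => by
      rw [hilbertBasis_apply]
      exact ⟨B.mem_kineticDomain hw i, B.pert_vec hw i⟩)
    (fun i => by
      rw [hilbertBasis_apply]
      exact ⟨B.mem_kineticDomain hw i, B.momentum_vec hm hw i a⟩)
    (fun i hi => by linarith [B.add_gap_le_energy hB hi, hB.gap_pos])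
    (by rw [B.momentum_ground hL hm hB]; simp [waveVector])
    (by rw [hilbertBasis_apply]; exact hχ) hζ
  have h2 := (B.hasSum_structureFactor hL hN h0 (f := fun k => (waveVector L k a * ‖c k‖) ^ 2)
    (fun k => sq_nonneg _) hs).mul_left (1 / Δ ^ 3)
  refine hasSum_le (fun i => ?_) h1 h2
  have h3 : ⟪B.hilbertBasis i, X (B.groundVec hw)⟫ =
      c (B.momentum i) * ⟪B.state i, density L (-(B.momentum i)) (B.state B.ground)⟫ := by
    rw [hilbertBasis_apply]
    exact hX i
  rw [h3, norm_mul]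
  set x := ‖⟪B.state i, density L (-(B.momentum i)) (B.state B.ground)⟫‖
  by_cases hz : i = B.ground ∨ c (B.momentum i) = 0
  · rcases hz with rfl | hz
    · rw [B.momentum_ground hL hm hB]
      simp [waveVector]
    · rw [hz]
      simp
  · push Not at hz
    obtain ⟨hpos, hle⟩ := hΔ i hz.1 hz.2
    have h4 : (0 : ℝ) ≤ (waveVector L (B.momentum i) a * ‖c (B.momentum i)‖) ^ 2 * x ^ 2 := by
      positivity
    calc waveVector L (B.momentum i) a ^ 2 * (‖c (B.momentum i)‖ * x) ^ 2 /
          (B.energy i - B.energy B.ground) ^ 3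
        = (waveVector L (B.momentum i) a * ‖c (B.momentum i)‖) ^ 2 * x ^ 2 /
          (B.energy i - B.energy B.ground) ^ 3 := by ring
      _ ≤ (waveVector L (B.momentum i) a * ‖c (B.momentum i)‖) ^ 2 * x ^ 2 / Δ ^ 3 := by
          gcongr
      _ = _ := by ring

end JointEigenbasis

/-! ### From the energy expansion to the superfluid fraction. -/

section Fraction

local notation "⟪" x ", " y "⟫" => inner ℂ x y

theorem tendsto_of_quartic {E : ℝ → ℝ} {t : ℝ}
    (h : (fun v => E v - E 0 + t * v ^ 2) =O[𝓝 0] fun v => v ^ 4) :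
    Tendsto (fun v => (E v - E 0) / v ^ 2) (𝓝[≠] 0) (𝓝 (-t)) := by
  obtain ⟨C, hC⟩ := h.bound
  have h1 : Tendsto (fun v : ℝ => C * v ^ 2) (𝓝[≠] 0) (𝓝 0) := by
    have : Tendsto (fun v : ℝ => C * v ^ 2) (𝓝 0) (𝓝 (C * 0 ^ 2)) := by
      apply Continuous.tendsto
      fun_prop
    rw [zero_pow two_ne_zero, mul_zero] at this
    exact this.mono_left nhdsWithin_le_nhds
  rw [tendsto_iff_norm_sub_tendsto_zero]
  refine squeeze_zero' (Eventually.of_forall fun _ => norm_nonneg _) ?_ h1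
  filter_upwards [hC.filter_mono nhdsWithin_le_nhds, self_mem_nhdsWithin] with v hv hv0
  have hv0' : v ≠ 0 := hv0
  have h2 : (E v - E 0) / v ^ 2 - -t = (E v - E 0 + t * v ^ 2) / v ^ 2 := by
    field_simp
    ring
  rw [h2, norm_div, norm_pow, Real.norm_eq_abs v, sq_abs, div_le_iff₀ (by positivity)]
  rw [norm_pow, Real.norm_eq_abs v] at hv
  calc ‖E v - E 0 + t * v ^ 2‖ ≤ C * |v| ^ 4 := hv
    _ = C * v ^ 2 * v ^ 2 := by
      have : |v| ^ 4 = v ^ 4 := by rw [← abs_pow, abs_of_nonneg (by positivity)]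
      rw [this]; ring

theorem quadraticCoeff_eq {E : ℝ → ℝ} {t : ℝ}
    (h : (fun v => E v - E 0 + t * v ^ 2) =O[𝓝 0] fun v => v ^ 4) : quadraticCoeff E = -t :=
  (tendsto_of_quartic h).limUnder_eq

end Fraction

namespace JointEigenbasis

variable {N d : ℕ} {s : Statistics} {L m : ℝ} {w : (Fin d → ℝ) → ℝ} {g : ℝ}
  {hw : IsInteraction L w}

local notation "⟪" x ", " y "⟫" => inner ℂ x y

/-- The superfluid fraction in a weak potential, and its lower bound to second order. -/
theorem exists_fraction_bound (hL : 0 < L) (hm : 0 < m) (hN : 0 < N) (a : Fin d)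
    (B : JointEigenbasis s N d L m w)
    (hB : GappedGround (pert (sectorKinetic s N d L m) (sectorInteraction s N hw)) (B.groundVec hw)
      (B.energy B.ground) g) :
    ∃ M : ℝ, 0 ≤ M ∧ ∀ (u : (Fin d → ℝ) → ℝ) (b : ℝ) (hu : BddPotential u b) (κ ρ : ℝ), 0 ≤ ρ →
      (∀ x, |κ * u x| ≤ ρ) → 4 * (N * ρ) ≤ g →
      ((fun v => wallEnergy s N d L m w a u κ v - wallEnergy s N d L m w a u κ 0
        - quadraticCoeff (wallEnergy s N d L m w a u κ) * v ^ 2) =O[𝓝 0] fun v => v ^ 4) ∧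
      superfluidFraction s N d L m w a u κ ≤ 1 ∧
      1 - M * ρ ^ 2 ≤ superfluidFraction s N d L m w a u κ ∧
      ∀ (c : (Fin d → ℤ) → ℂ) (Δ : ℝ), B.IsOneBody (sectorPotential s N L hu) c →
        (∀ i, i ≠ B.ground → c (B.momentum i) ≠ 0 →
          0 < Δ ∧ Δ ≤ B.energy i - B.energy B.ground) →
        (Summable fun k => (waveVector L k a * ‖c k‖) ^ 2 * B.structureFactor k) →
        1 - 2 * κ ^ 2 / (m * Δ ^ 3) *
          ∑' k, (waveVector L k a * ‖c k‖) ^ 2 * B.structureFactor k - M * ρ ^ 3 ≤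
          superfluidFraction s N d L m w a u κ := by
  have hK := isKinetic_sectorKinetic (s := s) (N := N) (d := d) hL hm
  have hW := sectorInteraction_symm (s := s) (N := N) hw
  obtain ⟨M, hM, h⟩ := hB.exists_quadratic_expansion hK (isDrift_sectorMomentum hm a)
    (isReversal_sectorConj hm a) hW (fun x => sectorInteraction_conj hw x)
    (B.momentum_groundVec hL hm hB a)
  have hN' : (0 : ℝ) < N := by exact_mod_cast hN
  -- The factor `2/(Nm)` converts the energy coefficient; `N² + N³` accommodates both `(Nρ)²` and
  -- `(Nρ)³`.
  refine ⟨2 / (N * m) * (M * (N ^ 2 + N ^ 3)), by positivity, ?_⟩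
  intro u b hu κ ρ hρ hκ hg
  have hnorm := norm_smul_sectorPotential_le (s := s) (N := N) (L := L) hu hρ hκ
  set Y := (κ : ℂ) • sectorPotential s N L hu with hY
  have hYs : BddSymm Y := (sectorPotential_symm hu).real_smul κ
  have hYc : ∀ x, Y (sectorConj s N d x) = sectorConj s N d (Y x) := by
    intro x
    rw [hY, smul_apply, smul_apply, sectorPotential_conj,
      (isReversal_sectorConj (s := s) (N := N) (L := L) hm a).map_smul, Complex.conj_ofReal]
  obtain ⟨t, ht0, ht2, hquart, htr⟩ := h Y hYs hYc (by linarith)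
  have hE : ∀ v, infForm (pert (sectorKinetic s N d L m) (sectorInteraction s N hw + Y))
      (sectorMomentum s N d L m hm a) v = wallEnergy s N d L m w a u κ v := fun v =>
    (wallEnergy_eq_infForm hm hw hu a κ v).symm
  simp only [hE] at hquart
  have hq := quadraticCoeff_eq hquart
  have hsf : superfluidFraction s N d L m w a u κ = 1 - 2 / (N * m) * t := by
    rw [superfluidFraction, hq]
    ring
  have hY0 : 0 ≤ ‖Y‖ := ContinuousLinearMap.opNorm_nonneg Y
  refine ⟨?_, ?_, ?_, ?_⟩
  · rw [hq]
    simpa only [neg_mul, sub_neg_eq_add] using hquart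
  · rw [hsf]
    have : 0 ≤ 2 / (N * m) * t := by positivity
    linarith
  · rw [hsf]
    have h1 : t ≤ M * (N ^ 2 + N ^ 3) * ρ ^ 2 := by
      calc t ≤ M * ‖Y‖ ^ 2 := ht2
        _ ≤ M * (N * ρ) ^ 2 := by gcongr
        _ = M * (N ^ 2) * ρ ^ 2 := by ring
        _ ≤ M * (N ^ 2 + N ^ 3) * ρ ^ 2 := by gcongr; linarith [pow_pos hN' 3]
    have h2 : 2 / (N * m) * t ≤ 2 / (N * m) * (M * (N ^ 2 + N ^ 3) * ρ ^ 2) := by gcongr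
    linarith
  · intro c Δ hc hΔ hs
    have hc' : B.IsOneBody Y fun k => κ * c k := by
      intro i
      rw [hY, smul_apply, inner_smul_right, hc i, mul_assoc]
    have hterm : ∀ k, (waveVector L k a * ‖(κ : ℂ) * c k‖) ^ 2 * B.structureFactor k =
        κ ^ 2 * ((waveVector L k a * ‖c k‖) ^ 2 * B.structureFactor k) := by
      intro k
      rw [norm_mul, Complex.norm_real, Real.norm_eq_abs, mul_left_comm, mul_pow |κ|, sq_abs,
        mul_assoc]
    have hs' : Summable fun k => (waveVector L k a * ‖(κ : ℂ) * c k‖) ^ 2 * B.structureFactor k := by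
      simp only [hterm]
      exact hs.mul_left _
    obtain ⟨χ, ζ, hχ0, hχ, hζ0, hζ, hle⟩ := B.exists_response_le hL hm hN a hB hc' (Δ := Δ)
      (fun i hi hne => hΔ i hi (right_ne_zero_of_mul hne)) hs'
    have h1 := htr χ ζ hχ0 hχ hζ0 hζ
    simp only [hterm] at hle
    rw [tsum_mul_left] at hle
    set S₁ := ∑' k, (waveVector L k a * ‖c k‖) ^ 2 * B.structureFactor k
    have h2 : t ≤ 1 / Δ ^ 3 * (N * (κ ^ 2 * S₁)) + M * (N ^ 2 + N ^ 3) * ρ ^ 3 := by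
      refine h1.trans (add_le_add hle ?_)
      calc M * ‖Y‖ ^ 3 ≤ M * (N * ρ) ^ 3 := by gcongr
        _ = M * (N ^ 3) * ρ ^ 3 := by ring
        _ ≤ M * (N ^ 2 + N ^ 3) * ρ ^ 3 := by gcongr; linarith [pow_pos hN' 2]
    have h3 : 2 / (N * m) * t ≤ 2 / (N * m) * (1 / Δ ^ 3 * (N * (κ ^ 2 * S₁)) +
        M * (N ^ 2 + N ^ 3) * ρ ^ 3) := by gcongr
    have h4 : 2 / (N * m) * (1 / Δ ^ 3 * (N * (κ ^ 2 * S₁))) = 2 * κ ^ 2 / (m * Δ ^ 3) * S₁ := by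
      -- `Δ = 0` occurs when there is no relevant excitation; division by zero then makes both sides
      -- `0`, as the convention requires.
      rcases eq_or_ne Δ 0 with h0 | h0
      · simp [h0]
      · field_simp
    rw [hsf]
    rw [mul_add, h4] at h3
    linarith

end JointEigenbasis

/-! ### Fourier coefficients of `C¹` potentials. -/

section Smooth

variable {N d : ℕ} {s : Statistics} {L m : ℝ} {w u : (Fin d → ℝ) → ℝ}

local notation "⟪" x ", " y "⟫" => inner ℂ x y

theorem IsPotential.exists_bddPotential (hL : 0 < L) (hu : IsPotential L u) :
    ∃ b, BddPotential u b := by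
  obtain ⟨b, hb⟩ := hu.periodic.exists_bound hL hu.contDiff.continuous
  exact ⟨b, hu.contDiff.continuous.measurable, hb⟩

/-- A potential as a function on the torus. -/
def IsPotential.torus (hu : IsPotential L u) : C(UnitAddTorus (Fin d), ℂ) :=
  torusFun hu.contDiff.continuous hu.periodic

theorem IsPotential.torus_apply (hu : IsPotential L u) (y : UnitAddTorus (Fin d)) :
    hu.torus y = (u (boxPoint L y) : ℂ) := rfl

theorem IsPotential.torus_mk (hu : IsPotential L u) (t : Fin d → ℝ) :
    hu.torus (fun i => (t i : UnitAddCircle)) = (u fun i => L * t i : ℂ) := by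
  rw [hu.torus_apply, hu.periodic.boxPoint_mk]

theorem IsPotential.isOneBody (hL : 0 < L) (hu : IsPotential L u) {b : ℝ}
    (hb : BddPotential u b) (B : JointEigenbasis s N d L m w)
    (h0 : HasMomentum 0 (B.state B.ground)) :
    B.IsOneBody (sectorPotential s N L hb) fun k => torusCoeff k hu.torus := by
  intro i
  rw [← inner_oneBodyMul hL (B.hasMomentum hL i) h0,
    oneBodyMul_apply (hb.bddMeas N L) (fun y => by
      rw [oneBodyFun, Complex.ofReal_sum]
      rfl)]
  rfl

open scoped Pointwise in
/-- The Fourier transform of a potential in the box and its Fourier coefficients on the torus. -/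
theorem IsPotential.torusCoeff_eq (hL : 0 < L) (hu : IsPotential L u) (k : Fin d → ℤ) :
    torusCoeff k hu.torus = ((L ^ d : ℝ) : ℂ)⁻¹ * fourierPotential L u k := by
  rw [torusCoeff_eq_mFourierCoeff, UnitAddTorus.mFourierCoeff_eq_integral _ _ 0]
  have h1 : ∀ x : Fin d → ℝ, UnitAddTorus.mFourier (-k) (fun i => (x i : UnitAddCircle)) •
      hu.torus (fun i => (x i : UnitAddCircle)) =
      (fun z => (u z : ℂ) * cexpWave L (-k) z) (L • x) := by
    intro x
    have e : L • x = fun i => L * x i := rfl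
    rw [hu.torus_mk, ← cexpWave_mul hL, e, smul_eq_mul, mul_comm]
  simp only [h1]
  -- Rescaling the unit cube to the box gives the factor `L^{-d}`; half-open and closed boxes differ
  -- by a null set.
  rw [Measure.setIntegral_comp_smul_of_pos volume (fun z => (u z : ℂ) * cexpWave L (-k) z) _ hL,
    Module.finrank_fintype_fun_eq_card, Fintype.card_fin, fourierPotential]
  have h2 : L • {x : Fin d → ℝ | ∀ i, x i ∈ Set.Ioc ((0 : Fin d → ℝ) i) ((0 : Fin d → ℝ) i + 1)} =
      Set.pi Set.univ fun i => Set.Ioc ((0 : Fin d → ℝ) i) L := by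
    ext x
    rw [Set.mem_smul_set_iff_inv_smul_mem₀ hL.ne']
    simp only [Set.mem_ofPred_eq, Set.mem_pi, Set.mem_univ, true_imp_iff, Set.mem_Ioc,
      Pi.smul_apply, Pi.zero_apply, smul_eq_mul, zero_add]
    refine forall_congr' fun i => ?_
    rw [inv_mul_le_iff₀ hL, mul_one, mul_pos_iff_of_pos_left (inv_pos.2 hL)]
  rw [h2]
  have h3 : (Set.pi Set.univ fun i => Set.Ioc ((0 : Fin d → ℝ) i) L) =ᵐ[volume]
      Set.Icc (0 : Fin d → ℝ) (fun _ => L) :=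
    Measure.univ_pi_Ioc_ae_eq_Icc
  rw [setIntegral_congr_set h3, Complex.real_smul]
  push_cast
  rfl

/-- A potential is Lipschitz continuous along the coordinate axes. -/
theorem IsPotential.exists_lipschitz (hL : 0 < L) (hu : IsPotential L u) (a : Fin d) :
    ∃ M, 0 ≤ M ∧ ∀ (x : Fin d → ℝ) (t : ℝ), |u (x + Pi.single a t) - u x| ≤ M * |t| := by
  have hd : Differentiable ℝ u := hu.contDiff.differentiable one_ne_zero
  have hc : Continuous fun x => fderiv ℝ u x (Pi.single a 1) :=
    (hu.contDiff.continuous_fderiv one_ne_zero).clm_apply continuous_const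
  -- The derivative along the axis is continuous and again periodic, hence bounded by compactness;
  -- the bound is the Lipschitz constant.
  have hper : BoxPeriodic L fun x => fderiv ℝ u x (Pi.single a 1) := by
    intro x i
    have h1 : (fun z => u (z + Pi.single i L)) = u := funext fun z => hu.periodic z i
    have h2 := fderiv_comp_add_right (𝕜 := ℝ) (f := u) (x := x) (Pi.single i L : Fin d → ℝ)
    rw [h1] at h2
    simp only [h2]
  obtain ⟨M, hM⟩ := hper.exists_bound hL hc
  refine ⟨M, (abs_nonneg _).trans (hM 0), fun x t => ?_⟩
  have hderiv : ∀ r : ℝ, HasDerivAt (fun r : ℝ => u (x + r • Pi.single a 1))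
      (fderiv ℝ u (x + r • Pi.single a 1) (Pi.single a 1)) r := by
    intro r
    have h1 : HasDerivAt (fun r : ℝ => x + r • (Pi.single a 1 : Fin d → ℝ)) (Pi.single a 1) r := by
      simpa using ((hasDerivAt_id r).smul_const (Pi.single a 1 : Fin d → ℝ)).const_add x
    exact (hd _).hasFDerivAt.comp_hasDerivAt r h1
  have h2 := Convex.norm_image_sub_le_of_norm_hasDerivWithin_le (C := M) (s := Set.univ)
    (fun r _ => (hderiv r).hasDerivWithinAt) (fun r _ => hM _) convex_univ (Set.mem_univ 0)
    (Set.mem_univ t)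
  have h3 : (Pi.single a t : Fin d → ℝ) = t • Pi.single a 1 := by
    rw [← Pi.single_smul, smul_eq_mul, mul_one]
  rw [h3]
  simpa using h2

theorem mFourier_apply_add (q : Fin d → ℤ) (x x' : UnitAddTorus (Fin d)) :
    UnitAddTorus.mFourier q (x + x') = UnitAddTorus.mFourier q x * UnitAddTorus.mFourier q x' := by
  change ∏ i, fourier (q i) (x i + x' i) = (∏ i, fourier (q i) (x i)) * ∏ i, fourier (q i) (x' i)
  rw [← Finset.prod_mul_distrib]
  refine Finset.prod_congr rfl fun i _ => ?_
  rw [fourier_apply, fourier_apply, fourier_apply, smul_add, AddCircle.toCircle_add,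
    Circle.coe_mul]

/-- Translations of functions on the torus. -/
def torusShift (z : UnitAddTorus (Fin d)) :
    C(UnitAddTorus (Fin d), ℂ) →L[ℂ] C(UnitAddTorus (Fin d), ℂ) where
  toFun f := f.comp ⟨fun y => y + z, by fun_prop⟩
  map_add' _ _ := rfl
  map_smul' _ _ := rfl
  cont := ContinuousMap.continuous_precomp _

theorem torusCoeff_torusShift (k : Fin d → ℤ) (z : UnitAddTorus (Fin d))
    (f : C(UnitAddTorus (Fin d), ℂ)) :
    torusCoeff k (torusShift z f) = UnitAddTorus.mFourier k z * torusCoeff k f := by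
  have hE : torusCoeff k ∘L torusShift z = UnitAddTorus.mFourier k z • torusCoeff k := by
    refine ContinuousLinearMap.ext_on (s := Set.range (UnitAddTorus.mFourier (d := Fin d))) ?_ ?_
    · exact Submodule.dense_iff_topologicalClosure_eq_top.2
        (UnitAddTorus.span_mFourier_closure_eq_top (d := Fin d))
    · rintro _ ⟨q, rfl⟩
      have h : torusShift z (UnitAddTorus.mFourier q) =
          UnitAddTorus.mFourier q z • UnitAddTorus.mFourier q := by
        ext y
        exact (mFourier_apply_add q y z).trans (mul_comm _ _)
      change torusCoeff k (torusShift z (UnitAddTorus.mFourier q)) =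
        UnitAddTorus.mFourier k z * torusCoeff k (UnitAddTorus.mFourier q)
      rw [h, map_smul, torusCoeff_mFourier, smul_eq_mul]
      split_ifs with hkq
      · rw [hkq]
      · rw [mul_zero, mul_zero]
  exact DFunLike.congr_fun hE f

theorem mFourier_single (k : Fin d → ℤ) (a : Fin d) (h : ℝ) :
    UnitAddTorus.mFourier k (Pi.single a (h : UnitAddCircle)) =
      Complex.exp (2 * Real.pi * Complex.I * k a * h) := by
  change ∏ i, fourier (k i) ((Pi.single a (h : UnitAddCircle) : UnitAddTorus (Fin d)) i) = _
  rw [Finset.prod_eq_single a]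
  · rw [Pi.single_eq_same, fourier_coe_apply]
    simp
  · intro i _ hi
    rw [Pi.single_eq_of_ne hi, fourier_eval_zero]
  · simp

/-- The Fourier coefficients of the derivative of a potential are square summable. -/
theorem IsPotential.summable_sq (hL : 0 < L) (hu : IsPotential L u) (a : Fin d) :
    Summable fun k : Fin d → ℤ => (waveVector L k a * ‖torusCoeff k hu.torus‖) ^ 2 := by
  obtain ⟨M, hM, hlip⟩ := hu.exists_lipschitz hL a
  set f := hu.torus with hf
  have hsup : ∀ h : ℝ, ‖torusShift (Pi.single a (h : UnitAddCircle)) f - f‖ ≤ M * (L * |h|) := by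
    intro h
    rw [ContinuousMap.norm_le _ (by positivity)]
    intro y
    have hy : y = fun i => (((AddCircle.equivIco (1 : ℝ) 0 (y i) : ℝ)) : UnitAddCircle) := by
      funext i
      exact AddCircle.coe_equivIco.symm
    set t : Fin d → ℝ := fun i => (AddCircle.equivIco (1 : ℝ) 0 (y i) : ℝ) with ht
    have hy2 : y + Pi.single a (h : UnitAddCircle) =
        fun i => (((t + Pi.single a h : Fin d → ℝ) i : ℝ) : UnitAddCircle) := by
      funext i
      rw [Pi.add_apply, Pi.add_apply, AddCircle.coe_add]
      congr 1
      · exact congrFun hy i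
      · by_cases hi : i = a
        · subst hi
          rw [Pi.single_eq_same, Pi.single_eq_same]
        · rw [Pi.single_eq_of_ne hi, Pi.single_eq_of_ne hi]
          rfl
    change ‖f (y + Pi.single a (h : UnitAddCircle)) - f y‖ ≤ _
    have hy3 : f y = (u fun i => L * t i : ℂ) := (congrArg f hy).trans (hu.torus_mk t)
    rw [hy2, hy3, hf, hu.torus_mk, ← Complex.ofReal_sub, Complex.norm_real]
    have e : (fun i => L * (t + Pi.single a h : Fin d → ℝ) i) =
        (fun i => L * t i) + Pi.single a (L * h) := by
      funext i
      by_cases hi : i = a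
      · subst hi
        simp [mul_add]
      · simp [Pi.single_eq_of_ne hi]
    rw [e]
    refine (hlip _ _).trans (le_of_eq ?_)
    rw [abs_mul, abs_of_pos hL]
  set Q := ‖torusLp d‖ with hQ
  -- Bessel's inequality for the difference `f(· + h) - f`, whose coefficients are `(exp (2πi k_a h)
  -- - 1)` times those of `f` and whose size is of order `|h|`.
  have hbessel : ∀ (T : Finset (Fin d → ℤ)) (h : ℝ),
      ∑ k ∈ T, (‖Complex.exp (2 * Real.pi * Complex.I * k a * h) - 1‖ * ‖torusCoeff k f‖) ^ 2 ≤
        (Q * (M * (L * |h|))) ^ 2 := by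
    intro T h
    have h1 := HilbertBasis.hasSum_sq_norm (torusBasis d)
      (torusLp d (torusShift (Pi.single a (h : UnitAddCircle)) f - f))
    have h2 := sum_le_hasSum T (fun k _ => sq_nonneg _) h1
    have h3 : ∀ k, coeff (torusBasis d)
        (torusLp d (torusShift (Pi.single a (h : UnitAddCircle)) f - f)) k =
        (Complex.exp (2 * Real.pi * Complex.I * k a * h) - 1) * torusCoeff k f := by
      intro k
      rw [← torusCoeff_eq_coeff, map_sub, torusCoeff_torusShift, mFourier_single]
      ring
    simp only [h3, norm_mul] at h2
    refine h2.trans ?_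
    gcongr
    exact ((torusLp d).le_opNorm _).trans (mul_le_mul_of_nonneg_left (hsup h) (norm_nonneg _))
  -- Dividing by `h²` and letting `h → 0` in a finite sum yields a bound uniform in `T`, without
  -- computing Fourier coefficients of the derivative.
  have hlim : ∀ (T : Finset (Fin d → ℤ)),
      ∑ k ∈ T, (2 * Real.pi * |(k a : ℝ)| * ‖torusCoeff k f‖) ^ 2 ≤ (Q * (M * L)) ^ 2 := by
    intro T
    have h1 : Tendsto (fun h : ℝ => ∑ k ∈ T,
        (‖h⁻¹ • (Complex.exp (2 * Real.pi * Complex.I * k a * h) - 1)‖ * ‖torusCoeff k f‖) ^ 2)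
        (𝓝[≠] 0) (𝓝 (∑ k ∈ T, (2 * Real.pi * |(k a : ℝ)| * ‖torusCoeff k f‖) ^ 2)) := by
      refine tendsto_finsetSum _ fun k _ => ?_
      have h2 : HasDerivAt (fun h : ℝ => Complex.exp (2 * Real.pi * Complex.I * k a * h))
          (2 * Real.pi * Complex.I * k a) 0 := by
        have h3 : HasDerivAt (fun h : ℝ => 2 * Real.pi * Complex.I * k a * (h : ℂ))
            (2 * Real.pi * Complex.I * k a) 0 := by
          simpa using (Complex.ofRealCLM.hasDerivAt (x := (0 : ℝ))).const_mul
            (2 * Real.pi * Complex.I * k a)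
        simpa using h3.cexp
      rw [hasDerivAt_iff_tendsto_slope_zero] at h2
      have h4 := ((h2.norm).mul_const ‖torusCoeff k f‖).pow 2
      have e : ‖(2 * Real.pi * Complex.I * k a : ℂ)‖ = 2 * Real.pi * |(k a : ℝ)| := by
        simp [abs_of_pos Real.pi_pos]
      rw [e] at h4
      refine h4.congr fun h => ?_
      simp
    refine le_of_tendsto h1 ?_
    filter_upwards [self_mem_nhdsWithin] with h hh
    have hh' : h ≠ 0 := hh
    have h5 := hbessel T h
    have h6 : 0 < h ^ 2 := by positivity
    have h7 : ∑ k ∈ T, (‖h⁻¹ • (Complex.exp (2 * Real.pi * Complex.I * k a * h) - 1)‖ *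
        ‖torusCoeff k f‖) ^ 2 = (h ^ 2)⁻¹ * ∑ k ∈ T,
        (‖Complex.exp (2 * Real.pi * Complex.I * k a * h) - 1‖ * ‖torusCoeff k f‖) ^ 2 := by
      rw [Finset.mul_sum]
      refine Finset.sum_congr rfl fun k _ => ?_
      rw [norm_smul, mul_pow, mul_pow, mul_pow, norm_inv, Real.norm_eq_abs, inv_pow, sq_abs]
      ring
    rw [h7, inv_mul_le_iff₀ h6]
    refine h5.trans (le_of_eq ?_)
    calc (Q * (M * (L * |h|))) ^ 2 = |h| ^ 2 * (Q * (M * L)) ^ 2 := by ring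
      _ = _ := by rw [sq_abs]
  have hs : Summable fun k : Fin d → ℤ => (2 * Real.pi * |(k a : ℝ)| * ‖torusCoeff k f‖) ^ 2 :=
    summable_of_sum_le (fun _ => sq_nonneg _) hlim
  refine (hs.mul_left ((1 / L) ^ 2)).congr fun k => ?_
  rw [waveVector, mul_pow, mul_pow, mul_pow, sq_abs]
  ring

end Smooth

/-! ### Lower bounds for general potentials. -/

section FractionBound

variable {N d : ℕ} {s : Statistics} {L m : ℝ} {w u : (Fin d → ℝ) → ℝ} {g : ℝ}
  {hw : IsInteraction L w}

local notation "⟪" x ", " y "⟫" => inner ℂ x y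

theorem IsPotential.norm_torusCoeff (hL : 0 < L) (hu : IsPotential L u) (k : Fin d → ℤ) :
    ‖torusCoeff k hu.torus‖ = ‖fourierPotential L u k‖ / L ^ d := by
  rw [hu.torusCoeff_eq hL, norm_mul, norm_inv, Complex.norm_real,
    Real.norm_of_nonneg (by positivity), inv_mul_eq_div]

namespace JointEigenbasis

theorem summable_structureFactor (hL : 0 < L) (hN : 0 < N) (B : JointEigenbasis s N d L m w)
    (h0 : HasMomentum 0 (B.state B.ground)) (hu : IsPotential L u) (a : Fin d) :
    Summable fun k => (waveVector L k a * ‖torusCoeff k hu.torus‖) ^ 2 * B.structureFactor k := by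
  refine Summable.of_nonneg_of_le
    (fun k => mul_nonneg (sq_nonneg _) (B.structureFactor_nonneg k)) (fun k => ?_)
    ((hu.summable_sq hL a).mul_right (N : ℝ))
  exact mul_le_mul_of_nonneg_left (B.structureFactor_le hL hN h0 k) (sq_nonneg _)

/-- Supplies the hypothesis on `Δ` in `FractionBound`; the member `i` itself witnesses that there is
an excitation. -/
theorem gap_support (B : JointEigenbasis s N d L m w)
    (hB : GappedGround (pert (sectorKinetic s N d L m) (sectorInteraction s N hw)) (B.groundVec hw)
      (B.energy B.ground) g) {K : Set (Fin d → ℤ)} {i : B.ι} (hi : i ≠ B.ground)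
    (hK : B.momentum i ∈ K) : 0 < B.gap K ∧ B.gap K ≤ B.energy i - B.energy B.ground :=
  ⟨B.gap_pos hB ⟨_, i, hi, hK, rfl⟩, B.gap_le hi hK⟩

/-- Without excitations the gap is `sInf ∅ = 0`. -/
theorem gap_nonneg (B : JointEigenbasis s N d L m w)
    (hB : GappedGround (pert (sectorKinetic s N d L m) (sectorInteraction s N hw)) (B.groundVec hw)
      (B.energy B.ground) g) (K : Set (Fin d → ℤ)) : 0 ≤ B.gap K := by
  rcases (B.excitations K).eq_empty_or_nonempty with h | h
  · rw [gap, h, Real.sInf_empty]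
  · exact (B.gap_pos hB h).le

/-- The conclusion of the second order perturbation theory for the superfluid fraction in smooth
potentials, with error constant `M` and range of validity `g`. -/
def FractionBound (B : JointEigenbasis s N d L m w) (a : Fin d) (g M : ℝ) : Prop :=
  ∀ u, ∀ hu : IsPotential L u, ∀ κ ρ : ℝ, 0 ≤ ρ → (∀ x, |κ * u x| ≤ ρ) → 4 * (N * ρ) ≤ g →
    ((fun v => wallEnergy s N d L m w a u κ v - wallEnergy s N d L m w a u κ 0
      - quadraticCoeff (wallEnergy s N d L m w a u κ) * v ^ 2) =O[𝓝 0] fun v => v ^ 4) ∧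
    superfluidFraction s N d L m w a u κ ≤ 1 ∧
    1 - M * ρ ^ 2 ≤ superfluidFraction s N d L m w a u κ ∧
    ∀ Δ : ℝ, (∀ i, i ≠ B.ground → torusCoeff (B.momentum i) hu.torus ≠ 0 →
        0 < Δ ∧ Δ ≤ B.energy i - B.energy B.ground) →
      1 - 2 * κ ^ 2 / (m * Δ ^ 3) *
        ∑' k, (waveVector L k a * ‖torusCoeff k hu.torus‖) ^ 2 * B.structureFactor k
        - M * ρ ^ 3 ≤ superfluidFraction s N d L m w a u κ

theorem exists_fractionBound (hL : 0 < L) (hm : 0 < m) (hN : 0 < N) (a : Fin d)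
    (B : JointEigenbasis s N d L m w)
    (hB : GappedGround (pert (sectorKinetic s N d L m) (sectorInteraction s N hw)) (B.groundVec hw)
      (B.energy B.ground) g) : ∃ M, 0 ≤ M ∧ B.FractionBound a g M := by
  obtain ⟨M, hM, h⟩ := B.exists_fraction_bound hL hm hN a hB
  refine ⟨M, hM, fun u hu κ ρ hρ hκ hg => ?_⟩
  obtain ⟨b, hb⟩ := hu.exists_bddPotential hL
  obtain ⟨h1, h2, h3, h4⟩ := h u b hb κ ρ hρ hκ hg
  have h0 := B.hasMomentum_ground hL hm hB
  exact ⟨h1, h2, h3, fun Δ hΔ => h4 _ Δ (hu.isOneBody hL hb B h0) hΔ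
    (B.summable_structureFactor hL hN h0 hu a)⟩

theorem FractionBound.eventually {B : JointEigenbasis s N d L m w} {a : Fin d} {M : ℝ}
    (hg : 0 < g) (hM : B.FractionBound a g M) (hL : 0 < L) (hu : IsPotential L u) :
    ∃ b, 0 ≤ b ∧ ∀ᶠ κ in 𝓝 (0 : ℝ), superfluidFraction s N d L m w a u κ ≤ 1 ∧
      1 - M * (|κ| * b) ^ 2 ≤ superfluidFraction s N d L m w a u κ ∧
      ∀ Δ : ℝ, (∀ i, i ≠ B.ground → torusCoeff (B.momentum i) hu.torus ≠ 0 →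
        0 < Δ ∧ Δ ≤ B.energy i - B.energy B.ground) →
      1 - 2 * κ ^ 2 / (m * Δ ^ 3) *
        ∑' k, (waveVector L k a * ‖torusCoeff k hu.torus‖) ^ 2 * B.structureFactor k
        - M * (|κ| * b) ^ 3 ≤ superfluidFraction s N d L m w a u κ := by
  obtain ⟨b, hb⟩ := hu.exists_bddPotential hL
  have hb0 : 0 ≤ b := (abs_nonneg _).trans (hb.bound 0)
  refine ⟨b, hb0, ?_⟩
  have ht : Tendsto (fun κ : ℝ => 4 * (N * (|κ| * b))) (𝓝 0) (𝓝 (4 * (N * (|(0 : ℝ)| * b)))) := by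
    apply Continuous.tendsto
    fun_prop
  rw [abs_zero, zero_mul, mul_zero, mul_zero] at ht
  filter_upwards [ht.eventually_le_const hg] with κ hκ
  refine (hM u hu κ (|κ| * b) (by positivity) (fun x => ?_) hκ).2
  rw [abs_mul]
  exact mul_le_mul_of_nonneg_left (hb.bound x) (abs_nonneg _)

theorem FractionBound.tendsto {B : JointEigenbasis s N d L m w} {a : Fin d} {M : ℝ}
    (hg : 0 < g) (hM : B.FractionBound a g M) (hL : 0 < L) (hu : IsPotential L u) :
    Tendsto (superfluidFraction s N d L m w a u) (𝓝 0) (𝓝 1) := by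
  obtain ⟨b, hb0, hb⟩ := hM.eventually hg hL hu
  have ht : Tendsto (fun κ : ℝ => 1 - M * (|κ| * b) ^ 2) (𝓝 0)
      (𝓝 (1 - M * (|(0 : ℝ)| * b) ^ 2)) := by
    apply Continuous.tendsto
    fun_prop
  rw [abs_zero, zero_mul, zero_pow two_ne_zero, mul_zero, sub_zero] at ht
  exact tendsto_of_tendsto_of_tendsto_of_le_of_le' ht tendsto_const_nhds
    (hb.mono fun _ h => h.2.1) (hb.mono fun _ h => h.1)

/-- The lower bound for a general potential. -/
theorem FractionBound.general {B : JointEigenbasis s N d L m w} {a : Fin d} {M : ℝ}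
    (hM : B.FractionBound a g M) (hL : 0 < L) (hN : 0 < N) (hm : 0 < m)
    (hB : GappedGround (pert (sectorKinetic s N d L m) (sectorInteraction s N hw)) (B.groundVec hw)
      (B.energy B.ground) g) (hu : IsPotential L u) :
    (Summable fun k : Fin d → ℤ =>
      (waveVector L k a * ‖fourierPotential L u k‖ / L ^ d) ^ 2 * B.structureFactor k) ∧
    (∃ C, ∀ᶠ κ in 𝓝 (0 : ℝ), superfluidFraction s N d L m w a u κ ≥
      1 - 2 * κ ^ 2 / (m * B.gap (Function.support (fourierPotential L u)) ^ 3)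
        * ∑' k : Fin d → ℤ, (waveVector L k a * ‖fourierPotential L u k‖ / L ^ d) ^ 2
          * B.structureFactor k - C * |κ| ^ 3) := by
  have h1 : ∀ k : Fin d → ℤ, waveVector L k a * ‖fourierPotential L u k‖ / L ^ d =
      waveVector L k a * ‖torusCoeff k hu.torus‖ := fun k => by
    rw [hu.norm_torusCoeff hL, mul_div_assoc]
  simp only [h1]
  refine ⟨B.summable_structureFactor hL hN (B.hasMomentum_ground hL hm hB) hu a, ?_⟩
  obtain ⟨b, hb0, hb⟩ := hM.eventually hB.gap_pos hL hu
  refine ⟨M * b ^ 3, ?_⟩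
  filter_upwards [hb] with κ hκ
  have h2 := hκ.2.2 (B.gap (Function.support (fourierPotential L u))) fun i hi hne =>
    B.gap_support hB hi fun h0 => hne (by rw [hu.torusCoeff_eq hL, h0, mul_zero])
  rw [mul_pow] at h2
  rw [ge_iff_le]
  refine le_trans (le_of_eq ?_) h2
  ring

end JointEigenbasis

/-! ### Lower bound for a periodic potential. -/

section Cosine

theorem cexpWave_re (L : ℝ) (p : Fin d → ℤ) (x : Fin d → ℝ) :
    (cexpWave L p x).re = Real.cos (∑ i, waveVector L p i * x i) := by
  rw [cexpWave, mul_comm, Complex.exp_mul_I, Complex.add_re, ← Complex.ofReal_cos,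
    ← Complex.ofReal_sin, Complex.ofReal_re, Complex.re_ofReal_mul, Complex.I_re, mul_zero,
    add_zero]

theorem contDiff_cexpWave (L : ℝ) (p : Fin d → ℤ) : ContDiff ℝ 1 (cexpWave L p) := by
  unfold cexpWave
  have h1 : ContDiff ℝ 1 fun x : Fin d → ℝ => ∑ i, waveVector L p i * x i := by fun_prop
  exact (contDiff_const.mul (Complex.ofRealCLM.contDiff.comp h1)).cexp

theorem cexpWave_periodic (hL : 0 < L) (p : Fin d → ℤ) (x : Fin d → ℝ) (i : Fin d) :
    cexpWave L p (x + Pi.single i L) = cexpWave L p x := by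
  have h1 : ∀ z : Fin d → ℝ, cexpWave L p z =
      UnitAddTorus.mFourier p fun j => ((z j / L : ℝ) : UnitAddCircle) := by
    intro z
    rw [← cexpWave_mul hL]
    congr 1
    funext j
    field_simp
  rw [h1, h1]
  congr 1
  funext j
  by_cases hj : j = i
  · subst hj
    rw [Pi.add_apply, Pi.single_eq_same, add_div, div_self hL.ne', AddCircle.coe_add_period]
  · rw [Pi.add_apply, Pi.single_eq_of_ne hj, add_zero]

theorem isPotential_trigPotential (hL : 0 < L) (F : Finset (Fin d → ℤ))
    (c : (Fin d → ℤ) → ℂ) : IsPotential L (trigPotential L F c) where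
  contDiff := by
    unfold trigPotential
    have h1 : ContDiff ℝ 1 fun x : Fin d → ℝ =>
        1 / ((L ^ d : ℝ) : ℂ) * ∑ k ∈ F, c k * cexpWave L k x :=
      contDiff_const.mul (ContDiff.sum fun k _ => contDiff_const.mul (contDiff_cexpWave L k))
    exact Complex.reCLM.contDiff.comp h1
  periodic := by
    intro x i
    simp only [trigPotential, cexpWave_periodic hL]

theorem isPotential_cos (hL : 0 < L) (u₀ : ℝ) (p : Fin d → ℤ) :
    IsPotential L fun x => u₀ * Real.cos (∑ i, waveVector L p i * x i) where
  contDiff := by fun_prop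
  periodic := by
    intro x i
    simp only [← cexpWave_re, cexpWave_periodic hL]

theorem torusCoeff_cos (hL : 0 < L) (u₀ : ℝ) (p k : Fin d → ℤ) :
    torusCoeff k (isPotential_cos hL u₀ p).torus =
      (u₀ / 2 : ℂ) * ((if k = p then 1 else 0) + if k = -p then 1 else 0) := by
  have h : (isPotential_cos hL u₀ p).torus =
      (u₀ / 2 : ℂ) • (UnitAddTorus.mFourier p + UnitAddTorus.mFourier (-p)) := by
    ext y
    rw [IsPotential.torus_apply, ← cexpWave_re, ContinuousMap.smul_apply, ContinuousMap.add_apply,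
      ← cexpWave_boxPoint hL, ← cexpWave_boxPoint hL, cexpWave_neg, Complex.add_conj]
    push_cast
    rw [smul_eq_mul]
    ring
  rw [h, map_smul, map_add, torusCoeff_mFourier, torusCoeff_mFourier, smul_eq_mul]

/-- The lower bound for a periodic potential. -/
theorem JointEigenbasis.FractionBound.cos {B : JointEigenbasis s N d L m w} {a : Fin d} {M : ℝ}
    (hM : B.FractionBound a g M) (hL : 0 < L) (hm : 0 < m)
    (hB : GappedGround (pert (sectorKinetic s N d L m) (sectorInteraction s N hw)) (B.groundVec hw)
      (B.energy B.ground) g) (u₀ : ℝ) (p : Fin d → ℤ) :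
    ∃ C, ∀ᶠ κ in 𝓝 (0 : ℝ), superfluidFraction s N d L m w a
      (fun x => u₀ * Real.cos (∑ i, waveVector L p i * x i)) κ ≥
        1 - (waveVector L p a * u₀ * κ) ^ 2 / (m * B.gap {p} ^ 3) * B.structureFactor p
          - C * |κ| ^ 3 := by
  have hu := isPotential_cos hL u₀ p
  have h0 := B.hasMomentum_ground hL hm hB
  obtain ⟨b, hb0, hb⟩ := hM.eventually hB.gap_pos hL hu
  -- The coefficients `u₀/2` at `p` and `-p` contribute equally, the structure factor being even:
  -- twice a quarter is one half.
  have hsum : ∑' k, (waveVector L k a * ‖torusCoeff k hu.torus‖) ^ 2 * B.structureFactor k =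
      (waveVector L p a * u₀) ^ 2 / 2 * B.structureFactor p := by
    have hc : ∀ k, torusCoeff k hu.torus =
      (u₀ / 2 : ℂ) * ((if k = p then 1 else 0) + if k = -p then 1 else 0) := torusCoeff_cos hL u₀ p
    rw [tsum_eq_sum (s := {p, -p})]
    -- Over `ℤ` this happens only for `p = 0`, where the momentum factor annihilates both sides.
    · by_cases hp : p = -p
      · have hp0 : p = 0 := by
          funext i
          have := congrFun hp i
          simp only [Pi.neg_apply] at this
          simp only [Pi.zero_apply]
          omega
        subst hp0
        simp [waveVector]
      · rw [Finset.sum_pair hp, hc, hc, B.structureFactor_neg hL h0, if_pos rfl, if_neg hp,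
          if_pos rfl, if_neg (fun h => hp h.symm)]
        have h2 : waveVector L (-p) a = -waveVector L p a := by simp [waveVector]
        rw [h2, add_zero, zero_add, mul_one, norm_div, Complex.norm_real, Real.norm_eq_abs,
          Complex.norm_ofNat, mul_pow, mul_pow, neg_sq, div_pow, sq_abs]
        ring
    · intro k hk
      simp only [Finset.mem_insert, Finset.mem_singleton, not_or] at hk
      rw [hc, if_neg hk.1, if_neg hk.2]
      simp
  refine ⟨M * b ^ 3, ?_⟩
  filter_upwards [hb] with κ hκ
  have h2 := hκ.2.2 (B.gap {p}) fun i hi hne => by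
    rw [torusCoeff_cos hL] at hne
    by_cases h1 : B.momentum i = p
    · exact B.gap_support hB hi h1
    -- A member of momentum `-p` has a time reversed partner at `p` with the same energy, so the gap
    -- at `p` alone suffices.
    by_cases h2 : B.momentum i = -p
    · obtain ⟨j, hj1, hj2⟩ := B.exists_index_neg hL hm hw a i
      rw [h2, neg_neg] at hj2
      have hj : j ≠ B.ground := by
        rintro rfl
        have := B.add_gap_le_energy hB hi
        linarith [hB.gap_pos]
      rw [← hj1]
      exact B.gap_support hB hj hj2
    · rw [if_neg h1, if_neg h2] at hne
      simp at hne
  rw [hsum, mul_pow |κ|] at h2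
  rw [ge_iff_le]
  refine le_trans (le_of_eq ?_) h2
  ring

end Cosine

end FractionBound

/-! ### Averaged lower bound for random potentials. -/

section Random

variable {N d : ℕ} {s : Statistics} {L m : ℝ} {w u : (Fin d → ℝ) → ℝ} {g : ℝ}
  {hw : IsInteraction L w}

local notation "⟪" x ", " y "⟫" => inner ℂ x y

theorem norm_trig_le (hL : 0 < L) (F : Finset (Fin d → ℤ)) (c : (Fin d → ℤ) → ℂ)
    (x : Fin d → ℝ) : |trigPotential L F c x| ≤ 1 / L ^ d * ∑ k ∈ F, ‖c k‖ := by
  refine (Complex.abs_re_le_norm _).trans ?_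
  rw [norm_mul, norm_div, norm_one, Complex.norm_real, Real.norm_of_nonneg (by positivity)]
  gcongr
  refine (norm_sum_le _ _).trans (Finset.sum_le_sum fun k _ => ?_)
  rw [norm_mul, norm_cexpWave, mul_one]

theorem trigPotential_sub (F : Finset (Fin d → ℤ)) (c c' : (Fin d → ℤ) → ℂ) (x : Fin d → ℝ) :
    trigPotential L F c x - trigPotential L F c' x = trigPotential L F (c - c') x := by
  rw [trigPotential, trigPotential, trigPotential, ← Complex.sub_re, ← mul_sub,
    ← Finset.sum_sub_distrib]
  simp only [Pi.sub_apply, sub_mul]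

theorem torusCoeff_trig (hL : 0 < L) (F : Finset (Fin d → ℤ)) (hF : ∀ k ∈ F, -k ∈ F)
    (c : (Fin d → ℤ) → ℂ) (hc : ∀ k ∈ F, c (-k) = (starRingEnd ℂ) (c k)) (k : Fin d → ℤ) :
    torusCoeff k (isPotential_trigPotential hL F c).torus =
      if k ∈ F then c k / ((L ^ d : ℝ) : ℂ) else 0 := by
  have h : (isPotential_trigPotential hL F c).torus =
      ∑ q ∈ F, (c q / ((L ^ d : ℝ) : ℂ)) • UnitAddTorus.mFourier q := by
    ext y
    rw [IsPotential.torus_apply, ContinuousMap.sum_apply, trigPotential]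
    set z := 1 / ((L ^ d : ℝ) : ℂ) * ∑ k ∈ F, c k * cexpWave L k (boxPoint L y) with hz
    -- Exchanging `k` and `-k` shows that the sum is real, so the real part in `trigPotential`
    -- discards nothing.
    have h1 : (starRingEnd ℂ) z = z := by
      rw [hz, map_mul, map_div₀, map_one, Complex.conj_ofReal, map_sum]
      congr 1
      refine Finset.sum_nbij' (fun k => -k) (fun k => -k) hF hF (fun k _ => neg_neg k)
        (fun k _ => neg_neg k) fun k hk => ?_
      rw [map_mul, cexpWave_neg, hc k hk]
    rw [Complex.conj_eq_iff_re.1 h1, hz, Finset.mul_sum]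
    refine Finset.sum_congr rfl fun q _ => ?_
    rw [ContinuousMap.smul_apply, ← cexpWave_boxPoint hL, smul_eq_mul]
    ring
  rw [h, map_sum]
  simp only [map_smul, torusCoeff_mFourier, smul_eq_mul, mul_ite, mul_one, mul_zero]
  rw [Finset.sum_ite_eq]

/-- No smallness of `κ u` is required, so the energies are measurable on the whole sample space. -/
theorem abs_wallEnergy_sub_le (hL : 0 < L) (hm : 0 < m) (hw : IsInteraction L w)
    (B : JointEigenbasis s N d L m w) (a : Fin d) {u u' : (Fin d → ℝ) → ℝ} {b b' δ : ℝ}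
    (hu : BddPotential u b) (hu' : BddPotential u' b') (h : ∀ x, |u x - u' x| ≤ δ) (κ v : ℝ) :
    |wallEnergy s N d L m w a u κ v - wallEnergy s N d L m w a u' κ v| ≤ |κ| * (N * δ) := by
  rw [wallEnergy_eq_infForm hm hw hu, wallEnergy_eq_infForm hm hw hu']
  refine (abs_infForm_sub_le (isKinetic_sectorKinetic hL hm) (isDrift_sectorMomentum hm a)
    ⟨B.groundVec hw, B.orthonormal_vec.1 B.ground⟩ _ _ v).trans ?_
  have hd : BddPotential (fun x => u x - u' x) δ := ⟨hu.measurable.sub hu'.measurable, h⟩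
  have h1 : ∀ x, sectorPotential s N L hu x - sectorPotential s N L hu' x =
      sectorPotential s N L hd x := by
    intro x
    refine Subtype.ext ?_
    change mulCLM (hu.bddMeas N L) (x : Wave N d) - mulCLM (hu'.bddMeas N L) (x : Wave N d) =
      mulCLM (hd.bddMeas N L) (x : Wave N d)
    apply Lp.ext
    filter_upwards [mulCLM_ae (hu.bddMeas N L) (x : Wave N d),
      mulCLM_ae (hu'.bddMeas N L) (x : Wave N d), mulCLM_ae (hd.bddMeas N L) (x : Wave N d),
      Lp.coeFn_sub (mulCLM (hu.bddMeas N L) (x : Wave N d))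
        (mulCLM (hu'.bddMeas N L) (x : Wave N d))] with y h1 h2 h3 h4
    rw [h4, Pi.sub_apply, h1, h2, h3, ← sub_mul]
    congr 1
    simp only [oneBodyFun, Finset.sum_sub_distrib]
    push_cast
    rfl
  have h2 : sectorInteraction s N hw + (κ : ℂ) • sectorPotential s N L hu -
      (sectorInteraction s N hw + (κ : ℂ) • sectorPotential s N L hu') =
      (κ : ℂ) • sectorPotential s N L hd := by
    rw [add_sub_add_left_eq_sub]
    ext1 x
    rw [sub_apply, smul_apply, smul_apply, smul_apply, ← h1, smul_sub]
  rw [h2]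
  refine (ContinuousLinearMap.opNorm_smul_le _ _).trans ?_
  rw [Complex.norm_real, Real.norm_eq_abs]
  exact mul_le_mul_of_nonneg_left (norm_sectorPotential_le hd) (abs_nonneg κ)

/-- The energy depends continuously on the Fourier coefficients of the potential. -/
theorem continuous_wallEnergy_trig (hL : 0 < L) (hm : 0 < m) (hw : IsInteraction L w)
    (B : JointEigenbasis s N d L m w) (a : Fin d) (F : Finset (Fin d → ℤ)) (κ v : ℝ) :
    Continuous fun c : (Fin d → ℤ) → ℂ => wallEnergy s N d L m w a (trigPotential L F c) κ v := by
  rw [continuous_iff_continuousAt]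
  intro c
  rw [ContinuousAt, tendsto_iff_norm_sub_tendsto_zero]
  have hb : ∀ c, BddPotential (trigPotential L F c) (1 / L ^ d * ∑ k ∈ F, ‖c k‖) := fun c =>
    ⟨(isPotential_trigPotential hL F c).contDiff.continuous.measurable, norm_trig_le hL F c⟩
  have ht : Tendsto (fun c' : (Fin d → ℤ) → ℂ =>
      |κ| * (N * (1 / L ^ d * ∑ k ∈ F, ‖(c' - c) k‖))) (𝓝 c)
      (𝓝 (|κ| * (N * (1 / L ^ d * ∑ k ∈ F, ‖(c - c) k‖)))) := by
    apply Continuous.tendsto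
    fun_prop
  have h0 : |κ| * (N * (1 / L ^ d * ∑ k ∈ F, ‖(c - c) k‖)) = 0 := by simp
  rw [h0] at ht
  refine squeeze_zero (fun _ => norm_nonneg _) (fun c' => ?_) ht
  refine abs_wallEnergy_sub_le hL hm hw B a (hb c') (hb c) (fun x => ?_) κ v
  rw [trigPotential_sub]
  exact norm_trig_le hL F _ x

theorem tsum_trig (hL : 0 < L) (B : JointEigenbasis s N d L m w) (a : Fin d)
    (F : Finset (Fin d → ℤ)) (hF : ∀ k ∈ F, -k ∈ F)
    (c : (Fin d → ℤ) → ℂ) (hc : ∀ k ∈ F, c (-k) = (starRingEnd ℂ) (c k)) :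
    ∑' k, (waveVector L k a * ‖torusCoeff k (isPotential_trigPotential hL F c).torus‖) ^ 2 *
      B.structureFactor k =
      ∑ k ∈ F, (waveVector L k a ^ 2 * B.structureFactor k / (L ^ d) ^ 2) * ‖c k‖ ^ 2 := by
  rw [tsum_eq_sum (s := F)]
  · refine Finset.sum_congr rfl fun k hk => ?_
    rw [torusCoeff_trig hL F hF c hc, if_pos hk, norm_div, Complex.norm_real,
      Real.norm_of_nonneg (by positivity)]
    ring
  · intro k hk
    rw [torusCoeff_trig hL F hF c hc, if_neg hk]
    simp

/-! ### Moments of the Fourier coefficients. -/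

section Moments

variable {Γ : Type*} {ξ : (Fin d → ℤ) → Γ → ℂ}

/-- The sum of the moduli of the Fourier coefficients. -/
def coeffSum (L : ℝ) (F : Finset (Fin d → ℤ)) (ξ : (Fin d → ℤ) → Γ → ℂ) (ω : Γ) : ℝ :=
  1 / L ^ d * ∑ k ∈ F, ‖ξ k ω‖

theorem coeffSum_nonneg (hL : 0 < L) (F : Finset (Fin d → ℤ)) (ω : Γ) :
    0 ≤ coeffSum L F ξ ω :=
  mul_nonneg (by positivity) (Finset.sum_nonneg fun _ _ => norm_nonneg _)

variable [MeasurableSpace Γ] {μ : Measure Γ} {V γ : ℝ}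

theorem IsDeltaCorrelated.integrable_sq [IsProbabilityMeasure μ]
    (hξ : IsDeltaCorrelated μ V γ ξ) (k : Fin d → ℤ) :
    Integrable (fun ω => ‖ξ k ω‖ ^ 2) μ :=
  ((hξ.memLp k).norm.mono_exponent (by norm_num : (2 : ENNReal) ≤ 3)).integrable_sq

/-- The covariance of `k` with `-k` is the second moment because the potential is real. -/
theorem IsDeltaCorrelated.integral_sq (hξ : IsDeltaCorrelated μ V γ ξ) (k : Fin d → ℤ) :
    ∫ ω, ‖ξ k ω‖ ^ 2 ∂μ = γ ^ 2 * V := by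
  have h1 := hξ.cov k (-k)
  rw [if_pos (add_neg_cancel k)] at h1
  have h2 : ∫ ω, ξ k ω * ξ (-k) ω ∂μ = ∫ ω, ((‖ξ k ω‖ ^ 2 : ℝ) : ℂ) ∂μ := by
    refine integral_congr_ae ?_
    filter_upwards [hξ.conj k] with ω hω
    rw [hω, Complex.mul_conj, Complex.normSq_eq_norm_sq]
  rw [h2, integral_complex_ofReal] at h1
  exact_mod_cast h1

theorem IsDeltaCorrelated.memLp_coeffSum (hξ : IsDeltaCorrelated μ V γ ξ) (L : ℝ)
    (F : Finset (Fin d → ℤ)) : MemLp (coeffSum L F ξ) 3 μ :=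
  (memLp_finsetSum F fun k _ => (hξ.memLp k).norm).const_mul _

theorem IsDeltaCorrelated.integrable_cube [IsProbabilityMeasure μ]
    (hξ : IsDeltaCorrelated μ V γ ξ) (hL : 0 < L)
    (F : Finset (Fin d → ℤ)) : Integrable (fun ω => coeffSum L F ξ ω ^ 3) μ := by
  have h1 : MemLp (coeffSum L F ξ) ((3 : ℕ) : ENNReal) μ := by
    exact_mod_cast hξ.memLp_coeffSum L F
  refine (h1.integrable_norm_pow three_ne_zero).congr (ae_of_all _ fun ω => ?_)
  simp only [Real.norm_of_nonneg (coeffSum_nonneg hL F ω)]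

/-- Markov's inequality for the third power, which makes the exceptional probability as small as the
perturbative error. -/
theorem IsDeltaCorrelated.measure_smallEvent_compl_le [IsProbabilityMeasure μ]
    (hξ : IsDeltaCorrelated μ V γ ξ)
    (hL : 0 < L) (F : Finset (Fin d → ℤ)) {r : ℝ} (hr : 0 < r) (κ : ℝ) :
    μ.real (smallEvent L r F ξ κ)ᶜ ≤ (∫ ω, coeffSum L F ξ ω ^ 3 ∂μ) / r ^ 3 * |κ| ^ 3 := by
  have h1 := mul_meas_ge_le_integral_of_nonneg (μ := μ)
    (f := fun ω => |κ| ^ 3 * coeffSum L F ξ ω ^ 3)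
    (ae_of_all _ fun ω => by have := coeffSum_nonneg (ξ := ξ) hL F ω; positivity)
    ((hξ.integrable_cube hL F).const_mul _) (r ^ 3)
  rw [integral_const_mul] at h1
  have h2 : μ.real (smallEvent L r F ξ κ)ᶜ ≤
      μ.real {ω | r ^ 3 ≤ |κ| ^ 3 * coeffSum L F ξ ω ^ 3} := by
    refine measureReal_mono fun ω hω => ?_
    have h3 : r < |κ| * coeffSum L F ξ ω := not_le.1 hω
    change r ^ 3 ≤ |κ| ^ 3 * coeffSum L F ξ ω ^ 3
    rw [← mul_pow]
    gcongr
  refine h2.trans ?_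
  rw [div_mul_eq_mul_div, le_div_iff₀ (by positivity)]
  linarith

theorem IsDeltaCorrelated.nullMeasurableSet_smallEvent (hξ : IsDeltaCorrelated μ V γ ξ)
    (F : Finset (Fin d → ℤ)) (r κ : ℝ) : NullMeasurableSet (smallEvent L r F ξ κ) μ :=
  nullMeasurableSet_le
    ((hξ.memLp_coeffSum L F).aestronglyMeasurable.aemeasurable.const_mul |κ|) aemeasurable_const

end Moments

/-- The averaged lower bound for a random potential. -/
theorem JointEigenbasis.FractionBound.random {B : JointEigenbasis s N d L m w} {a : Fin d} {M : ℝ}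
    (hM : B.FractionBound a g M) (hM0 : 0 ≤ M) (hL : 0 < L) (hm : 0 < m)
    (hB : GappedGround (pert (sectorKinetic s N d L m) (sectorInteraction s N hw)) (B.groundVec hw)
      (B.energy B.ground) g) {r : ℝ} (hr : 0 < r) (hrg : 4 * (N * r) ≤ g)
    {Γ : Type*} [MeasurableSpace Γ] {μ : Measure Γ} [IsProbabilityMeasure μ] {γ : ℝ}
    {ξ : (Fin d → ℤ) → Γ → ℂ} (hξ : IsDeltaCorrelated μ (L ^ d) γ ξ) (F : Finset (Fin d → ℤ))
    (hF : ∀ k ∈ F, -k ∈ F) :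
    ∃ C, ∀ κ : ℝ, μ.real (smallEvent L r F ξ κ)ᶜ ≤ C * |κ| ^ 3 ∧
      IntegrableOn (fun ω => superfluidFraction s N d L m w a (trigPotential L F fun k => ξ k ω) κ)
        (smallEvent L r F ξ κ) μ ∧
      ∫ ω in smallEvent L r F ξ κ,
        superfluidFraction s N d L m w a (trigPotential L F fun k => ξ k ω) κ ∂μ ≥
          1 - 2 * (γ * κ) ^ 2 / (m * B.gap Set.univ ^ 3)
            * (1 / L ^ d * ∑ k ∈ F, waveVector L k a ^ 2 * B.structureFactor k) - C * |κ| ^ 3 := by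
  set T := ∫ ω, coeffSum L F ξ ω ^ 3 ∂μ with hT
  have hT0 : 0 ≤ T := integral_nonneg fun ω => pow_nonneg (coeffSum_nonneg hL F ω) 3
  have hV : (0 : ℝ) < L ^ d := by positivity
  have hΔ0 : 0 ≤ B.gap Set.univ := B.gap_nonneg hB Set.univ
  -- The first summand bounds the probability outside the event, the second the averaged third order
  -- error.
  refine ⟨T / r ^ 3 + M * T, fun κ => ?_⟩
  set G := smallEvent L r F ξ κ with hG
  have hcompl := hξ.measure_smallEvent_compl_le hL F hr κ
  have hGm : NullMeasurableSet G μ := hξ.nullMeasurableSet_smallEvent F r κ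
  set f : Γ → ℝ := fun ω =>
    superfluidFraction s N d L m w a (trigPotential L F fun k => ξ k ω) κ with hf
  have hbound : ∀ ω ∈ G, _ := fun ω (hω : ω ∈ G) =>
    hM _ (isPotential_trigPotential hL F fun k => ξ k ω) κ (|κ| * coeffSum L F ξ ω)
      (mul_nonneg (abs_nonneg _) (coeffSum_nonneg hL F ω))
      (fun x => by
        rw [abs_mul]
        exact mul_le_mul_of_nonneg_left (norm_trig_le hL F (fun k => ξ k ω) x) (abs_nonneg _))
      (by
        have h1 : |κ| * coeffSum L F ξ ω ≤ r := hω
        refine le_trans ?_ hrg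
        gcongr)
  have hmeas : AEStronglyMeasurable f (μ.restrict G) := by
    have hξm : AEMeasurable (fun ω => fun k => ξ k ω) μ :=
      aemeasurable_pi_lambda _ fun k => (hξ.memLp k).aestronglyMeasurable.aemeasurable
    have hE : ∀ v, AEMeasurable (fun ω =>
        wallEnergy s N d L m w a (trigPotential L F fun k => ξ k ω) κ v) μ := fun v =>
      (continuous_wallEnergy_trig hL hm hw B a F κ v).measurable.comp_aemeasurable hξm
    have hq : AEStronglyMeasurable (fun ω =>
        quadraticCoeff (wallEnergy s N d L m w a (trigPotential L F fun k => ξ k ω) κ))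
        (μ.restrict G) := by
      -- `quadraticCoeff` is a `limUnder`. On the event the limit exists, and it is reached along `v
      -- = 1/(n + 1)` by measurable difference quotients.
      refine aestronglyMeasurable_of_tendsto_ae atTop (f := fun (n : ℕ) ω =>
        (wallEnergy s N d L m w a (trigPotential L F fun k => ξ k ω) κ (1 / ((n : ℝ) + 1)) -
          wallEnergy s N d L m w a (trigPotential L F fun k => ξ k ω) κ 0) /
          (1 / ((n : ℝ) + 1)) ^ 2) (fun n => ?_) ?_
      · exact (((hE _).sub (hE 0)).div_const _).aestronglyMeasurable.restrict
      · refine (ae_restrict_iff'₀ hGm).2 (ae_of_all _ fun ω hω => ?_)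
        have h1 := (hbound ω hω).1
        have h2 := tendsto_of_quartic (E := wallEnergy s N d L m w a
          (trigPotential L F fun k => ξ k ω) κ) (t := -quadraticCoeff (wallEnergy s N d L m w a
          (trigPotential L F fun k => ξ k ω) κ))
          (by simpa only [neg_mul, ← sub_eq_add_neg] using h1)
        rw [neg_neg] at h2
        refine h2.comp (tendsto_nhdsWithin_iff.2 ⟨tendsto_one_div_add_atTop_nhds_zero_nat,
          Eventually.of_forall fun n => ?_⟩)
        have : (0 : ℝ) < 1 / ((n : ℝ) + 1) := by positivity
        exact this.ne'
    exact (hq.const_mul (2 / (N * m))).const_add 1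
  have hint : IntegrableOn f G μ := by
    refine Integrable.of_mem_Icc (1 - M * r ^ 2) 1 hmeas.aemeasurable
      ((ae_restrict_iff'₀ hGm).2 (ae_of_all _ fun ω hω => ⟨?_, (hbound ω hω).2.1⟩))
    refine le_trans ?_ (hbound ω hω).2.2.1
    have h1 : |κ| * coeffSum L F ξ ω ≤ r := hω
    have h2 : 0 ≤ |κ| * coeffSum L F ξ ω := mul_nonneg (abs_nonneg _) (coeffSum_nonneg hL F ω)
    gcongr
  have hκ3 : 0 ≤ |κ| ^ 3 := by positivity
  refine ⟨?_, hint, ?_⟩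
  · refine hcompl.trans ?_
    gcongr
    exact le_add_of_nonneg_right (mul_nonneg hM0 hT0)
  set A := 2 * κ ^ 2 / (m * B.gap Set.univ ^ 3) with hA
  have hA0 : 0 ≤ A := by positivity
  -- The loss in the lower bound. It is nonnegative everywhere, so its integral over the event is at
  -- most its full average, which the second and third moments determine.
  set q : Γ → ℝ := fun ω => A * ∑ k ∈ F,
    (waveVector L k a ^ 2 * B.structureFactor k / (L ^ d) ^ 2) * ‖ξ k ω‖ ^ 2 +
      M * |κ| ^ 3 * coeffSum L F ξ ω ^ 3 with hq
  have hsumint : Integrable (fun ω => ∑ k ∈ F,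
      (waveVector L k a ^ 2 * B.structureFactor k / (L ^ d) ^ 2) * ‖ξ k ω‖ ^ 2) μ :=
    integrable_finsetSum F fun k _ => (hξ.integrable_sq k).const_mul _
  have hqint : Integrable q μ :=
    (hsumint.const_mul A).add ((hξ.integrable_cube hL F).const_mul _)
  have hq0 : ∀ ω, 0 ≤ q ω := fun ω => by
    have h1 := coeffSum_nonneg (ξ := ξ) hL F ω
    refine add_nonneg (mul_nonneg hA0 (Finset.sum_nonneg fun k _ => ?_)) (by positivity)
    have h2 := B.structureFactor_nonneg k
    positivity
  have hconj : ∀ᵐ ω ∂μ, ∀ k, ξ (-k) ω = (starRingEnd ℂ) (ξ k ω) := ae_all_iff.2 hξ.conj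
  have hlow : ∀ᵐ ω ∂μ.restrict G, 1 - q ω ≤ f ω := by
    refine (ae_restrict_iff'₀ hGm).2 ?_
    filter_upwards [hconj] with ω hω hωG
    have h1 := (hbound ω hωG).2.2.2 (B.gap Set.univ) fun i hi _ =>
      B.gap_support hB hi (Set.mem_univ _)
    rw [tsum_trig hL B a F hF _ fun k _ => hω k, mul_pow |κ|] at h1
    refine le_trans (le_of_eq ?_) h1
    rw [hq, hA]
    ring
  have h1 : ∫ ω in G, (1 - q ω) ∂μ ≤ ∫ ω in G, f ω ∂μ :=
    integral_mono_ae ((integrable_const 1).sub hqint.integrableOn) hint hlow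
  have h2 : ∫ ω in G, (1 - q ω) ∂μ = μ.real G - ∫ ω in G, q ω ∂μ := by
    rw [integral_sub (integrable_const 1) hqint.integrableOn, setIntegral_const, smul_eq_mul,
      mul_one]
  have h3 : ∫ ω in G, q ω ∂μ ≤ ∫ ω, q ω ∂μ :=
    setIntegral_le_integral hqint (ae_of_all _ hq0)
  have h4 : ∫ ω, q ω ∂μ = A * ∑ k ∈ F,
      (waveVector L k a ^ 2 * B.structureFactor k / (L ^ d) ^ 2) * (γ ^ 2 * L ^ d) +
        M * |κ| ^ 3 * T := by
    rw [hq, integral_add (hsumint.const_mul A) ((hξ.integrable_cube hL F).const_mul _),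
      integral_const_mul, integral_const_mul, integral_finsetSum]
    · simp only [integral_const_mul, hξ.integral_sq, hT]
    · exact fun k _ => (hξ.integrable_sq k).const_mul _
  have h5 : A * ∑ k ∈ F,
      (waveVector L k a ^ 2 * B.structureFactor k / (L ^ d) ^ 2) * (γ ^ 2 * L ^ d) =
      2 * (γ * κ) ^ 2 / (m * B.gap Set.univ ^ 3)
        * (1 / L ^ d * ∑ k ∈ F, waveVector L k a ^ 2 * B.structureFactor k) := by
    have e : ∀ k ∈ F, (waveVector L k a ^ 2 * B.structureFactor k / (L ^ d) ^ 2) *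
        (γ ^ 2 * L ^ d) = γ ^ 2 * (1 / L ^ d) * (waveVector L k a ^ 2 * B.structureFactor k) := by
      intro k _
      field_simp
    rw [Finset.sum_congr rfl e, ← Finset.mul_sum, hA]
    ring
  -- Subadditivity is enough, although the event is only null measurable.
  have h6 : 1 ≤ μ.real G + μ.real Gᶜ := by
    have := measureReal_union_le (μ := μ) G Gᶜ
    rwa [Set.union_compl_self, probReal_univ] at this
  rw [ge_iff_le, ← h5, add_mul]
  linarith

end Random

end Superfluid

end

/-! ### Assembly of the theorem. -/

open Superfluid in
theorem mainTheorem3 (s : Statistics) (N d : ℕ) (hN : 0 < N) (a : Fin d) (L m : ℝ) (hL : 0 < L)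
    (hm : 0 < m) (w : (Fin d → ℝ) → ℝ) (hw : Continuous w) (hw_per : BoxPeriodic L w)
    (hw_even : ∀ x, w (-x) = w x)
    (hground : HasUniqueGroundState s (freeHamiltonian N d L m w)) :
    Nonempty (JointEigenbasis s N d L m w) ∧
    ∃ r > 0,
      -- the superfluid fraction is well defined as long as `|κ u| ≤ r`
      (∀ u, IsPotential L u → ∀ κ : ℝ, (∀ x, |κ * u x| ≤ r) →
        (fun v => wallEnergy s N d L m w a u κ v - wallEnergy s N d L m w a u κ 0
            - quadraticCoeff (wallEnergy s N d L m w a u κ) * v ^ 2)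
          =O[𝓝 0] fun v => v ^ 4) ∧
      ∀ B : JointEigenbasis s N d L m w,
        -- excitation gaps are positive
        (∀ K, (B.excitations K).Nonempty → 0 < B.gap K) ∧
        -- general potential
        (∀ u, IsPotential L u →
          (Summable fun k : Fin d → ℤ =>
            (waveVector L k a * ‖fourierPotential L u k‖ / L ^ d) ^ 2 * B.structureFactor k) ∧
          (∃ C, ∀ᶠ κ in 𝓝 (0 : ℝ),
            superfluidFraction s N d L m w a u κ ≥
              1 - 2 * κ ^ 2 / (m * B.gap (Function.support (fourierPotential L u)) ^ 3)
                * ∑' k : Fin d → ℤ, (waveVector L k a * ‖fourierPotential L u k‖ / L ^ d) ^ 2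
                    * B.structureFactor k
              - C * |κ| ^ 3) ∧
          Tendsto (superfluidFraction s N d L m w a u) (𝓝 0) (𝓝 1)) ∧
        -- periodic potential `u₀ cos (p·x)`
        (∀ (u₀ : ℝ) (p : Fin d → ℤ),
          ∃ C, ∀ᶠ κ in 𝓝 (0 : ℝ),
            superfluidFraction s N d L m w a
                (fun x => u₀ * Real.cos (∑ i, waveVector L p i * x i)) κ ≥
              1 - (waveVector L p a * u₀ * κ) ^ 2 / (m * B.gap {p} ^ 3) * B.structureFactor p
              - C * |κ| ^ 3) ∧
        -- random potential, averaged over the realisations within the range of validity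
        (∀ (Γ : Type*) [MeasurableSpace Γ] (μ : Measure Γ) [IsProbabilityMeasure μ] (γ : ℝ)
          (ξ : (Fin d → ℤ) → Γ → ℂ), IsDeltaCorrelated μ (L ^ d) γ ξ →
          ∀ F : Finset (Fin d → ℤ), (∀ k ∈ F, -k ∈ F) →
          ∃ C, ∀ κ : ℝ,
            μ.real (smallEvent L r F ξ κ)ᶜ ≤ C * |κ| ^ 3 ∧
            IntegrableOn (fun ω =>
              superfluidFraction s N d L m w a (trigPotential L F fun k => ξ k ω) κ)
              (smallEvent L r F ξ κ) μ ∧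
            ∫ ω in smallEvent L r F ξ κ,
                superfluidFraction s N d L m w a (trigPotential L F fun k => ξ k ω) κ ∂μ ≥
              1 - 2 * (γ * κ) ^ 2 / (m * B.gap Set.univ ^ 3)
                * (1 / L ^ d * ∑ k ∈ F, waveVector L k a ^ 2 * B.structureFactor k)
              - C * |κ| ^ 3) := by
  obtain ⟨b, hb⟩ := hw_per.exists_bound hL hw
  have hwI : IsInteraction L w := ⟨hw, hw_per, hw_even, b, hb⟩
  obtain ⟨Ω, g, hΩ⟩ := exists_gappedGround hL hm hwI hground
  have hg := hΩ.gap_pos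
  have hN' : (0 : ℝ) < N := by exact_mod_cast hN
  -- With `r = g/(4N)` the perturbation `κU` has norm at most `g/4`, the threshold for the
  -- persistence of the gap.
  have hrg : 4 * (N * (g / (4 * N))) ≤ g := by
    field_simp
    exact le_rfl
  have hr : 0 < g / (4 * N) := by positivity
  have hex := exists_jointEigenbasis hL hm hwI hground
  refine ⟨hex, g / (4 * N), hr, fun u hu κ hκ => ?_, fun B => ?_⟩
  · obtain ⟨B⟩ := hex
    obtain ⟨M, -, hM⟩ := B.exists_fractionBound hL hm hN a (B.gappedGround hL hm hwI hΩ)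
    exact (hM u hu κ _ hr.le hκ hrg).1
  · have hB := B.gappedGround hL hm hwI hΩ
    obtain ⟨M, hM0, hM⟩ := B.exists_fractionBound hL hm hN a hB
    refine ⟨fun K hK => B.gap_pos hB hK, fun u hu => ?_, fun u₀ p => hM.cos hL hm hB u₀ p, ?_⟩
    · obtain ⟨h1, h2⟩ := hM.general hL hN hm hB hu
      exact ⟨h1, h2, hM.tendsto hg hL hu⟩
    · intro Γ _ μ _ γ ξ hξ F hF
      exact hM.random hM0 hL hm hB hr hrg hξ F hF
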